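/- A twofold triple system $\mathrm{TTS}(v)$ is a pair $(V,\mathcal{B})$, where $V$ is a set of $v$ points and $\mathcal{B}$ is a collection (repetitions allowed) of $3$-element subsets of $V$, called blocks, such that every $2$-element subset of $V$ is contained in exactly two blocks of $\mathcal{B}$ (counted with multiplicity). Its $2$-block-intersection graph has the blocks in $\mathcal{B}$ as vertices (one vertex for each occurrence of a block), two of them being adjacent if and only if the blocks have exactly two points in common; the graph is Hamiltonian if it has a cycle through all of its vertices. A cyclic $2$-intersecting Gray code for $(V,\mathcal{B})$ is a cyclic arrangement of all the blocks in $\mathcal{B}$, each occurrence used exactly once, in which any two cyclically consecutive blocks have exactly two points in common. Theorem. Let $v \geq 3$ be an integer. There exists a $\mathrm{TTS}(v)$ whose $2$-block-intersection graph is Hamiltonian if and only if $v \equiv 0$ or $1 \pmod 3$ and $v \notin \{3,6\}$. Likewise, there exists a $\mathrm{TTS}(v)$ with a cyclic $2$-intersecting Gray code if and only if $v \equiv 0$ or $1 \pmod 3$ and $v \notin \{3,6\}$. -/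

import Mathlib

/-- `IsBIBD V B v k lam`: the finite point set `V` together with the collection of blocks `B` is a
balanced incomplete block design BIBD(`v`, `k`, `lam`).  The blocks form a multiset, so repeated
blocks are allowed and are counted with multiplicity. -/
structure IsBIBD (V : Type) [Fintype V] [DecidableEq V] (B : Multiset (Finset V))
    (v k lam : ℕ) : Prop where
  card_points : Fintype.card V = v
  card_block : ∀ b ∈ B, b.card = k
  pair_count : ∀ p : Finset V, p.card = 2 → B.countP (fun b => p ⊆ b) = lam

/-- A twofold triple system TTS(`v`) is a BIBD(`v`, 3, 2). -/
def IsTTS (V : Type) [Fintype V] [DecidableEq V] (B : Multiset (Finset V)) (v : ℕ) : Prop :=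
  IsBIBD V B v 3 2

instance blockDecidableEq {V : Type} [DecidableEq V] (B : Multiset (Finset V)) :
    DecidableEq B.ToType :=
  inferInstanceAs (DecidableEq (Σ b : Finset V, Fin (B.count b)))

/-- The `i`-block-intersection graph: its vertices are the blocks (the type `B.ToType` has one
element for each occurrence of a block in the multiset `B`), and two distinct vertices are adjacent
when the corresponding blocks share exactly `i` points. -/
def blockIntersectionGraph {V : Type} [DecidableEq V] (B : Multiset (Finset V)) (i : ℕ) :
    SimpleGraph B.ToType where
  Adj b c := b ≠ c ∧ (b.1 ∩ c.1).card = i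
  symm := ⟨fun _ _ h => ⟨h.1.symm, by rw [Finset.inter_comm]; exact h.2⟩⟩
  loopless := ⟨fun _ h => h.1 rfl⟩

/-- A cyclic `κ`-intersecting Gray code of a design with blocks `B`: a cyclic arrangement of all the
blocks, each used as often as it occurs in `B`, in which any two cyclically consecutive blocks share
exactly `κ` points. -/
def IsCyclicGrayCode {V : Type} [DecidableEq V] (B : Multiset (Finset V)) (κ : ℕ)
    (c : Cycle (Finset V)) : Prop :=
  c.toMultiset = B ∧ c.Chain (fun b b' => (b ∩ b').card = κ)

/-! Necessity. Counting pairs inside blocks gives 3|B| = v(v-1), hence v ≡ 0 or 1 mod 3. On three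
points both blocks are the whole set. On six points there are ten blocks; a relabelling puts two
consecutive ones in standard position, and a finite search (`SixPoints.search_eq_true`) shows that
no sequence of ten triples covering each pair at most twice closes up.

Sufficiency. Gray codes give Hamiltonian cycles, because triples meeting in exactly two points are
distinct vertices; so only Gray codes need constructing. By double counting, v(v-1)/3 sets of size
at most three that cover every pair at least twice form a TTS (`card_eq_and_count_eq_of_cover`). If
cyclic neighbours share two points, they cannot coincide, since the pair shared with the next block
would then be covered three times (`HasGrayTTS.of_list`). Hence only lower bounds ever need
checking.

For v = 3m+1, and for v = 3m with m odd, the points are three copies of Z_m, plus a fixed point in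
the first case (`Theta.hasGrayTTS`). A strand between two levels runs through all mixed differences
in the order 0, 1, -1, 2, … or an affine image of it. Each block carries two consecutive mixed
differences and one pure difference, on whichever level moves. The moving levels are chosen so that
every level receives each nonzero residue once, which covers each pair of opposite pure differences
twice. A few extra blocks cover the end differences of the strands a second time. The base blocks
form a path leading to a translate of its first block by a unit, so m translates of the path close
into a cycle (`HasGrayTTS.of_base_blocks`).

For v = 6t+6 the points are Z_n and ∞, with n = 6t+5. The blocks {∞, y, y+d}, d = 3t+2, form one
ring. The others form a second ring, each being the union of two consecutive pairs in a cyclically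
developed sequence of pairs (`Rotational.hasGrayTTS`). The second ring is cut and reconnected
through its remaining shared pairs into a path whose ends fit a gap in the first ring
(`exists_rearrangement_two`, `exists_rearrangement_three`). The orders 4, 7, 9, 12, 18, 24, 30 have
explicit codes. -/

/-! ### Gray codes versus Hamiltonian cycles. -/

/-- A permutation of the image of a list lifts to a permutation of the list. -/
theorem List.Perm.exists_perm_map_eq {α β : Type*} (f : α → β) {l₁ l₂ : List β} (h : l₁.Perm l₂) :
    ∀ u : List α, u.map f = l₁ → ∃ u' : List α, u'.Perm u ∧ u'.map f = l₂ := by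
  induction h with
  | nil => exact fun u hu => ⟨u, .refl _, hu⟩
  | cons x _ ih =>
    rintro (_ | ⟨a, u⟩) hu
    · simp at hu
    · simp only [List.map_cons, List.cons.injEq] at hu
      obtain ⟨u', h1, h2⟩ := ih u hu.2
      exact ⟨a :: u', h1.cons a, by simp [hu.1, h2]⟩
  | swap x y l =>
    rintro (_ | ⟨a, _ | ⟨b, u⟩⟩) hu
    · simp at hu
    · simp at hu
    · simp only [List.map_cons, List.cons.injEq] at hu
      exact ⟨b :: a :: u, .swap a b u, by simp [hu]⟩
  | trans _ _ ih₁ ih₂ =>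
    intro u hu
    obtain ⟨u', h1, h2⟩ := ih₁ u hu
    obtain ⟨u'', h3, h4⟩ := ih₂ u' h2
    exact ⟨u'', h3.trans h1, h4⟩

/-- A cyclic chain of adjacent vertices that visits every vertex once gives a Hamiltonian cycle. -/
theorem SimpleGraph.IsHamiltonian.of_cycle_chain {α : Type*} [Fintype α] [DecidableEq α]
    (G : SimpleGraph α) (l : List α) (hl : l.Perm Finset.univ.toList) (h3 : 3 ≤ l.length)
    (hc : (l : Cycle α).Chain G.Adj) : G.IsHamiltonian := by
  intro _
  obtain _ | ⟨a, l⟩ := l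
  · simp at h3
  rw [Cycle.chain_coe_cons] at hc
  have hnd : (a :: l).Nodup := hl.nodup_iff.2 (Finset.nodup_toList _)
  let w := (SimpleGraph.Walk.ofSupport _ (List.cons_ne_nil _ _) hc).copy (u' := a) (v' := a)
    rfl (by simp)
  have hsup : w.support = a :: (l ++ [a]) :=
    (SimpleGraph.Walk.support_copy _ _ _).trans (SimpleGraph.Walk.support_ofSupport _ _)
  have hnil : ¬ w.Nil := by
    intro hn
    have := congrArg List.length (SimpleGraph.Walk.nil_iff_support_eq.1 hn)
    simp [hsup] at this
  have htail : w.tail.support = l ++ [a] := by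
    rw [SimpleGraph.Walk.support_tail_of_not_nil _ hnil, hsup]; rfl
  have hperm : (l ++ [a]).Perm (a :: l) := List.perm_append_singleton a l
  refine ⟨a, w, (SimpleGraph.Walk.isHamiltonianCycle_isCycle_and_isHamiltonian_tail).2 ⟨?_, ?_⟩⟩
  · rw [SimpleGraph.Walk.isCycle_iff_isPath_tail_and_le_length, SimpleGraph.Walk.isPath_def, htail]
    refine ⟨hperm.nodup_iff.2 hnd, ?_⟩
    have := w.length_support
    rw [hsup] at this
    simp at this h3
    omega
  · intro b
    rw [htail, hperm.count_eq, hl.count_eq]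
    exact List.count_eq_one_of_mem (Finset.nodup_toList _) (by simp)

/-- A Hamiltonian graph with at least two vertices has a cyclic chain of adjacent vertices that
visits every vertex once. -/
theorem SimpleGraph.IsHamiltonian.exists_cycle_chain {α : Type*} [Fintype α] [DecidableEq α]
    {G : SimpleGraph α} (hG : G.IsHamiltonian) (h1 : Fintype.card α ≠ 1) :
    ∃ l : List α, l.Perm Finset.univ.toList ∧ (l : Cycle α).Chain G.Adj := by
  obtain ⟨a, w, hw⟩ := hG h1
  have hcount := (SimpleGraph.Walk.isHamiltonianCycle_iff_isCycle_and_support_count_tail_eq_one).1 hw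
  refine ⟨w.support.tail, ?_, ?_⟩
  · rw [List.perm_iff_count]
    intro b
    rw [hcount.2 b, List.count_eq_one_of_mem (Finset.nodup_toList _) (by simp)]
  · have hne : w.support.tail ≠ [] := by
      intro h
      have := hcount.2 a
      simp [h] at this
    rw [Cycle.chain_ne_nil _ hne]
    have : w.support.tail.getLast hne = a := by
      rw [List.getLast_tail, SimpleGraph.Walk.getLast_support]
    rw [this, SimpleGraph.Walk.cons_tail_support]
    exact w.isChain_adj_support

section

variable {V : Type} [DecidableEq V]

/-- A cyclic Gray code of triples with intersections of size two gives a Hamiltonian cycle of the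
2-block-intersection graph. -/
theorem IsCyclicGrayCode.isHamiltonian {B : Multiset (Finset V)} {c : Cycle (Finset V)}
    (hc : IsCyclicGrayCode B 2 c) (hB : ∀ b ∈ B, b.card = 3) (h3 : 3 ≤ Multiset.card B) :
    (blockIntersectionGraph B 2).IsHamiltonian := by
  obtain ⟨hcB, hch⟩ := hc
  induction c using Quotient.inductionOn' with | h l => ?_
  change ((l : Cycle (Finset V)).toMultiset) = B at hcB
  change (l : Cycle (Finset V)).Chain _ at hch
  rw [Cycle.coe_toMultiset] at hcB
  have hp : ((Finset.univ : Finset B.ToType).toList.map (fun x => x.1)).Perm l := by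
    rw [← Multiset.coe_eq_coe, hcB, ← Multiset.map_coe, Finset.coe_toList]
    exact Multiset.map_univ_coe B
  obtain ⟨u, hu, rfl⟩ := hp.exists_perm_map_eq _ _ rfl
  refine SimpleGraph.IsHamiltonian.of_cycle_chain _ u hu ?_ ?_
  · rw [hu.length_eq, Finset.length_toList, Finset.card_univ, Multiset.card_coe]; exact h3
  · rw [← Cycle.map_coe, Cycle.chain_map] at hch
    refine hch.imp fun a b hab => ⟨?_, hab⟩
    -- Equal vertices would carry one triple, which meets itself in three points.
    rintro rfl
    rw [Finset.inter_self, hB a.1 Multiset.coe_mem] at hab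
    omega

/-- A Hamiltonian cycle of the 2-block-intersection graph gives a cyclic Gray code. -/
theorem exists_isCyclicGrayCode_of_isHamiltonian {B : Multiset (Finset V)}
    (h1 : Multiset.card B ≠ 1) (hB : (blockIntersectionGraph B 2).IsHamiltonian) :
    ∃ c, IsCyclicGrayCode B 2 c := by
  obtain ⟨l, hl, hc⟩ := hB.exists_cycle_chain (by rwa [Multiset.card_coe])
  refine ⟨(l : Cycle B.ToType).map (fun x => x.1), ?_, ?_⟩
  · rw [Cycle.map_coe, Cycle.coe_toMultiset, ← Multiset.map_coe, Multiset.coe_eq_coe.2 hl,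
      Finset.coe_toList]
    exact Multiset.map_univ_coe B
  · rw [Cycle.chain_map]
    exact hc.imp fun a b hab => hab.2

end

/-! ### A counting criterion for twofold triple systems with a Gray code. -/

/-- There is a twofold triple system on `v` points with a cyclic 2-intersecting Gray code. -/
def HasGrayTTS (v : ℕ) : Prop :=
  ∃ (V : Type) (_ : Fintype V) (_ : DecidableEq V) (B : Multiset (Finset V)),
    IsTTS V B v ∧ ∃ c : Cycle (Finset V), IsCyclicGrayCode B 2 c

/-- The cyclic chain condition in terms of indices. -/
theorem Cycle.chain_iff_getElem {α : Type*} (r : α → α → Prop) (l : List α) :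
    (l : Cycle α).Chain r ↔
      ∀ (i : ℕ) (h : i < l.length), r l[i] (l[(i + 1) % l.length]'(Nat.mod_lt _ (by omega))) := by
  obtain _ | ⟨a, l⟩ := l
  · simp
  rw [Cycle.chain_coe_cons, List.isChain_iff_getElem]
  have key : ∀ (i : ℕ) (h : i < (a :: l).length) (h' : i + 1 < (a :: (l ++ [a])).length),
      (a :: (l ++ [a]))[i] = (a :: l)[i] ∧
      (a :: (l ++ [a]))[i + 1] = (a :: l)[(i + 1) % (a :: l).length]'(Nat.mod_lt _ (by simp)) := by
    intro i h h'
    constructor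
    · simp only [← List.cons_append]
      rw [List.getElem_append_left]
    · rcases Nat.lt_or_ge (i + 1) (a :: l).length with hi | hi
      · simp only [Nat.mod_eq_of_lt hi, ← List.cons_append]
        rw [List.getElem_append_left]
      · have hi' : i + 1 = (a :: l).length := by omega
        simp only [hi', Nat.mod_self, ← List.cons_append]
        rw [List.getElem_append_right (by simp)]
        simp
  constructor
  · intro H i h
    have h' : i + 1 < (a :: (l ++ [a])).length := by simp at h ⊢; omega
    have := H i h'
    rw [(key i h h').1, (key i h h').2] at this
    exact this
  · intro H i h'
    have h : i < (a :: l).length := by simp at h' ⊢; omega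
    have := H i h
    rw [← (key i h h').1, ← (key i h h').2] at this
    exact this

/-- Two sets share two distinct points. -/
def SharePair {V : Type} (A B : Finset V) : Prop :=
  ∃ x y, x ≠ y ∧ x ∈ A ∧ y ∈ A ∧ x ∈ B ∧ y ∈ B

theorem SharePair.symm {V : Type} {A B : Finset V} (h : SharePair A B) : SharePair B A := by
  obtain ⟨x, y, h0, h1, h2, h3, h4⟩ := h
  exact ⟨x, y, h0, h3, h4, h1, h2⟩

section criterion

variable {V ι : Type} [Fintype V] [DecidableEq V]

/-- Double counting: a family of `v(v-1)/3` sets of size at most three that covers every pair at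
least twice consists of triples and covers every pair exactly twice. -/
theorem card_eq_and_count_eq_of_cover (s : Finset ι) (f : ι → Finset V)
    (hN : 3 * s.card = Fintype.card V * (Fintype.card V - 1))
    (hcard : ∀ i ∈ s, (f i).card ≤ 3)
    (hcov : ∀ x y, x ≠ y → ∃ i ∈ s, ∃ j ∈ s, i ≠ j ∧ x ∈ f i ∧ y ∈ f i ∧ x ∈ f j ∧ y ∈ f j) :
    (∀ i ∈ s, (f i).card = 3) ∧
      ∀ p : Finset V, p.card = 2 → (s.filter (fun i => p ⊆ f i)).card = 2 := by
  classical
  have hdc := Finset.sum_card_bipartiteAbove_eq_sum_card_bipartiteBelow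
    (s := Finset.powersetCard 2 (Finset.univ : Finset V)) (t := s) (fun p i => p ⊆ f i)
  have hbelow : ∀ i ∈ s, (Finset.bipartiteBelow (fun p i => p ⊆ f i)
      (Finset.powersetCard 2 (Finset.univ : Finset V)) i).card = (f i).card.choose 2 := by
    intro i _
    rw [← Finset.card_powersetCard]
    congr 1
    ext p
    simp [Finset.bipartiteBelow, Finset.mem_powersetCard, and_comm]
  have habove : ∀ p ∈ Finset.powersetCard 2 (Finset.univ : Finset V),
      2 ≤ (Finset.bipartiteAbove (fun p i => p ⊆ f i) s p).card := by
    intro p hp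
    obtain ⟨x, y, hxy, rfl⟩ := Finset.card_eq_two.1 (Finset.mem_powersetCard.1 hp).2
    obtain ⟨i, hi, j, hj, hij, h1, h2, h3, h4⟩ := hcov x y hxy
    refine (Finset.card_pair hij).symm.le.trans ?_
    refine Finset.card_le_card ?_
    intro k hk
    simp only [Finset.mem_insert, Finset.mem_singleton] at hk
    simp only [Finset.bipartiteAbove, Finset.mem_filter, Finset.insert_subset_iff,
      Finset.singleton_subset_iff]
    rcases hk with rfl | rfl
    · exact ⟨hi, h1, h2⟩
    · exact ⟨hj, h3, h4⟩
  have hchoose : ∀ k ≤ 3, k.choose 2 ≤ 3 := by decide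
  rw [Finset.sum_congr rfl hbelow] at hdc
  have hle : ∑ i ∈ s, (f i).card.choose 2 ≤ ∑ i ∈ s, 3 :=
    Finset.sum_le_sum fun i hi => hchoose _ (hcard i hi)
  have hge : ∑ p ∈ Finset.powersetCard 2 (Finset.univ : Finset V), 2 ≤
      ∑ p ∈ Finset.powersetCard 2 (Finset.univ : Finset V),
        (Finset.bipartiteAbove (fun p i => p ⊆ f i) s p).card := Finset.sum_le_sum habove
  -- The lower bound by pairs and the upper bound by blocks have the same value, so equality holds
  -- term by term in both sums.
  have htot : ∑ p ∈ Finset.powersetCard 2 (Finset.univ : Finset V), 2 = ∑ i ∈ s, 3 := by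
    rw [Finset.sum_const, Finset.sum_const, Finset.card_powersetCard, Finset.card_univ,
      smul_eq_mul, smul_eq_mul, mul_comm s.card, hN, Nat.choose_two_right]
    exact Nat.div_mul_cancel (Nat.even_mul_pred_self _).two_dvd
  constructor
  · have := (Finset.sum_eq_sum_iff_of_le fun i hi => hchoose _ (hcard i hi)).1
      (le_antisymm hle (by omega))
    intro i hi
    have h3 : ∀ k ≤ 3, k.choose 2 = 3 → k = 3 := by decide
    exact h3 _ (hcard i hi) (this i hi)
  · have := (Finset.sum_eq_sum_iff_of_le habove).1 (le_antisymm hge (by omega))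
    intro p hp
    exact (this p (Finset.mem_powersetCard.2 ⟨Finset.subset_univ _, hp⟩)).symm

/-- Criterion for a cyclically arranged indexed family of sets to give a twofold triple system with
a Gray code. -/
theorem HasGrayTTS.of_list {v : ℕ} (hv : Fintype.card V = v) (l : List ι) (hl : l.Nodup)
    (hlen : 3 ≤ l.length) (f : ι → Finset V) (hN : 3 * l.length = v * (v - 1))
    (hcard : ∀ i ∈ l, (f i).card ≤ 3)
    (hcov : ∀ x y, x ≠ y → ∃ i ∈ l, ∃ j ∈ l, i ≠ j ∧ x ∈ f i ∧ y ∈ f i ∧ x ∈ f j ∧ y ∈ f j)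
    (hchain : (∀ i ∈ l, (f i).card = 3) →
      (l : Cycle ι).Chain (fun i j => SharePair (f i) (f j))) : HasGrayTTS v := by
  classical
  obtain ⟨h3, h2⟩ := card_eq_and_count_eq_of_cover l.toFinset f
    (by rw [List.toFinset_card_of_nodup hl, hN, hv]) (by simpa using hcard) (by simpa using hcov)
  have h3' : ∀ i ∈ l, (f i).card = 3 := by simpa using h3
  have hchain := hchain h3'
  refine ⟨V, inferInstance, inferInstance, ((l.map f : List (Finset V)) : Multiset (Finset V)),
    ⟨hv, ?_, ?_⟩, ((l : Cycle ι).map f), ?_, ?_⟩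
  · intro b hb
    rw [Multiset.mem_coe, List.mem_map] at hb
    obtain ⟨i, hi, rfl⟩ := hb
    exact h3' i hi
  · intro p hp
    rw [Multiset.coe_countP, List.countP_map, ← h2 p hp]
    rw [List.countP_eq_length_filter, ← List.toFinset_card_of_nodup (hl.filter _)]
    congr 1
    ext i
    simp
  · rw [Cycle.map_coe, Cycle.coe_toMultiset]
  · rw [Cycle.chain_map]
    rw [Cycle.chain_iff_getElem] at hchain ⊢
    intro i hi
    have hlt : ∀ k, k % l.length < l.length := fun k => Nat.mod_lt _ (by omega)
    have hmem : ∀ k (hk : k < l.length), l[k] ∈ l := fun k hk => List.getElem_mem hk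
    set A := f l[i] with hA
    set B := f (l[(i + 1) % l.length]'(hlt _)) with hB
    have hA3 : A.card = 3 := h3' _ (hmem i hi)
    have hB3 : B.card = 3 := h3' _ (hmem _ (hlt _))
    have hge : 2 ≤ (A ∩ B).card := by
      obtain ⟨x, y, hxy, h1, h2, h3, h4⟩ := hchain i hi
      rw [← Finset.card_pair hxy]
      refine Finset.card_le_card ?_
      intro z hz
      simp only [Finset.mem_insert, Finset.mem_singleton] at hz
      rcases hz with rfl | rfl
      · exact Finset.mem_inter.2 ⟨h1, h3⟩
      · exact Finset.mem_inter.2 ⟨h2, h4⟩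
    -- Otherwise neighbours A and B coincide. The pair that B shares with its successor then lies in
    -- three blocks, at positions i, i+1 and i+2, which are distinct modulo a length of at least
    -- three.
    by_contra hne
    have hle : (A ∩ B).card ≤ 3 := (Finset.card_le_card Finset.inter_subset_left).trans hA3.le
    have hAB : A = B := by
      have e1 : A ∩ B = A := Finset.eq_of_subset_of_card_le Finset.inter_subset_left (by omega)
      have e2 : A ∩ B = B := Finset.eq_of_subset_of_card_le Finset.inter_subset_right (by omega)
      rw [← e1, e2]
    obtain ⟨x, y, hxy, h1, h2', h3'', h4⟩ := hchain _ (hlt (i + 1))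
    have hcount := h2 {x, y} (Finset.card_pair hxy)
    have hk : ((i + 1) % l.length + 1) % l.length = (i + 2) % l.length := by
      rw [Nat.add_mod, Nat.mod_mod, ← Nat.add_mod]
    have hne01 : i ≠ (i + 1) % l.length := by
      rcases Nat.lt_or_ge (i + 1) l.length with h | h
      · rw [Nat.mod_eq_of_lt h]; omega
      · rw [show i + 1 = l.length by omega, Nat.mod_self]; omega
    have hne02 : i ≠ (i + 2) % l.length := by
      rcases Nat.lt_or_ge (i + 2) l.length with h | h
      · rw [Nat.mod_eq_of_lt h]; omega
      · rw [Nat.mod_eq_sub_mod h, Nat.mod_eq_of_lt (by omega)]; omega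
    have hne12 : (i + 1) % l.length ≠ (i + 2) % l.length := by
      rcases Nat.lt_or_ge (i + 2) l.length with h | h
      · rw [Nat.mod_eq_of_lt h, Nat.mod_eq_of_lt (by omega)]; omega
      · rw [Nat.mod_eq_sub_mod h, Nat.mod_eq_of_lt (by omega : i + 2 - l.length < _)]
        rcases Nat.lt_or_ge (i + 1) l.length with h | h
        · rw [Nat.mod_eq_of_lt h]; omega
        · rw [show i + 1 = l.length by omega, Nat.mod_self]; omega
    have inj : ∀ a (ha : a < l.length) b (hb : b < l.length), a ≠ b → l[a] ≠ l[b] :=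
      fun a ha b hb hab h => hab ((hl.getElem_inj_iff).1 h)
    have hsub : ({l[i], l[(i + 1) % l.length]'(hlt _), l[(i + 2) % l.length]'(hlt _)} : Finset ι) ⊆
        l.toFinset.filter (fun i => {x, y} ⊆ f i) := by
      intro k hk'
      simp only [Finset.mem_insert, Finset.mem_singleton] at hk'
      simp only [Finset.mem_filter, List.mem_toFinset, Finset.insert_subset_iff,
        Finset.singleton_subset_iff]
      rcases hk' with rfl | rfl | rfl
      · rw [← hA, hAB]; exact ⟨hmem _ _, h1, h2'⟩
      · exact ⟨hmem _ _, h1, h2'⟩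
      · simp only [hk] at h3'' h4
        exact ⟨hmem _ _, h3'', h4⟩
    have hc3 := Finset.card_le_card hsub
    rw [hcount, Finset.card_insert_of_notMem, Finset.card_pair] at hc3
    · omega
    · exact inj _ _ _ _ hne12
    · simp only [Finset.mem_insert, Finset.mem_singleton, not_or]
      exact ⟨inj _ _ _ _ hne01, inj _ _ _ _ hne02⟩

end criterion

/-! ### Necessity: divisibility and three points. -/

/-- Counting incidences of pairs and blocks. -/
theorem sum_countP_pair_eq {V : Type} [Fintype V] [DecidableEq V] (B : Multiset (Finset V)) :
    ∑ p ∈ Finset.powersetCard 2 (Finset.univ : Finset V), B.countP (fun b => p ⊆ b) =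
      (B.map fun b => b.card.choose 2).sum := by
  induction B using Multiset.induction_on with
  | empty => simp
  | cons b B ih =>
    simp only [Multiset.countP_cons, Finset.sum_add_distrib, ih, Multiset.map_cons,
      Multiset.sum_cons]
    rw [add_comm]
    congr 1
    rw [Finset.sum_boole, ← Finset.card_powersetCard, Nat.cast_id]
    congr 1
    ext p
    simp [Finset.mem_powersetCard, and_comm]

theorem IsTTS.three_mul_card {V : Type} [Fintype V] [DecidableEq V] {B : Multiset (Finset V)}
    {v : ℕ} (h : IsTTS V B v) : 3 * Multiset.card B = v * (v - 1) := by
  have h1 := sum_countP_pair_eq B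
  rw [Finset.sum_congr rfl (fun p hp => h.pair_count p (Finset.mem_powersetCard.1 hp).2),
    Finset.sum_const, Finset.card_powersetCard, Finset.card_univ, h.card_points,
    Multiset.map_congr rfl (fun b hb => by rw [h.card_block b hb]), Multiset.map_const',
    Multiset.sum_replicate, smul_eq_mul, smul_eq_mul, Nat.choose_two_right,
    Nat.div_mul_cancel (Nat.even_mul_pred_self _).two_dvd] at h1
  rw [h1, mul_comm]
  rfl

theorem IsTTS.mod_three {V : Type} [Fintype V] [DecidableEq V] {B : Multiset (Finset V)}
    {v : ℕ} (h : IsTTS V B v) : v ≡ 0 [MOD 3] ∨ v ≡ 1 [MOD 3] := by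
  have h1 := h.three_mul_card
  rcases v with _ | v
  · exact Or.inl rfl
  simp only [Nat.add_sub_cancel] at h1
  have h2 : 3 ∣ (v + 1) * v := ⟨_, h1.symm⟩
  rcases (Nat.Prime.dvd_mul Nat.prime_three).1 h2 with h3 | h3
  · exact Or.inl ((Nat.modEq_zero_iff_dvd).2 h3)
  · exact Or.inr (((Nat.modEq_zero_iff_dvd).2 h3).add_right 1)

/-- On three points all blocks coincide, so no two of them share exactly two points. -/
theorem IsTTS.ne_three_of_gray {V : Type} [Fintype V] [DecidableEq V] {B : Multiset (Finset V)}
    {v : ℕ} (h : IsTTS V B v) {c : Cycle (Finset V)} (hc : IsCyclicGrayCode B 2 c) : v ≠ 3 := by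
  rintro rfl
  have h1 := h.three_mul_card
  obtain ⟨hcB, hch⟩ := hc
  induction c using Quotient.inductionOn' with | h l => ?_
  change ((l : Cycle (Finset V)).toMultiset) = B at hcB
  change (l : Cycle (Finset V)).Chain _ at hch
  rw [Cycle.coe_toMultiset] at hcB
  subst hcB
  rw [Cycle.chain_iff_getElem] at hch
  rw [Multiset.coe_card] at h1
  have hl : l.length = 2 := by omega
  have huniv : ∀ i (hi : i < l.length), l[i] = Finset.univ := by
    intro i hi
    rw [← Finset.card_eq_iff_eq_univ, h.card_points]
    exact h.card_block _ (by simp)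
  have := hch 0 (by omega)
  rw [huniv, huniv, Finset.inter_self, Finset.card_univ, h.card_points] at this
  omega

/-! ### Necessity: exhaustive search on six points. -/

namespace SixPoints

/-- The bit mask of a subset of `Fin 6`. -/
def mask (b : Finset (Fin 6)) : ℕ := Nat.ofBits (fun i => decide (i ∈ b))

theorem testBit_mask (b : Finset (Fin 6)) (i : ℕ) :
    (mask b).testBit i = if h : i < 6 then decide ((⟨i, h⟩ : Fin 6) ∈ b) else false := by
  split_ifs with h
  · exact Nat.testBit_ofBits_lt _ _ h
  · exact Nat.testBit_ofBits_ge _ _ (by omega)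

theorem land_mask (b c : Finset (Fin 6)) : Nat.land (mask b) (mask c) = mask (b ∩ c) := by
  change mask b &&& mask c = mask (b ∩ c)
  apply Nat.eq_of_testBit_eq
  intro i
  rw [Nat.testBit_and, testBit_mask, testBit_mask, testBit_mask]
  split_ifs <;> simp

theorem mask_injective : Function.Injective mask := by
  intro b c h
  ext i
  have := congrArg (fun n => Nat.testBit n i) h
  simpa [testBit_mask] using this

theorem land_mask_eq_left (p b : Finset (Fin 6)) : Nat.land (mask p) (mask b) = mask p ↔ p ⊆ b := by
  rw [land_mask, mask_injective.eq_iff, Finset.inter_eq_left]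

/-- Bit masks of the pairs. -/
def pairMasks : List ℕ := [3, 5, 6, 9, 10, 12, 17, 18, 20, 24, 33, 34, 36, 40, 48]

/-- Bit masks of the triples. -/
def tripleMasks : List ℕ :=
  [7, 11, 13, 14, 19, 21, 22, 25, 26, 28, 35, 37, 38, 41, 42, 44, 49, 50, 52, 56]

/-- Membership in `pairMasks`, as a table look-up. -/
def isPairMask (n : ℕ) : Bool := Nat.beq (Nat.land 1 (Nat.shiftRight 282668995843688 n)) 1

/-- The set bits of the constant 282668995843688 are exactly the positions listed in `pairMasks`. -/
theorem isPairMask_mask : ∀ p : Finset (Fin 6), p.card = 2 → isPairMask (mask p) = true := by decide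

theorem mask_mem_tripleMasks : ∀ p : Finset (Fin 6), p.card = 3 → mask p ∈ tripleMasks := by decide

theorem exists_mask_eq_of_mem_pairMasks : ∀ q ∈ pairMasks, ∃ p : Finset (Fin 6),
    p.card = 2 ∧ mask p = q := by decide

/-- The triple `x` may be put in front of the list `l`: it shares a pair with the head, and no pair
is covered three times. -/
def admissible (x : ℕ) (l : List ℕ) : Bool :=
  l.head?.all (fun y => isPairMask (Nat.land x y)) &&
    pairMasks.all (fun q => !(Nat.beq (Nat.land q x) q) ||
      Nat.ble (l.countP (fun y => Nat.beq (Nat.land q y) q)) 1)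

/-- All admissible one-step extensions of the lists in `L`. -/
def extend (L : List (List ℕ)) : List (List ℕ) :=
  L.flatMap fun l => (tripleMasks.filter fun x => admissible x l).map (· :: l)

/-- Soundness of the search. If a pair lies in the new triple, then the triples already present can
contain it at most once, which is the bound tested by `admissible`. -/
theorem mem_extend {b c : Finset (Fin 6)} {l : List (Finset (Fin 6))} {L : List (List ℕ)}
    (hb : b.card = 3) (hbc : (b ∩ c).card = 2)
    (hcount : ∀ p : Finset (Fin 6), p.card = 2 →
      (b :: c :: l).countP (fun a => p ⊆ a) ≤ 2)
    (hl : (c :: l).map mask ∈ L) : (b :: c :: l).map mask ∈ extend L := by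
  rw [extend, List.mem_flatMap]
  refine ⟨_, hl, ?_⟩
  rw [List.mem_map]
  refine ⟨mask b, ?_, by simp⟩
  rw [List.mem_filter]
  refine ⟨mask_mem_tripleMasks b hb, ?_⟩
  rw [admissible, Bool.and_eq_true, List.all_eq_true]
  constructor
  · rw [List.map_cons, List.head?_cons, Option.all_some, land_mask]
    exact isPairMask_mask _ hbc
  · intro q hq
    obtain ⟨p, hp, rfl⟩ := exists_mask_eq_of_mem_pairMasks q hq
    have := hcount p hp
    rw [Bool.or_eq_true, Bool.not_eq_true', Nat.ble_eq, List.countP_map]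
    by_cases hpb : p ⊆ b
    · right
      rw [List.countP_cons_of_pos (by simpa using hpb)] at this
      refine le_trans (le_of_eq ?_) (Nat.le_of_succ_le_succ this)
      congr 1
      funext a
      rw [Bool.eq_iff_iff, Function.comp_apply, Nat.beq_eq, land_mask_eq_left, decide_eq_true_iff]
    · left
      rw [Bool.eq_false_iff, Ne, Nat.beq_eq, land_mask_eq_left]
      exact hpb

/-- The seed is {0,1,3} followed by {0,1,2}, as masks 11 and 7. Eight extensions produce all
admissible lists of ten triples, and the check says that none has a first triple sharing a pair with
the last triple, 7. -/
theorem search_eq_true :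
    ((extend (extend (extend (extend (extend (extend (extend (extend [[11, 7]])))))))).all
      fun l => !(isPairMask (Nat.land (l.headD 0) 7))) = true := by
  decide +kernel

/-- The sequence is built from its end: entries 8 and 9 are the seed, entries 7 down to 0 are
prepended, and adjacency of 9 with 0 contradicts the search. The covering bound is used only as "at
most twice". -/
theorem false_of_cyclic {c : Fin 10 → Finset (Fin 6)} (h3 : ∀ i, (c i).card = 3)
    (h2 : ∀ i, (c i ∩ c (i + 1)).card = 2)
    (hcount : ∀ p : Finset (Fin 6), p.card = 2 →
      (List.ofFn c).countP (fun a => p ⊆ a) ≤ 2)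
    (h8 : c 8 = {0, 1, 3}) (h9 : c 9 = {0, 1, 2}) : False := by
  have hc : List.ofFn c = [c 0, c 1, c 2, c 3, c 4, c 5, c 6, c 7, c 8, c 9] := by
    simp [List.ofFn_succ]
  rw [hc] at hcount
  -- A suffix inherits the bound on pair multiplicities, so every partial list passes the test.
  have hsub : ∀ l : List (Finset (Fin 6)),
      l <:+ [c 0, c 1, c 2, c 3, c 4, c 5, c 6, c 7, c 8, c 9] →
      ∀ p : Finset (Fin 6), p.card = 2 → l.countP (fun a => p ⊆ a) ≤ 2 :=
    fun l hl p hp => (hl.sublist.countP_le).trans (hcount p hp)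
  have m8 : [c 8, c 9].map mask ∈ [[11, 7]] := by rw [h8, h9]; decide
  have m7 := mem_extend (h3 7) (h2 7) (hsub _ (List.suffix_append [c 0, c 1, c 2, c 3, c 4, c 5, c 6] _)) m8
  have m6 := mem_extend (h3 6) (h2 6) (hsub _ (List.suffix_append [c 0, c 1, c 2, c 3, c 4, c 5] _)) m7
  have m5 := mem_extend (h3 5) (h2 5) (hsub _ (List.suffix_append [c 0, c 1, c 2, c 3, c 4] _)) m6
  have m4 := mem_extend (h3 4) (h2 4) (hsub _ (List.suffix_append [c 0, c 1, c 2, c 3] _)) m5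
  have m3 := mem_extend (h3 3) (h2 3) (hsub _ (List.suffix_append [c 0, c 1, c 2] _)) m4
  have m2 := mem_extend (h3 2) (h2 2) (hsub _ (List.suffix_append [c 0, c 1] _)) m3
  have m1 := mem_extend (h3 1) (h2 1) (hsub _ (List.suffix_append [c 0] _)) m2
  have m0 := mem_extend (h3 0) (h2 0) (hsub _ (List.suffix_append [] _)) m1
  have key := List.all_eq_true.1 search_eq_true _ m0
  have h7 : 7 = mask (c 9) := by rw [h9]; decide
  rw [List.map_cons, List.headD_cons, Bool.not_eq_true', h7, land_mask, Finset.inter_comm] at key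
  exact Bool.false_ne_true (key.symm.trans (isPairMask_mask _ (h2 9)))

end SixPoints

/-- Two triples that share a pair can be moved to any standard position by a relabelling. -/
theorem exists_equiv_map_eq {V : Type} [Fintype V] [DecidableEq V] (hV : Fintype.card V = 6)
    {b c : Finset V} (hb : b.card = 3) (hc : c.card = 3) (hbc : (b ∩ c).card = 2) :
    ∃ e : V ≃ Fin 6, b.map e.toEmbedding = {0, 1, 3} ∧ c.map e.toEmbedding = {0, 1, 2} := by
  obtain ⟨x, y, hxy, hi⟩ := Finset.card_eq_two.1 hbc
  have hb1 : (b \ c).card = 1 := by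
    have := Finset.card_sdiff_add_card_inter b c; omega
  have hc1 : (c \ b).card = 1 := by
    have := Finset.card_sdiff_add_card_inter c b; rw [Finset.inter_comm] at this; omega
  obtain ⟨z, hz⟩ := Finset.card_eq_one.1 hb1
  obtain ⟨w, hw⟩ := Finset.card_eq_one.1 hc1
  have hbe : b = {x, y, z} := by
    rw [← Finset.sdiff_union_inter b c, hz, hi]; ext; simp; tauto
  have hce : c = {x, y, w} := by
    rw [← Finset.sdiff_union_inter c b, Finset.inter_comm, hw, hi]; ext; simp; tauto
  have hzm : z ∈ b \ c := by simp [hz]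
  have hwm : w ∈ c \ b := by simp [hw]
  rw [Finset.mem_sdiff] at hzm hwm
  have hzx : z ≠ x := by rintro rfl; exact hzm.2 (by simp [hce])
  have hzy : z ≠ y := by rintro rfl; exact hzm.2 (by simp [hce])
  have hwx : w ≠ x := by rintro rfl; exact hwm.2 (by simp [hbe])
  have hwy : w ≠ y := by rintro rfl; exact hwm.2 (by simp [hbe])
  have hwz : w ≠ z := by rintro rfl; exact hwm.2 hzm.1
  let e₀ : V ≃ Fin 6 := Fintype.equivFinOfCardEq hV
  have hinj : Function.Injective ![e₀ x, e₀ y, e₀ w, e₀ z] := by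
    intro i j
    fin_cases i <;> fin_cases j <;> simp [hxy, hzx, hzy, hwx, hwy, hwz, hxy.symm, hzx.symm, hzy.symm,
      hwx.symm, hwy.symm, hwz.symm]
  have hinj' : Function.Injective ![(0 : Fin 6), 1, 2, 3] := by decide
  -- The symmetric group on six points is 4-transitive, so the two common points and the two private
  -- points can be sent to 0, 1, 2, 3.
  obtain ⟨g, hg⟩ := (Equiv.Perm.isMultiplyPretransitive (Fin 6) 4).exists_smul_eq
    ⟨_, hinj⟩ ⟨_, hinj'⟩
  have hg' : ∀ i : Fin 4, g (![e₀ x, e₀ y, e₀ w, e₀ z] i) = ![(0 : Fin 6), 1, 2, 3] i :=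
    fun i => DFunLike.congr_fun hg i
  have g0 := hg' 0
  have g1 := hg' 1
  have g2 := hg' 2
  have g3 := hg' 3
  simp at g0 g1 g2 g3
  refine ⟨e₀.trans g, ?_, ?_⟩
  · rw [hbe]; simp [Finset.map_insert, g0, g1, g3]
  · rw [hce]; simp [Finset.map_insert, g0, g1, g2]

/-- Ten blocks are forced, and transporting the code along a relabelling that normalises blocks 8
and 9 reduces the claim to the search. -/
theorem IsTTS.ne_six_of_gray {V : Type} [Fintype V] [DecidableEq V] {B : Multiset (Finset V)}
    {v : ℕ} (h : IsTTS V B v) {c : Cycle (Finset V)} (hc : IsCyclicGrayCode B 2 c) : v ≠ 6 := by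
  rintro rfl
  have h1 := h.three_mul_card
  obtain ⟨hcB, hch⟩ := hc
  induction c using Quotient.inductionOn' with | h l => ?_
  change ((l : Cycle (Finset V)).toMultiset) = B at hcB
  change (l : Cycle (Finset V)).Chain _ at hch
  rw [Cycle.coe_toMultiset] at hcB
  subst hcB
  rw [Cycle.chain_iff_getElem] at hch
  rw [Multiset.coe_card] at h1
  have hl : l.length = 10 := by omega
  have h3 : ∀ i (hi : i < l.length), l[i].card = 3 := fun i hi => h.card_block _ (by simp)
  let c : Fin 10 → Finset V := fun i => l[i.1]'(by omega)
  have hofFn : List.ofFn c = l := by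
    apply List.ext_getElem
    · simp [hl]
    · intro i h1 h2
      rw [List.getElem_ofFn]
  have hadj : ∀ i : Fin 10, (c i ∩ c (i + 1)).card = 2 := by
    intro i
    have := hch i.1 (by omega)
    have hi : (i + 1).1 = (i.1 + 1) % l.length := by rw [hl, Fin.val_add]; rfl
    simp only [c, hi]
    exact this
  obtain ⟨e, he8, he9⟩ := exists_equiv_map_eq h.card_points (h3 8 (by omega)) (h3 9 (by omega))
    (hadj 8)
  refine SixPoints.false_of_cyclic (c := fun i => (c i).map e.toEmbedding) ?_ ?_ ?_ he8 he9
  · intro i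
    rw [Finset.card_map]
    exact h3 _ _
  · intro i
    rw [← Finset.map_inter, Finset.card_map]
    exact hadj i
  · intro p hp
    have : List.ofFn (fun i => (c i).map e.toEmbedding) = l.map (Finset.map e.toEmbedding) := by
      rw [← hofFn, List.map_ofFn]; rfl
    rw [this, List.countP_map]
    have hcnt := h.pair_count (p.map e.symm.toEmbedding) (by rw [Finset.card_map, hp])
    rw [Multiset.coe_countP] at hcnt
    refine le_of_eq (Eq.trans ?_ hcnt)
    congr 1
    funext b
    rw [Bool.eq_iff_iff]
    simp only [Function.comp_apply, decide_eq_true_iff]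
    constructor
    · intro hpb x hx
      obtain ⟨y, hy, rfl⟩ := Finset.mem_map.1 hx
      obtain ⟨z, hz, hzy⟩ := Finset.mem_map.1 (hpb hy)
      simp only [Equiv.coe_toEmbedding] at hzy ⊢
      rw [← hzy]; simpa using hz
    · intro hpb x hx
      have := hpb (Finset.mem_map_of_mem e.symm.toEmbedding hx)
      exact Finset.mem_map.2 ⟨_, this, by simp⟩

/-! ### Developing base blocks under a cyclic group. -/

theorem SharePair.image {V : Type} [DecidableEq V] {A B : Finset V} (h : SharePair A B) {f : V → V}
    (hf : Function.Injective f) : SharePair (A.image f) (B.image f) := by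
  obtain ⟨x, y, h0, h1, h2, h3, h4⟩ := h
  exact ⟨f x, f y, hf.ne h0, Finset.mem_image_of_mem f h1, Finset.mem_image_of_mem f h2,
    Finset.mem_image_of_mem f h3, Finset.mem_image_of_mem f h4⟩

section voltage

variable {V ι : Type} [Fintype V] [DecidableEq V] {m : ℕ}

/-- A list of base blocks, developed under a cyclic group of translations, whose last block shares
a pair with the translate of the first one by a generator, gives a Gray code as soon as the
translates cover every pair twice. -/
theorem HasGrayTTS.of_base_blocks {v : ℕ} (hm : m ≠ 0) (hv : Fintype.card V = v)
    (sh : ZMod m → V → V) (sh_zero : ∀ x, sh 0 x = x)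
    (sh_add : ∀ a b x, sh (a + b) x = sh a (sh b x))
    (base : List ι) (hbase : base.Nodup) (T : ι → Finset V)
    (hlen : 3 ≤ m * base.length) (hN : 3 * (m * base.length) = v * (v - 1))
    (hcard : ∀ i ∈ base, (T i).card ≤ 3)
    (hcov : ∀ x y, x ≠ y → ∃ i ∈ base, ∃ s, ∃ j ∈ base, ∃ s', (i, s) ≠ (j, s') ∧
      x ∈ (T i).image (sh s) ∧ y ∈ (T i).image (sh s) ∧
      x ∈ (T j).image (sh s') ∧ y ∈ (T j).image (sh s'))
    (hchain : base.IsChain (fun i j => SharePair (T i) (T j)))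
    (g : ZMod m) (hg : IsUnit g)
    (hlast : ∀ i ∈ base.getLast?, ∀ j ∈ base.head?, SharePair (T i) ((T j).image (sh g))) :
    HasGrayTTS v := by
  have : NeZero m := ⟨hm⟩
  have hinj : ∀ a, Function.Injective (sh a) := by
    intro a x y hxy
    have := congrArg (sh (-a)) hxy
    rwa [← sh_add, ← sh_add, neg_add_cancel, sh_zero, sh_zero] at this
  obtain ⟨b, base, rfl⟩ : ∃ b t, base = b :: t := by
    cases base with
    | nil => simp at hlen
    | cons b t => exact ⟨b, t, rfl⟩
  -- Copy number q of the base path is translated by q·g.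
  let f : ℕ × ι → Finset V := fun p => (T p.2).image (sh (p.1 * g))
  let chunk : ℕ → List (ℕ × ι) := fun q => (b :: base).map (fun i => (q, i))
  have hR : ∀ n, ((List.range n).flatMap chunk).IsChain (fun p p' => SharePair (f p) (f p')) := by
    intro n
    rw [List.flatMap_def, List.isChain_flatten (by simp [chunk])]
    constructor
    · intro l hl
      obtain ⟨q, -, rfl⟩ := List.mem_map.1 hl
      rw [List.isChain_map]
      exact hchain.imp fun i j h => h.image (hinj _)
    · rw [List.isChain_map]
      have hs : (List.range n).IsChain (fun a b => b = a + 1) := by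
        rw [List.isChain_iff_getElem]
        intro i hi
        simp
      refine hs.imp ?_
      rintro q _ rfl p hp p' hp'
      simp only [chunk, List.getLast?_map, List.head?_map, Option.mem_def,
        Option.map_eq_some_iff] at hp hp'
      obtain ⟨i, hi, rfl⟩ := hp
      obtain ⟨j, hj, rfl⟩ := hp'
      have := (hlast i hi j hj).image (hinj (q * g))
      rw [Finset.image_image] at this
      convert this using 2
      funext x
      simp only [Function.comp_apply, ← sh_add]
      push_cast
      ring_nf
  have hlenl : ((List.range m).flatMap chunk).length = m * (b :: base).length := by
    simp [chunk, List.length_flatMap]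
  have hmem : ∀ i ∈ b :: base, ∀ s : ZMod m, ∃ q < m, (q : ZMod m) * g = s ∧
      (q, i) ∈ (List.range m).flatMap chunk := by
    intro i hi s
    obtain ⟨u, rfl⟩ := hg
    refine ⟨(s * ↑u⁻¹ : ZMod m).val, ZMod.val_lt _, ?_, ?_⟩
    · rw [ZMod.natCast_val, ZMod.cast_id', id, mul_assoc, Units.inv_mul, mul_one]
    · rw [List.mem_flatMap]
      exact ⟨_, List.mem_range.2 (ZMod.val_lt _), List.mem_map.2 ⟨i, hi, rfl⟩⟩
  refine HasGrayTTS.of_list hv ((List.range m).flatMap chunk) ?_ (by rwa [hlenl]) f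
    (by rwa [hlenl]) ?_ ?_ (fun _ => ?_)
  · rw [List.nodup_flatMap]
    constructor
    · intro q _
      exact hbase.map (fun i j h => (Prod.mk.inj h).2)
    · refine List.nodup_range.imp ?_
      intro q q' hq
      rw [Function.onFun, List.disjoint_left]
      rintro ⟨a, i⟩ h1 h2
      obtain ⟨_, _, h1⟩ := List.mem_map.1 h1
      obtain ⟨_, _, h2⟩ := List.mem_map.1 h2
      exact hq ((Prod.mk.inj h1).1.trans (Prod.mk.inj h2).1.symm)
  · rintro ⟨q, i⟩ hi
    obtain ⟨q', _, hi⟩ := List.mem_flatMap.1 hi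
    obtain ⟨i', hi', h⟩ := List.mem_map.1 hi
    obtain ⟨-, rfl⟩ := Prod.mk.inj h
    exact Finset.card_image_le.trans (hcard i' hi')
  · intro x y hxy
    obtain ⟨i, hi, s, j, hj, s', hne, h1, h2, h3, h4⟩ := hcov x y hxy
    obtain ⟨q, -, rfl, hq⟩ := hmem i hi s
    obtain ⟨q', -, rfl, hq'⟩ := hmem j hj s'
    refine ⟨_, hq, _, hq', ?_, h1, h2, h3, h4⟩
    rintro h
    obtain ⟨rfl, rfl⟩ := Prod.mk.inj h
    exact hne rfl
  -- One copy too many is chained and then truncated after its first block. As m·g = 0, that block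
  -- equals the very first one, which closes the cycle.
  · have h1 := hR (m + 1)
    rw [List.range_succ, List.flatMap_append, List.flatMap_singleton] at h1
    have h2 : ((List.range m).flatMap chunk ++ [(m, b)]).IsChain
        (fun p p' => SharePair (f p) (f p')) := by
      refine h1.prefix ?_
      refine ⟨base.map (fun i => (m, i)), ?_⟩
      simp [chunk]
    obtain ⟨r, hr⟩ : ∃ r, (List.range m).flatMap chunk = (0, b) :: r := by
      obtain ⟨n, rfl⟩ := Nat.exists_eq_succ_of_ne_zero hm
      rw [List.range_succ_eq_map, List.flatMap_cons]
      exact ⟨_, rfl⟩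
    rw [hr] at h2 ⊢
    rw [← List.isChain_map (R := SharePair)] at h2
    rw [Cycle.chain_coe_cons, ← List.isChain_map (R := SharePair)]
    have hf : f (m, b) = f (0, b) := by simp [f]
    simpa [hf] using h2

end voltage

/-! ### The zigzag sequence. -/

/-- The zigzag sequence `0, 1, -1, 2, -2, …`. -/
def zigzag (k : ℕ) : ℤ := if k % 2 = 1 then (k + 1) / 2 else -(k / 2)

theorem two_mul_zigzag_of_odd {k : ℕ} (h : k % 2 = 1) : 2 * zigzag k = k + 1 := by
  rw [zigzag, if_pos h]; omega

theorem two_mul_zigzag_of_even {k : ℕ} (h : k % 2 = 0) : 2 * zigzag k = -k := by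
  rw [zigzag, if_neg (by omega)]; omega

@[simp] theorem zigzag_zero : zigzag 0 = 0 := rfl

/-- The terms alternate around 0, so the steps have absolute values 1, 2, 3, …. These steps become
the pure differences of a strand. -/
theorem zigzag_succ_sub (k : ℕ) :
    zigzag (k + 1) - zigzag k = k + 1 ∨ zigzag (k + 1) - zigzag k = -(k + 1) := by
  rcases Nat.mod_two_eq_zero_or_one k with h | h
  · have h1 := two_mul_zigzag_of_even h
    have h2 := two_mul_zigzag_of_odd (k := k + 1) (by omega)
    push_cast at h2; omega
  · have h1 := two_mul_zigzag_of_odd h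
    have h2 := two_mul_zigzag_of_even (k := k + 1) (by omega)
    push_cast at h2; omega

/-- Residues in the lower half occur as positive terms, at odd indices, and the others as negative
terms, at even indices. -/
theorem exists_zigzag_eq (m : ℕ) [NeZero m] (d : ZMod m) : ∃ k < m, ((zigzag k : ℤ) : ZMod m) = d := by
  have hd : ((d.val : ℤ) : ZMod m) = d := by simp
  have hlt := ZMod.val_lt d
  rcases Nat.eq_zero_or_pos d.val with h0 | h0
  · exact ⟨0, by omega, by rw [← hd, h0]; simp⟩
  by_cases h : 2 * d.val - 1 < m
  · refine ⟨2 * d.val - 1, h, ?_⟩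
    have := two_mul_zigzag_of_odd (k := 2 * d.val - 1) (by omega)
    rw [show zigzag (2 * d.val - 1) = d.val by omega, hd]
  · refine ⟨2 * (m - d.val), by omega, ?_⟩
    have := two_mul_zigzag_of_even (k := 2 * (m - d.val)) (by omega)
    rw [show zigzag (2 * (m - d.val)) = d.val - m by omega]
    push_cast
    simp

/-! ### Three levels: strands and coverage by differences. -/

namespace Theta

/-- Labels of the base blocks: three strands, the connecting blocks and a final block. -/
inductive Label
  | s02 (k : ℕ)
  | s01 (k : ℕ)
  | s12 (k : ℕ)
  | y (k : ℕ)
  | x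

variable {m : ℕ} {P : Type}

/-- Three copies of `ZMod m`, together with some fixed points. -/
abbrev Point (m : ℕ) (P : Type) : Type := (Fin 3 × ZMod m) ⊕ P

/-- The point of level `i` with coordinate `a`. -/
abbrev pt (i : Fin 3) (a : ZMod m) : Point m P := Sum.inl (i, a)

/-- Translation of all levels. -/
def shift (s : ZMod m) : Point m P → Point m P
  | Sum.inl p => Sum.inl (p.1, s + p.2)
  | Sum.inr p => Sum.inr p

theorem shift_pt (s a : ZMod m) (i : Fin 3) : shift s (pt i a : Point m P) = pt i (s + a) := rfl

/-- The list of labels in the order in which the base blocks are arranged. -/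
def labels (n ny : ℕ) : List Label :=
  (List.range n).reverse.map Label.s02 ++ ((List.range n).map Label.s01 ++
    ((List.range ny).map Label.y ++ ((List.range n).map Label.s12 ++ [Label.x])))

theorem mem_s02 {n ny k : ℕ} : Label.s02 k ∈ labels n ny ↔ k < n := by simp [labels]

theorem mem_s01 {n ny k : ℕ} : Label.s01 k ∈ labels n ny ↔ k < n := by simp [labels]

theorem mem_s12 {n ny k : ℕ} : Label.s12 k ∈ labels n ny ↔ k < n := by simp [labels]

theorem mem_y {n ny k : ℕ} : Label.y k ∈ labels n ny ↔ k < ny := by simp [labels]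

theorem mem_x {n ny : ℕ} : Label.x ∈ labels n ny := by simp [labels]

theorem nodup_labels (n ny : ℕ) : (labels n ny).Nodup := by
  have h : ∀ f : ℕ → Label, Function.Injective f → ∀ k, ((List.range k).map f).Nodup :=
    fun f hf k => List.nodup_range.map hf
  have h' : ∀ f : ℕ → Label, Function.Injective f → ∀ k, ((List.range k).reverse.map f).Nodup :=
    fun f hf k => (List.nodup_reverse.2 List.nodup_range).map hf
  simp only [labels, List.nodup_append', List.disjoint_left]
  refine ⟨h' _ (fun _ _ => Label.s02.inj) _, ⟨h _ (fun _ _ => Label.s01.inj) _,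
    ⟨h _ (fun _ _ => Label.y.inj) _, ⟨h _ (fun _ _ => Label.s12.inj) _, by simp, by simp⟩,
    by simp⟩, by simp⟩, by simp⟩

theorem length_labels (n ny : ℕ) : (labels n ny).length = 3 * n + ny + 1 := by
  simp [labels]; omega

theorem sharePair_of_mem {A B : Finset (Point m P)} {i i' : Fin 3} {a b : ZMod m} (hi : i ≠ i')
    (h1 : pt i a ∈ A) (h2 : pt i' b ∈ A) (h3 : pt i a ∈ B) (h4 : pt i' b ∈ B) : SharePair A B :=
  ⟨pt i a, pt i' b, by simp [hi], h1, h2, h3, h4⟩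

variable [DecidableEq P]

/-- The block of a strand between levels `i` and `i'`. -/
def strand (i i' : Fin 3) (a b : ℕ → ZMod m) (k : ℕ) : Finset (Point m P) :=
  {pt i (a k), pt i (a (k + 1)), pt i' (b k), pt i' (b (k + 1))}

theorem card_strand_le {i i' : Fin 3} {a b : ℕ → ZMod m} {k : ℕ}
    (h : a k = a (k + 1) ∨ b k = b (k + 1)) : (strand i i' a b k : Finset (Point m P)).card ≤ 3 := by
  rcases h with h | h
  · rw [strand, h, Finset.insert_eq_of_mem (Finset.mem_insert_self _ _)]
    exact Finset.card_le_three
  · rw [strand, h, Finset.pair_eq_singleton]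
    exact Finset.card_le_three

theorem sharePair_strand {i i' : Fin 3} (hi : i ≠ i') (a b : ℕ → ZMod m) (k : ℕ) :
    SharePair (strand i i' a b k : Finset (Point m P)) (strand i i' a b (k + 1)) :=
  sharePair_of_mem (a := a (k + 1)) (b := b (k + 1)) hi (by simp [strand]) (by simp [strand])
    (by simp [strand]) (by simp [strand])

/-- The points `x` and `y` occur together in two different translates of base blocks. -/
def Covered (L : List Label) (T : Label → Finset (Point m P)) (x y : Point m P) : Prop :=
  ∃ i ∈ L, ∃ s, ∃ j ∈ L, ∃ s', (i, s) ≠ (j, s') ∧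
    x ∈ (T i).image (shift s) ∧ y ∈ (T i).image (shift s) ∧
    x ∈ (T j).image (shift s') ∧ y ∈ (T j).image (shift s')

theorem Covered.symm {L : List Label} {T : Label → Finset (Point m P)} {x y : Point m P}
    (h : Covered L T x y) : Covered L T y x := by
  obtain ⟨i, hi, s, j, hj, s', hne, h1, h2, h3, h4⟩ := h
  exact ⟨i, hi, s, j, hj, s', hne, h2, h1, h4, h3⟩

theorem mem_image_shift {A : Finset (Point m P)} {i : Fin 3} {a s x : ZMod m} (h : pt i a ∈ A)
    (hx : s + a = x) : pt i x ∈ A.image (shift s) :=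
  Finset.mem_image.2 ⟨_, h, by rw [shift_pt, hx]⟩

/-- Pairs of points on two different levels are covered along a strand. -/
theorem covered_mixed {n : ℕ} {L : List Label} {T : Label → Finset (Point m P)} {i i' : Fin 3}
    {a b : ℕ → ZMod m} (S : ℕ → Label) (hS : Function.Injective S)
    (hL : ∀ k < n, S k ∈ L) (hT : ∀ k < n, T (S k) = strand i i' a b k)
    (hsurj : ∀ d, ∃ k ≤ n, b k - a k = d)
    {e₀ e₁ : Label} (he₀ : e₀ ∈ L) (he₁ : e₁ ∈ L) (hne : e₀ ≠ e₁) (hS₀ : ∀ k, S k ≠ e₀)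
    (hS₁ : ∀ k, S k ≠ e₁)
    {u₀ u₀' u₁ u₁' : ZMod m} (h₀ : pt i u₀ ∈ T e₀) (h₀' : pt i' u₀' ∈ T e₀)
    (hd₀ : u₀' - u₀ = b 0 - a 0)
    (h₁ : pt i u₁ ∈ T e₁) (h₁' : pt i' u₁' ∈ T e₁) (hd₁ : u₁' - u₁ = b n - a n)
    (x y : ZMod m) : Covered L T (pt i x) (pt i' y) := by
  obtain ⟨k, hk, hd⟩ := hsurj (y - x)
  -- The k-th mixed difference lies in strand blocks k-1 and k. At the two ends of the strand, where
  -- one of these is missing, `e₀` or `e₁` replaces it.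
  have left : ∃ j ∈ L, (k = 0 ∧ j = e₀ ∨ ∃ k', k = k' + 1 ∧ j = S k') ∧ ∃ s,
      pt i x ∈ (T j).image (shift s) ∧ pt i' y ∈ (T j).image (shift s) := by
    rcases k with _ | k
    · refine ⟨e₀, he₀, Or.inl ⟨rfl, rfl⟩, x - u₀, mem_image_shift h₀ (by ring),
        mem_image_shift h₀' ?_⟩
      linear_combination hd₀ + hd
    · refine ⟨S k, hL k (by omega), Or.inr ⟨k, rfl, rfl⟩, x - a (k + 1), ?_, ?_⟩
      · exact mem_image_shift (a := a (k + 1)) (by simp [hT k (by omega), strand]) (by ring)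
      · refine mem_image_shift (a := b (k + 1)) (by simp [hT k (by omega), strand]) ?_
        linear_combination hd
  have right : ∃ j ∈ L, (k = n ∧ j = e₁ ∨ j = S k) ∧ ∃ s,
      pt i x ∈ (T j).image (shift s) ∧ pt i' y ∈ (T j).image (shift s) := by
    rcases hk.lt_or_eq with hk | rfl
    · refine ⟨S k, hL k hk, Or.inr rfl, x - a k, ?_, ?_⟩
      · exact mem_image_shift (a := a k) (by simp [hT k hk, strand]) (by ring)
      · refine mem_image_shift (a := b k) (by simp [hT k hk, strand]) ?_
        linear_combination hd
    · refine ⟨e₁, he₁, Or.inl ⟨rfl, rfl⟩, x - u₁, mem_image_shift h₁ (by ring),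
        mem_image_shift h₁' ?_⟩
      linear_combination hd₁ + hd
  obtain ⟨j, hj, hjk, s, h1, h2⟩ := left
  obtain ⟨j', hj', hjk', s', h3, h4⟩ := right
  refine ⟨j, hj, s, j', hj', s', ?_, h1, h2, h3, h4⟩
  intro h
  have hjj : j = j' := (Prod.mk.inj h).1
  rcases hjk with ⟨rfl, rfl⟩ | ⟨k', rfl, rfl⟩ <;> rcases hjk' with ⟨-, rfl⟩ | rfl
  · exact hne hjj
  · exact hS₀ _ hjj.symm
  · exact hS₁ _ hjj
  · have := hS hjj; omega

/-- Pairs of points on one level are covered if each nonzero difference has its own block. -/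
theorem covered_pure [NeZero m] {L : List Label} {T : Label → Finset (Point m P)} {i : Fin 3}
    (r : ℕ → Label) (hr : ∀ σ, 1 ≤ σ → σ < m → r σ ∈ L)
    (hinj : ∀ σ τ, 1 ≤ σ → σ < m → 1 ≤ τ → τ < m → r σ = r τ → σ = τ)
    (hT : ∀ σ : ℕ, 1 ≤ σ → σ < m → ∃ p q : ZMod m, pt i p ∈ T (r σ) ∧ pt i q ∈ T (r σ) ∧
      (q - p = σ ∨ q - p = -σ)) (x y : ZMod m) (hxy : x ≠ y) : Covered L T (pt i x) (pt i y) := by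
  -- The given pair is oriented so that its difference is +σ.
  have hT' : ∀ σ : ℕ, ∃ p : ZMod m, 1 ≤ σ → σ < m → pt i p ∈ T (r σ) ∧ pt i (p + (σ : ZMod m)) ∈ T (r σ) := by
    intro σ
    by_cases h : 1 ≤ σ ∧ σ < m
    · obtain ⟨p, q, hp, hq, hpq | hpq⟩ := hT σ h.1 h.2
      · exact ⟨p, fun _ _ => ⟨hp, by rwa [← hpq, add_sub_cancel]⟩⟩
      · exact ⟨q, fun _ _ => ⟨hq, by rwa [show q + (σ : ZMod m) = p by
          linear_combination hpq]⟩⟩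
    · exact ⟨0, fun h1 h2 => absurd ⟨h1, h2⟩ h⟩
  choose p hp using hT'
  set σ := (y - x).val with hσ
  have hσ0 : 1 ≤ σ := by
    rw [Nat.one_le_iff_ne_zero, hσ, Ne, ZMod.val_eq_zero, sub_eq_zero]
    exact hxy.symm
  have hσm : σ < m := ZMod.val_lt _
  have hcast : (σ : ZMod m) = y - x := by rw [hσ]; simp
  have hcast' : ((m - σ : ℕ) : ZMod m) = x - y := by
    rw [Nat.cast_sub hσm.le, hcast]; simp
  obtain ⟨h1, h2⟩ := hp σ hσ0 hσm
  -- The block for m-σ covers the same pair read from y to x; this is the second occurrence.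
  obtain ⟨h3, h4⟩ := hp (m - σ) (by omega) (by omega)
  refine ⟨_, hr σ hσ0 hσm, x - p σ, _, hr (m - σ) (by omega) (by omega), y - p (m - σ), ?_,
    mem_image_shift h1 (by ring), mem_image_shift h2 (by rw [hcast]; ring),
    mem_image_shift h4 (by rw [hcast']; ring), mem_image_shift h3 (by ring)⟩
  -- If 2σ = m both occurrences come from one base block, but the two translations then differ by x
  -- - y.
  intro h
  obtain ⟨h5, h6⟩ := Prod.mk.inj h
  have h7 := hinj _ _ hσ0 hσm (by omega) (by omega) h5
  rw [← h7] at h6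
  exact hxy (by linear_combination h6)

end Theta

/-! ### The general three-level construction. -/

namespace Theta

section

variable {m : ℕ}

/-- First coordinates of the strand that moves on its first level for `h` steps. -/
def first (h k : ℕ) : ZMod m := -((zigzag (min k h) : ℤ) : ZMod m)

/-- Second coordinates of the strand that moves on its first level for `h` steps. -/
def second (h k : ℕ) : ZMod m := first h k + ((zigzag k : ℤ) : ZMod m)

theorem first_zero (h : ℕ) : (first h 0 : ZMod m) = 0 := by simp [first]

theorem second_sub_first (h k : ℕ) :
    (second h k - first h k : ZMod m) = ((zigzag k : ℤ) : ZMod m) := by simp [second]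

theorem second_eq_of_lt {h k : ℕ} (hk : k < h) : (second h k : ZMod m) = second h (k + 1) := by
  simp [second, first, min_eq_left hk.le, min_eq_left (Nat.succ_le_of_lt hk)]

theorem first_eq_of_le {h k : ℕ} (hk : h ≤ k) : (first h k : ZMod m) = first h (k + 1) := by
  simp [first, min_eq_right hk, min_eq_right (hk.trans (Nat.le_succ k))]

theorem zigzag_succ_sub_cast (k : ℕ) :
    ((zigzag (k + 1) : ℤ) : ZMod m) - ((zigzag k : ℤ) : ZMod m) = ((k + 1 : ℕ) : ZMod m) ∨
    ((zigzag (k + 1) : ℤ) : ZMod m) - ((zigzag k : ℤ) : ZMod m) = -((k + 1 : ℕ) : ZMod m) := by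
  rcases zigzag_succ_sub k with h | h
  · left; rw [← Int.cast_sub, h]; push_cast; rfl
  · right; rw [← Int.cast_sub, h]; push_cast; rfl

/-- The first level absorbs the zigzag step while k < h; from h on the second level does, as in
`second_sub`. -/
theorem first_sub {h k : ℕ} (hk : k < h) :
    (first h (k + 1) - first h k : ZMod m) = ((k + 1 : ℕ) : ZMod m) ∨
    (first h (k + 1) - first h k : ZMod m) = -((k + 1 : ℕ) : ZMod m) := by
  rw [first, first, min_eq_left hk.le, min_eq_left (Nat.succ_le_of_lt hk)]
  rcases zigzag_succ_sub_cast (m := m) k with h | h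
  · right; linear_combination -h
  · left; linear_combination -h

theorem second_sub {h k : ℕ} (hk : h ≤ k) :
    (second h (k + 1) - second h k : ZMod m) = ((k + 1 : ℕ) : ZMod m) ∨
    (second h (k + 1) - second h k : ZMod m) = -((k + 1 : ℕ) : ZMod m) := by
  rw [second, second, ← first_eq_of_le hk, add_sub_add_left_eq_sub]
  exact zigzag_succ_sub_cast k

theorem first_or_second_eq (h k : ℕ) :
    (first h k : ZMod m) = first h (k + 1) ∨ (second h k : ZMod m) = second h (k + 1) := by
  rcases Nat.lt_or_ge k h with hk | hk
  · exact Or.inr (second_eq_of_lt hk)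
  · exact Or.inl (first_eq_of_le hk)

variable {P : Type} [DecidableEq P]

/-- The base blocks: strands between the levels `0, 2`, the levels `0, 1` and the levels `1, 2`,
the connecting blocks `Y`, and the closing block. -/
def block (n h : ℕ) (a b : ℕ → ZMod m) (Y : ℕ → Finset (Point m P)) : Label → Finset (Point m P)
  | .s02 k => strand 0 2 (first (n - h)) (second (n - h)) k
  | .s01 k => strand 0 1 (first h) (second h) k
  | .s12 k => strand 1 2 a b k
  | .y k => Y k
  | .x => {pt 0 (a n), pt 1 (a n), pt 2 (b n)}

end

/-- The strands 02 and 01 are fixed; the strand 12 and the connecting blocks are parameters. The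
closing block carries mixed difference 0 between levels 0 and 1 and the final differences of the
strands 02 and 12. The connecting blocks supply the other strand ends: the final 01 difference in `Y
0`, the initial 12 difference in the last one, and the initial 02 difference in `Y k₀`. The function
`κ` locates the step of strand 12 that realises a pure difference, on level 1 up to `h` and on level
2 above it. -/
theorem hasGrayTTS {n h ny v : ℕ} {P : Type} [Fintype P] [DecidableEq P] (hh : 1 ≤ h)
    (hhn : h < n) (a b : ℕ → ZMod (n + 1)) (Y : ℕ → Finset (Point (n + 1) P)) (hny : 1 ≤ ny)
    (hv : 3 * (n + 1) + Fintype.card P = v)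
    (hN : 3 * ((n + 1) * (3 * n + ny + 1)) = v * (v - 1))
    (hstep : ∀ k < n, a k = a (k + 1) ∨ b k = b (k + 1))
    (hsurj : ∀ d, ∃ k ≤ n, b k - a k = d)
    (κ : ℕ → ℕ) (hκ : ∀ σ, 1 ≤ σ → σ ≤ n → κ σ < n)
    (hκinj : ∀ σ τ, 1 ≤ σ → σ ≤ n → 1 ≤ τ → τ ≤ n → κ σ = κ τ → σ = τ)
    (hκa : ∀ σ : ℕ, 1 ≤ σ → σ ≤ h → a (κ σ + 1) - a (κ σ) = σ ∨ a (κ σ + 1) - a (κ σ) = -σ)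
    (hκb : ∀ σ : ℕ, h < σ → σ ≤ n → b (κ σ + 1) - b (κ σ) = σ ∨ b (κ σ + 1) - b (κ σ) = -σ)
    (hYcard : ∀ k < ny, (Y k).card ≤ 3)
    (hYchain : ∀ k, k + 1 < ny → SharePair (Y k) (Y (k + 1)))
    (hY0 : pt 0 (first h n) ∈ Y 0) (hY1 : pt 1 (second h n) ∈ Y 0)
    (hYa : pt 1 (a 0) ∈ Y (ny - 1)) (hYb : pt 2 (b 0) ∈ Y (ny - 1))
    {k₀ : ℕ} {u : ZMod (n + 1)} (hk₀ : k₀ < ny) (hu0 : pt 0 u ∈ Y k₀) (hu2 : pt 2 u ∈ Y k₀)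
    (hend : b n - a n = ((zigzag n : ℤ) : ZMod (n + 1)))
    (hg : IsUnit (a n - first (n - h) n))
    (hP : ∀ (p : P) (z : Point (n + 1) P), z ≠ Sum.inr p →
      Covered (labels n ny) (block n h a b Y) z (Sum.inr p)) : HasGrayTTS v := by
  set T := block n h a b Y with hT
  have hone : (1 : ZMod (n + 1)) ≠ 0 := by
    have : Fact (1 < n + 1) := ⟨by omega⟩
    exact one_ne_zero
  have hz0 : ∀ k, (second k 0 : ZMod (n + 1)) - first k 0 = 0 := by
    intro k; rw [second_sub_first]; simp
  have hzs : ∀ k (d : ZMod (n + 1)), ∃ r ≤ n, second k r - first k r = d := by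
    intro k d
    obtain ⟨r, hr, hd⟩ := exists_zigzag_eq (n + 1) d
    exact ⟨r, by omega, by rw [second_sub_first, hd]⟩
  have p01 : ∀ x y, Covered (labels n ny) T (pt 0 x) (pt 1 y) := by
    refine covered_mixed (n := n) (a := first h) (b := second h) Label.s01 (fun _ _ => Label.s01.inj)
      (fun k hk => mem_s01.2 hk) (fun k _ => rfl) (hzs h) mem_x (mem_y.2 (show 0 < ny by omega))
      (by simp) (by simp) (by simp) (u₀ := a n) (u₀' := a n) (u₁ := first h n) (u₁' := second h n)
      (by simp [hT, block]) (by simp [hT, block]) (by rw [hz0, sub_self]) hY0 hY1 rfl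
  have p02 : ∀ x y, Covered (labels n ny) T (pt 0 x) (pt 2 y) := by
    refine covered_mixed (n := n) (a := first (n - h)) (b := second (n - h)) Label.s02
      (fun _ _ => Label.s02.inj)
      (fun k hk => mem_s02.2 hk) (fun k _ => rfl) (hzs _) (mem_y.2 hk₀) mem_x
      (by simp) (by simp) (by simp) (u₀ := u) (u₀' := u) (u₁ := a n) (u₁' := b n)
      hu0 hu2 (by rw [hz0, sub_self]) (by simp [hT, block]) (by simp [hT, block])
      (by rw [hend, second_sub_first])
  have p12 : ∀ x y, Covered (labels n ny) T (pt 1 x) (pt 2 y) := by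
    refine covered_mixed (n := n) (a := a) (b := b) Label.s12 (fun _ _ => Label.s12.inj)
      (fun k hk => mem_s12.2 hk) (fun k _ => rfl) hsurj (mem_y.2 (show ny - 1 < ny by omega)) mem_x
      (by simp) (by simp) (by simp) (u₀ := a 0) (u₀' := b 0) (u₁ := a n) (u₁' := b n)
      hYa hYb rfl (by simp [hT, block]) (by simp [hT, block]) rfl
  -- On level 0 the residues σ ≤ h come from strand 01. The others come from strand 02, whose step
  -- number n-σ has size n-σ+1 ≡ -σ modulo n+1.
  have p00 : ∀ x y, x ≠ y → Covered (labels n ny) T (pt 0 x) (pt 0 y) := by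
    refine covered_pure (fun σ => if σ ≤ h then Label.s01 (σ - 1) else Label.s02 (n - σ)) ?_ ?_ ?_
    · intro σ h1 h2
      split_ifs
      · exact mem_s01.2 (by omega)
      · exact mem_s02.2 (by omega)
    · intro σ τ h1 h2 h3 h4 he
      split_ifs at he
      · have := Label.s01.inj he; omega
      · have := Label.s02.inj he; omega
    · intro σ h1 h2
      split_ifs with hc
      · refine ⟨first h (σ - 1), first h (σ - 1 + 1), by simp [hT, block, strand],
          by simp [hT, block, strand], ?_⟩
        have := first_sub (m := n + 1) (h := h) (k := σ - 1) (by omega)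
        rwa [Nat.sub_add_cancel h1] at this ⊢
      · refine ⟨first (n - h) (n - σ), first (n - h) (n - σ + 1), by simp [hT, block, strand],
          by simp [hT, block, strand], ?_⟩
        have := first_sub (m := n + 1) (h := n - h) (k := n - σ) (by omega)
        have hcast : ((n - σ + 1 : ℕ) : ZMod (n + 1)) = -(σ : ZMod (n + 1)) := by
          rw [show n - σ + 1 = n + 1 - σ by omega, Nat.cast_sub (by omega)]; simp
        rw [hcast, neg_neg] at this
        exact this.symm
  have p11 : ∀ x y, x ≠ y → Covered (labels n ny) T (pt 1 x) (pt 1 y) := by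
    refine covered_pure (fun σ => if σ ≤ h then Label.s12 (κ σ) else Label.s01 (σ - 1)) ?_ ?_ ?_
    · intro σ h1 h2
      split_ifs
      · exact mem_s12.2 (hκ σ h1 (by omega))
      · exact mem_s01.2 (by omega)
    · intro σ τ h1 h2 h3 h4 he
      split_ifs at he
      · exact hκinj σ τ h1 (by omega) h3 (by omega) (Label.s12.inj he)
      · have := Label.s01.inj he; omega
    · intro σ h1 h2
      split_ifs with hc
      · exact ⟨a (κ σ), a (κ σ + 1), by simp [hT, block, strand],
          by simp [hT, block, strand], hκa σ h1 hc⟩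
      · refine ⟨second h (σ - 1), second h (σ - 1 + 1), by simp [hT, block, strand],
          by simp [hT, block, strand], ?_⟩
        have := second_sub (m := n + 1) (h := h) (k := σ - 1) (by omega)
        rwa [Nat.sub_add_cancel h1] at this ⊢
  have p22 : ∀ x y, x ≠ y → Covered (labels n ny) T (pt 2 x) (pt 2 y) := by
    refine covered_pure (fun σ => if σ ≤ h then Label.s02 (n - σ) else Label.s12 (κ σ)) ?_ ?_ ?_
    · intro σ h1 h2
      split_ifs
      · exact mem_s02.2 (by omega)
      · exact mem_s12.2 (hκ σ h1 (by omega))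
    · intro σ τ h1 h2 h3 h4 he
      split_ifs at he
      · have := Label.s02.inj he; omega
      · exact hκinj σ τ h1 (by omega) h3 (by omega) (Label.s12.inj he)
    · intro σ h1 h2
      split_ifs with hc
      · refine ⟨second (n - h) (n - σ), second (n - h) (n - σ + 1), by simp [hT, block, strand],
          by simp [hT, block, strand], ?_⟩
        have := second_sub (m := n + 1) (h := n - h) (k := n - σ) (by omega)
        have hcast : ((n - σ + 1 : ℕ) : ZMod (n + 1)) = -(σ : ZMod (n + 1)) := by
          rw [show n - σ + 1 = n + 1 - σ by omega, Nat.cast_sub (by omega)]; simp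
        rw [hcast, neg_neg] at this
        exact this.symm
      · exact ⟨b (κ σ), b (κ σ + 1), by simp [hT, block, strand],
          by simp [hT, block, strand], hκb σ (by omega) (by omega)⟩
  have hrange : ∀ S : ℕ → Label, ∀ k, (∀ r, r + 1 < k → SharePair (T (S r)) (T (S (r + 1)))) →
      ((List.range k).map S).IsChain (fun i j => SharePair (T i) (T j)) := by
    intro S k hS
    rw [List.isChain_map, List.isChain_range]
    intro r hr
    exact hS r (by omega)
  refine HasGrayTTS.of_base_blocks (V := Point (n + 1) P) (m := n + 1) (by omega) ?_ shift ?_ ?_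
    (labels n ny) (nodup_labels n ny) T ?_ (by rw [length_labels]; exact hN) ?_ ?_ ?_
    (a n - first (n - h) n) hg ?_
  · simp [ZMod.card, ← hv]
  · rintro (p | p)
    · simp [shift]
    · rfl
  · rintro s t (p | p)
    · simp [shift, add_assoc]
    · rfl
  · rw [length_labels]; nlinarith
  · intro i hi
    cases i with
    | s02 k => exact card_strand_le (first_or_second_eq _ _)
    | s01 k => exact card_strand_le (first_or_second_eq _ _)
    | s12 k => exact card_strand_le (hstep k (mem_s12.1 hi))
    | y k => exact hYcard k (mem_y.1 hi)
    | x => exact Finset.card_le_three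
  · rintro (⟨i, x⟩ | p) (⟨i', y⟩ | p') hne
    · have hxy : i = i' → x ≠ y := by rintro rfl rfl; exact hne rfl
      fin_cases i <;> fin_cases i'
      · exact p00 x y (hxy rfl)
      · exact p01 x y
      · exact p02 x y
      · exact (p01 y x).symm
      · exact p11 x y (hxy rfl)
      · exact p12 x y
      · exact (p02 y x).symm
      · exact (p12 y x).symm
      · exact p22 x y (hxy rfl)
    · exact hP p' _ hne
    · exact (hP p _ hne.symm).symm
    · exact hP p' _ hne
  · have hn0 : n ≠ 0 := by omega
    have hny0 : ny ≠ 0 := by omega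
    refine List.IsChain.append ?_ (List.IsChain.append ?_ (List.IsChain.append ?_
      (List.IsChain.append ?_ (List.isChain_singleton _) ?_) ?_) ?_) ?_
    · rw [List.map_reverse, List.isChain_reverse]
      exact (hrange Label.s02 n fun r _ => sharePair_strand (by decide) _ _ r).imp
        fun _ _ h => h.symm
    · exact hrange Label.s01 n fun r _ => sharePair_strand (by decide) _ _ r
    · exact hrange Label.y ny hYchain
    · exact hrange Label.s12 n fun r _ => sharePair_strand (by decide) _ _ r
    · simp only [List.getLast?_map, List.getLast?_range, hn0, if_false, Option.map_some,
        List.head?_cons, Option.mem_def, Option.some.injEq]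
      rintro _ rfl _ rfl
      refine sharePair_of_mem (i := 1) (i' := 2) (a := a n) (b := b n) (by decide) ?_ ?_ ?_ ?_ <;>
        simp [hT, block, strand, Nat.sub_add_cancel (show 1 ≤ n by omega)]
    · simp only [List.getLast?_map, List.getLast?_range, hny0, if_false, Option.map_some,
        List.head?_append, List.head?_map, List.head?_range, hn0, Option.mem_def, Option.some.injEq,
        Option.some_or]
      rintro _ rfl _ rfl
      exact sharePair_of_mem (i := 1) (i' := 2) (a := a 0) (b := b 0) (by decide) hYa hYb
        (by simp [hT, block, strand]) (by simp [hT, block, strand])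
    · simp only [List.getLast?_map, List.getLast?_range, hny0, if_false, Option.map_some,
        List.head?_append, List.head?_map, List.head?_range, hn0, Option.mem_def, Option.some.injEq,
        Option.some_or]
      rintro _ rfl _ rfl
      exact sharePair_of_mem (i := 0) (i' := 1) (a := first h n) (b := second h n) (by decide)
        (by simp [hT, block, strand, Nat.sub_add_cancel (show 1 ≤ n by omega)])
        (by simp [hT, block, strand, Nat.sub_add_cancel (show 1 ≤ n by omega)]) hY0 hY1
    · simp only [List.getLast?_map, List.getLast?_reverse, List.head?_range, if_false,
        Option.map_some,
        List.head?_append, List.head?_map, List.head?_range, hn0, Option.mem_def, Option.some.injEq,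
        Option.some_or]
      rintro _ rfl _ rfl
      -- Here the path passes from block 0 of strand 02 to block 0 of strand 01. Both strands first
      -- move on level 0, because h ≥ 1 and n-h ≥ 1, so these blocks share the pure pair {0, -1}.
      have hf : ∀ k, 1 ≤ k → (first k 1 : ZMod (n + 1)) = -1 := by
        intro k hk
        rw [first, min_eq_left hk]
        simp [zigzag]
      refine ⟨pt 0 0, pt 0 (-1), ?_, ?_, ?_, ?_, ?_⟩
      · intro h
        have := (Prod.mk.inj (Sum.inl.inj h)).2
        exact hone (by linear_combination this)
      all_goals
        simp [hT, block, strand, first_zero, hf h hh, hf (n - h) (by omega)]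
  · have hn0 : n ≠ 0 := by omega
    simp only [labels, List.getLast?_append, List.getLast?_singleton, Option.some_or,
      Option.mem_def, Option.some.injEq, List.head?_append, List.head?_map, List.head?_reverse,
      List.getLast?_range, hn0, if_false, Option.map_some]
    rintro _ rfl _ rfl
    -- The closing block and the last block of strand 02 carry the same mixed difference;
    -- translating the latter by g makes their level 0 points agree.
    refine sharePair_of_mem (i := 0) (i' := 2) (a := a n) (b := b n) (by decide)
      (by simp [hT, block]) (by simp [hT, block])
      (mem_image_shift (a := first (n - h) n)
        (by simp [hT, block, strand, Nat.sub_add_cancel (show 1 ≤ n by omega)]) (by ring))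
      (mem_image_shift (a := second (n - h) n)
        (by simp [hT, block, strand, Nat.sub_add_cancel (show 1 ≤ n by omega)]) ?_)
    have := second_sub_first (m := n + 1) (n - h) n
    linear_combination this - hend

end Theta

/-! ### Orders 3m+1, and 3m with m odd. -/

namespace Theta

theorem isUnit_two_of_even {n : ℕ} (hn : n % 2 = 0) : IsUnit (2 : ZMod (n + 1)) := by
  have := (ZMod.isUnit_iff_coprime 2 (n + 1)).2 (by
    rw [Nat.coprime_two_left]; exact Nat.odd_iff.2 (by omega))
  simpa using this

/-- Modulo n+1 the element is -1 for odd n and 2 for even n; in the latter case n+1 is odd. -/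
theorem isUnit_of_two_mul_zigzag {n : ℕ} {g : ZMod (n + 1)} {z : ℤ}
    (hg : g = ((1 - 2 * z : ℤ) : ZMod (n + 1)))
    (hz : n % 2 = 1 ∧ 2 * z = -(n - 1) ∨ n % 2 = 0 ∧ 2 * z = n) : IsUnit g := by
  have hn : ((n : ℤ) : ZMod (n + 1)) = -1 := by
    have : ((n + 1 : ℕ) : ZMod (n + 1)) = 0 := ZMod.natCast_self _
    push_cast at this ⊢
    linear_combination this
  rcases hz with ⟨-, h⟩ | ⟨h', h⟩
  · rw [hg, h, show (1 - -((n : ℤ) - 1)) = n by ring, hn]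
    exact isUnit_one.neg
  · rw [hg, h, Int.cast_sub, hn]
    convert isUnit_two_of_even h' using 1
    push_cast; ring

/-- Twofold triple systems on `3m + 1` points with a Gray code, `m = n + 1`. -/
theorem hasGrayTTS_three_mul_add_one {n : ℕ} (hn : 2 ≤ n) : HasGrayTTS (3 * (n + 1) + 1) := by
  let z : ℕ → ZMod (n + 1) := fun k => ((zigzag k : ℤ) : ZMod (n + 1))
  let c : ZMod (n + 1) := first (n - 1) n
  have hc : c = -z (n - 1) := by simp [c, z, first]
  -- Since h = n-1, strand 12 must move on level 1 in all steps except the last, where level 2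
  -- moves. Its mixed differences follow the zigzag itself.
  let b : ℕ → ZMod (n + 1) := fun k => c + if n ≤ k then z n - z (n - 1) else 0
  let a : ℕ → ZMod (n + 1) := fun k => b k - z k
  have hblt : ∀ k < n, b k = c := fun k hk => by simp [b, not_le.2 hk]
  have hbn : b n = c + (z n - z (n - 1)) := by simp [b]
  have hz0 : z 0 = 0 := by simp [z]
  let inf : Point (n + 1) Unit := Sum.inr ()
  -- Each level meets ∞ in two of the three connecting blocks, which covers all pairs with ∞ twice
  -- after translation.
  let Y : ℕ → Finset (Point (n + 1) Unit) := fun k =>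
    if k = 0 then {inf, pt 0 c, pt 1 (second (n - 1) n)}
    else if k = 1 then {inf, pt 0 c, pt 2 c} else {inf, pt 1 c, pt 2 c}
  have hY0 : Y 0 = {inf, pt 0 c, pt 1 (second (n - 1) n)} := rfl
  have hY1 : Y 1 = {inf, pt 0 c, pt 2 c} := rfl
  have hY2 : Y 2 = {inf, pt 1 c, pt 2 c} := rfl
  have ha0 : a 0 = c := by simp only [a, hz0, hblt 0 (by omega), sub_zero]
  refine hasGrayTTS (n := n) (h := n - 1) (ny := 3) (P := Unit) (by omega) (by omega) a b Y
    (by omega) (by simp) ?_ ?_ ?_ (fun σ => σ - 1) ?_ ?_ ?_ ?_ ?_ ?_ ?_ ?_ ?_ ?_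
    (k₀ := 1) (u := c) (by omega) ?_ ?_ ?_ ?_ ?_
  · simp only [Nat.add_sub_cancel]; ring
  · intro k hk
    rcases Nat.lt_or_ge (k + 1) n with h | h
    · right; rw [hblt k hk, hblt _ h]
    · left
      obtain rfl : n = k + 1 := by omega
      simp only [a, hblt k hk, hbn, Nat.add_sub_cancel]; ring
  · intro d
    obtain ⟨k, hk, hd⟩ := exists_zigzag_eq (n + 1) d
    exact ⟨k, by omega, by simp only [a, z, hd]; ring⟩
  · intro σ h1 h2; omega
  · intro σ τ h1 h2 h3 h4 h5; omega
  · intro σ h1 h2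
    have := zigzag_succ_sub_cast (m := n + 1) (σ - 1)
    rw [Nat.sub_add_cancel h1] at this ⊢
    simp only [a, hblt σ (by omega), hblt (σ - 1) (by omega), z]
    rcases this with h | h
    · right; linear_combination -h
    · left; linear_combination -h
  · intro σ h1 h2
    obtain rfl : n = σ := by omega
    have := zigzag_succ_sub_cast (m := n + 1) (n - 1)
    rw [Nat.sub_add_cancel (by omega)] at this ⊢
    rw [hbn, hblt _ (by omega), add_sub_cancel_left]
    exact this
  · intro k hk
    simp only [Y]
    split_ifs <;> exact Finset.card_le_three
  · intro k hk
    obtain rfl | rfl : k = 0 ∨ k = 1 := by omega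
    · exact ⟨inf, pt 0 c, by simp [inf], by simp [hY0], by simp [hY0], by simp [hY1], by simp [hY1]⟩
    · exact ⟨inf, pt 2 c, by simp [inf], by simp [hY1], by simp [hY1], by simp [hY2], by simp [hY2]⟩
  · simp [hY0, c]
  · simp [hY0]
  · simp [hY2, ha0]
  · simp [hY2, hblt 0 (by omega)]
  · simp [hY1]
  · simp [hY1]
  · simp only [a, z]; ring
  -- The closing translation works out to 1 - 2·zigzag(n-1).
  · refine isUnit_of_two_mul_zigzag (z := zigzag (n - 1)) ?_ ?_
    · have : (first (n - (n - 1)) n : ZMod (n + 1)) = -1 := by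
        rw [first, show n - (n - 1) = 1 by omega, min_eq_right (by omega)]
        simp [zigzag]
      rw [this]
      simp only [a, hbn, hc, z]
      push_cast
      ring
    · rcases Nat.mod_two_eq_zero_or_one n with h | h
      · right
        have := two_mul_zigzag_of_odd (k := n - 1) (by omega)
        omega
      · left
        have := two_mul_zigzag_of_even (k := n - 1) (by omega)
        omega
  · have hinf : ∀ (A : Finset (Point (n + 1) Unit)) s, inf ∈ A → inf ∈ A.image (shift s) :=
      fun A s h => Finset.mem_image.2 ⟨inf, h, rfl⟩
    have key : ∀ (i : Fin 3) (x u w : ZMod (n + 1)) (r r' : ℕ), r < 3 → r' < 3 → r ≠ r' →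
        pt i u ∈ Y r → pt i w ∈ Y r' → inf ∈ Y r → inf ∈ Y r' →
        Covered (labels n 3) (block n (n - 1) a b Y) (pt i x) inf := by
      intro i x u w r r' hr hr' hne h1 h2 h3 h4
      exact ⟨.y r, mem_y.2 hr, x - u, .y r', mem_y.2 hr', x - w, by simp [hne],
        mem_image_shift h1 (by ring), hinf _ _ h3, mem_image_shift h2 (by ring), hinf _ _ h4⟩
    rintro ⟨⟩ (⟨i, x⟩ | ⟨⟩) hne
    · fin_cases i
      · exact key 0 x c c 0 1 (by omega) (by omega) (by omega) (by simp [hY0]) (by simp [hY1])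
          (by simp [hY0]) (by simp [hY1])
      · exact key 1 x (second (n - 1) n) c 0 2 (by omega) (by omega) (by omega) (by simp [hY0])
          (by simp [hY2]) (by simp [hY0]) (by simp [hY2])
      · exact key 2 x c c 1 2 (by omega) (by omega) (by omega) (by simp [hY1]) (by simp [hY2])
          (by simp [hY1]) (by simp [hY2])
    · exact absurd rfl hne

/-- Twofold triple systems on `3m` points with a Gray code, `m = 2q + 1`. -/
theorem hasGrayTTS_three_mul_odd {q : ℕ} (hq : 2 ≤ q) : HasGrayTTS (3 * (2 * q + 1)) := by
  obtain ⟨n, hn⟩ : ∃ n, n = 2 * q := ⟨_, rfl⟩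
  rw [← hn]
  -- The parity of q decides h so that the closing translation becomes 2 or -2, a unit modulo the
  -- odd number n+1.
  obtain ⟨h, hh⟩ : ∃ h, h = if q % 2 = 0 then n - 1 else n - 2 := ⟨_, rfl⟩
  have hh' : q % 2 = 0 ∧ h = n - 1 ∨ q % 2 = 1 ∧ h = n - 2 := by
    split_ifs at hh with hq2
    · exact Or.inl ⟨hq2, hh⟩
    · exact Or.inr ⟨by omega, hh⟩
  have hn0 : ((n : ℕ) : ZMod (n + 1)) = -1 := by
    have : ((n + 1 : ℕ) : ZMod (n + 1)) = 0 := ZMod.natCast_self _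
    push_cast at this
    linear_combination this
  let z : ℕ → ZMod (n + 1) := fun k => ((zigzag k : ℤ) : ZMod (n + 1))
  let c : ZMod (n + 1) := first h n
  have hc : c = -z h := by simp only [c, z, first]; rw [min_eq_right (by omega)]
  -- Level 2 moves only in step q, of size 2q = n, and, when h = n-2, also in step n, of size 2n ≡
  -- n-1: exactly the residues above h.
  let b : ℕ → ZMod (n + 1) := fun k => c + (if q ≤ k then 2 * (z q - z (q - 1)) else 0) +
    if h = n - 2 ∧ n ≤ k then 2 * (z n - z (n - 1)) else 0
  -- The single connecting block has 01 difference z n and 02 difference 0, hence 12 difference -z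
  -- n, whereas the closing block has 12 difference z n. The doubled zigzag 2·z k - z n runs between
  -- these ends, and it is surjective because 2 is a unit.
  let a : ℕ → ZMod (n + 1) := fun k => b k + z n - 2 * z k
  have hz0 : z 0 = 0 := by simp [z]
  have hb0 : b 0 = c := by
    simp only [b]
    rw [if_neg (by omega), if_neg (by omega)]; ring
  have ha0 : a 0 = c + z n := by simp only [a, hb0, hz0]; ring
  have hbmove : ∀ k < n, (k + 1 = q ∨ h = n - 2 ∧ k + 1 = n) →
      b (k + 1) - b k = 2 * (z (k + 1) - z k) := by
    rintro k hk (hkq | ⟨h1, h2⟩)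
    · subst hkq
      simp only [b]
      rw [if_pos le_rfl, if_neg (by omega), if_neg (by omega), if_neg (by omega),
        Nat.add_sub_cancel]
      ring
    · simp only [b]
      rw [if_pos (by omega), if_pos (by omega), if_pos (by omega), if_neg (by omega),
        show z (k + 1) = z n from congrArg z h2, show z k = z (n - 1) from congrArg z (by omega)]
      ring
  have hbstay : ∀ k < n, ¬ (k + 1 = q ∨ h = n - 2 ∧ k + 1 = n) → b k = b (k + 1) := by
    intro k hk hne
    have h1 : (q ≤ k) ↔ (q ≤ k + 1) := by omega
    have h2 : (h = n - 2 ∧ n ≤ k) ↔ (h = n - 2 ∧ n ≤ k + 1) := by omega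
    simp only [b, h1, h2]
  -- Step k changes the doubled zigzag by ±2(k+1), so 2(k+1) ≡ σ modulo n+1 must be solved: halve σ
  -- if it is even, and n+1+σ otherwise.
  let κ : ℕ → ℕ := fun σ => if σ % 2 = 0 then σ / 2 - 1 else (n + 1 + σ) / 2 - 1
  have hκ : ∀ σ, 1 ≤ σ → σ ≤ n → κ σ < n ∧
      (2 * (κ σ + 1) = σ ∨ 2 * (κ σ + 1) = n + 1 + σ) ∧
      ((κ σ + 1 = q ∨ h = n - 2 ∧ κ σ + 1 = n) ↔ h < σ) := by
    intro σ h1 h2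
    simp only [κ]
    split_ifs with hσ
    · exact ⟨by omega, Or.inl (by omega), by omega⟩
    · exact ⟨by omega, Or.inr (by omega), by omega⟩
  have hκz : ∀ σ : ℕ, 1 ≤ σ → σ ≤ n → 2 * (z (κ σ + 1) - z (κ σ)) = (σ : ZMod (n + 1)) ∨
      2 * (z (κ σ + 1) - z (κ σ)) = -(σ : ZMod (n + 1)) := by
    intro σ h1 h2
    have hcast : (2 : ZMod (n + 1)) * ((κ σ + 1 : ℕ) : ZMod (n + 1)) = (σ : ZMod (n + 1)) := by
      have h3 : ((2 * (κ σ + 1) : ℕ) : ZMod (n + 1)) = (σ : ZMod (n + 1)) := by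
        rcases (hκ σ h1 h2).2.1 with h | h
        · rw [h]
        · rw [h]; push_cast; rw [hn0]; ring
      rw [← h3]; push_cast; ring
    rcases zigzag_succ_sub_cast (m := n + 1) (κ σ) with h | h
    · left; rw [← hcast, ← h]
    · right; rw [← hcast, ← mul_neg, ← h]
  let Y : ℕ → Finset (Point (n + 1) Empty) := fun _ => {pt 0 c, pt 1 (second h n), pt 2 c}
  have hsec : (second h n : ZMod (n + 1)) = c + z n := rfl
  refine hasGrayTTS (n := n) (h := h) (ny := 1) (P := Empty) (by omega) (by omega) a b Y
    le_rfl (by simp) ?_ ?_ ?_ κ (fun σ h1 h2 => (hκ σ h1 h2).1) ?_ ?_ ?_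
    (fun _ _ => Finset.card_le_three) (fun k hk => by omega) (by simp [Y, c]) (by simp [Y])
    (by simp [Y, ha0, hsec]) (by simp [Y, hb0])
    (k₀ := 0) (u := c) (by omega) (by simp [Y]) (by simp [Y]) ?_ ?_ (fun p => p.elim)
  · obtain ⟨r, rfl⟩ : ∃ r, n = r + 1 := ⟨n - 1, by omega⟩
    rw [show 3 * (r + 1 + 1) - 1 = 3 * r + 5 by omega]
    ring
  · intro k hk
    by_cases hm : k + 1 = q ∨ h = n - 2 ∧ k + 1 = n
    · left
      have := hbmove k hk hm
      simp only [a]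
      linear_combination -this
    · exact Or.inr (hbstay k hk hm)
  · intro d
    obtain ⟨w, hw⟩ := isUnit_two_of_even (n := n) (by omega)
    obtain ⟨k, hk, hd⟩ := exists_zigzag_eq (n + 1) (↑w⁻¹ * (d + z n))
    refine ⟨k, by omega, ?_⟩
    have h2 : 2 * z k = d + z n := by
      simp only [z, hd]
      rw [← mul_assoc, ← hw, Units.mul_inv, one_mul]
    simp only [a]
    linear_combination h2
  · intro σ τ h1 h2 h3 h4 h5
    have e1 := (hκ σ h1 h2).2.1
    have e2 := (hκ τ h3 h4).2.1
    simp only [κ] at h5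
    split_ifs at h5 <;> omega
  · intro σ h1 h2
    obtain ⟨h3, -, h4⟩ := hκ σ h1 (by omega)
    have hs := hbstay _ h3 (fun hh => by have := h4.1 hh; omega)
    simp only [a, ← hs]
    rcases hκz σ h1 (by omega) with h5 | h5
    · right; linear_combination -h5
    · left; linear_combination -h5
  · intro σ h1 h2
    obtain ⟨h3, -, h4⟩ := hκ σ (by omega) h2
    rw [hbmove _ h3 (h4.2 h1)]
    exact hκz σ (by omega) h2
  · simp only [a, z]; ring
  · have hzn := two_mul_zigzag_of_even (k := n) (by omega)
    have hzn1 := two_mul_zigzag_of_odd (k := n - 1) (by omega)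
    have hu2 := isUnit_two_of_even (n := n) (by omega)
    have han : a n = c + 2 * (z q - z (q - 1)) +
        (if h = n - 2 then 2 * (z n - z (n - 1)) else 0) - z n := by
      simp only [a, b]
      rw [if_pos (by omega)]
      simp only [le_refl, and_true]
      ring
    rcases hh' with ⟨hq2, hhn⟩ | ⟨hq2, hhn⟩
    · have hzq := two_mul_zigzag_of_even hq2
      have hzq1 := two_mul_zigzag_of_odd (k := q - 1) (by omega)
      have hf : (first (n - h) n : ZMod (n + 1)) = -1 := by
        rw [first, show n - h = 1 by omega, min_eq_right (by omega)]
        simp [zigzag]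
      rw [hf, han, if_neg (by omega), hc, hhn]
      have e : -zigzag (n - 1) + 2 * (zigzag q - zigzag (q - 1)) - zigzag n + 1 = -n + 1 := by omega
      have e' := congrArg (Int.cast : ℤ → ZMod (n + 1)) e
      push_cast at e'
      convert hu2 using 1
      simp only [z]
      linear_combination e' - hn0
    · have hzq := two_mul_zigzag_of_odd hq2
      have hzq1 := two_mul_zigzag_of_even (k := q - 1) (by omega)
      have hzn2 := two_mul_zigzag_of_even (k := n - 2) (by omega)
      have hf : (first (n - h) n : ZMod (n + 1)) = 1 := by
        rw [first, show n - h = 2 by omega, min_eq_right (by omega)]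
        simp [zigzag]
      rw [hf, han, if_pos hhn, hc, hhn]
      have e : -zigzag (n - 2) + 2 * (zigzag q - zigzag (q - 1)) +
          2 * (zigzag n - zigzag (n - 1)) - zigzag n - 1 = -2 := by omega
      have e' := congrArg (Int.cast : ℤ → ZMod (n + 1)) e
      push_cast at e'
      convert hu2.neg using 1

end Theta

/-! ### Explicit codes for small orders. -/

namespace ExplicitCode

/-- The point `x` lies in the triple `t`. -/
def has (x : ℕ) (t : ℕ × ℕ × ℕ) : Bool := Nat.beq x t.1 || (Nat.beq x t.2.1 || Nat.beq x t.2.2)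

/-- Two points of the triple `t` in different positions lie in the triple `u`. -/
def share (t u : ℕ × ℕ × ℕ) : Bool :=
  (has t.1 u && (has t.2.1 u || has t.2.2 u)) || (has t.2.1 u && has t.2.2 u)

/-- Consecutive entries of a list share two points. -/
def chained : List (ℕ × ℕ × ℕ) → Bool
  | t :: u :: l => share t u && chained (u :: l)
  | _ => true

/-- The points `0, …, v - 1` are pairwise covered at least twice. -/
def covers (v : ℕ) (L : List (ℕ × ℕ × ℕ)) : Bool :=
  (List.range v).all fun x => (List.range x).all fun y =>
    Nat.ble 2 ((L.filter (has x)).countP (has y))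

theorem isChain_of_chained : ∀ L, chained L = true → L.IsChain (fun t u => share t u = true)
  | [], _ => .nil
  | [_], _ => .singleton _
  | t :: u :: l, h => by
    rw [chained, Bool.and_eq_true] at h
    exact .cons_cons h.1 (isChain_of_chained (u :: l) h.2)

theorem exists_getElem_of_two_le_countP {α : Type} (p : α → Bool) : ∀ L : List α,
    2 ≤ L.countP p → ∃ i j : Fin L.length, i ≠ j ∧ p L[i] = true ∧ p L[j] = true
  | [], h => by simp at h
  | a :: l, h => by
    by_cases ha : p a = true
    · rw [List.countP_cons_of_pos ha] at h
      obtain ⟨b, hb, hpb⟩ := List.countP_pos_iff.1 (show 0 < l.countP p by omega)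
      obtain ⟨k, hk, rfl⟩ := List.getElem_of_mem hb
      exact ⟨⟨0, by simp⟩, ⟨k + 1, by simpa using hk⟩, by simp, ha, hpb⟩
    · rw [List.countP_cons_of_neg ha] at h
      obtain ⟨i, j, hij, hi, hj⟩ := exists_getElem_of_two_le_countP p l h
      exact ⟨i.succ, j.succ, by simpa using hij, hi, hj⟩

/-- The triple of numbers as a set of elements of `Fin v`. -/
def toBlock (v : ℕ) [NeZero v] (t : ℕ × ℕ × ℕ) : Finset (Fin v) :=
  {Fin.ofNat v t.1, Fin.ofNat v t.2.1, Fin.ofNat v t.2.2}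

theorem mem_toBlock {v : ℕ} [NeZero v] {x : ℕ} {t : ℕ × ℕ × ℕ} (h : has x t = true) :
    Fin.ofNat v x ∈ toBlock v t := by
  simp only [has, Bool.or_eq_true, Nat.beq_eq] at h
  rcases h with rfl | rfl | rfl <;> simp [toBlock]

theorem ne_of_card_eq_three {α : Type} [DecidableEq α] {a b c : α}
    (h : ({a, b, c} : Finset α).card = 3) : a ≠ b ∧ a ≠ c ∧ b ≠ c := by
  refine ⟨?_, ?_, ?_⟩ <;> rintro rfl
  · rw [Finset.insert_eq_of_mem (by simp)] at h
    have := Finset.card_le_two (a := a) (b := c); omega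
  · rw [Finset.insert_eq_of_mem (by simp)] at h
    have := Finset.card_le_two (a := b) (b := a); omega
  · rw [Finset.pair_eq_singleton] at h
    have := Finset.card_le_two (a := a) (b := b); omega

theorem sharePair_toBlock {v : ℕ} [NeZero v] {t u : ℕ × ℕ × ℕ} (h3 : (toBlock v t).card = 3)
    (h : share t u = true) : SharePair (toBlock v t) (toBlock v u) := by
  obtain ⟨h1, h2, h3⟩ := ne_of_card_eq_three h3
  simp only [share, Bool.or_eq_true, Bool.and_eq_true] at h
  rcases h with ⟨ha, hb | hb⟩ | ⟨ha, hb⟩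
  · exact ⟨_, _, h1, by simp [toBlock], by simp [toBlock], mem_toBlock ha, mem_toBlock hb⟩
  · exact ⟨_, _, h2, by simp [toBlock], by simp [toBlock], mem_toBlock ha, mem_toBlock hb⟩
  · exact ⟨_, _, h3, by simp [toBlock], by simp [toBlock], mem_toBlock ha, mem_toBlock hb⟩

/-- Blocks are indexed by positions, so repeated triples stay separate. Coverage at least twice,
adjacency and the block count are verified by computation; that the triples have three points and
cover pairs exactly twice follows by counting. -/
theorem hasGrayTTS (v : ℕ) (t : ℕ × ℕ × ℕ) (l : List (ℕ × ℕ × ℕ))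
    (hlen : 3 ≤ (t :: l).length) (hN : 3 * (t :: l).length = v * (v - 1))
    (hcov : covers v (t :: l) = true) (hch : chained (t :: (l ++ [t])) = true) :
    HasGrayTTS v := by
  have : NeZero v := ⟨by rintro rfl; simp at hN⟩
  set L := t :: l with hL
  have hmap : (List.finRange L.length).map (fun i => L[i]) = L := by
    rw [← List.ofFn_eq_map]; exact List.ofFn_getElem
  refine HasGrayTTS.of_list (V := Fin v) (ι := Fin L.length) (by simp) (List.finRange L.length)
    (List.nodup_finRange _) (by simpa using hlen) (fun i => toBlock v L[i]) (by simpa using hN)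
    (fun _ _ => Finset.card_le_three) ?_ ?_
  · have key : ∀ x y : Fin v, y < x → ∃ i j : Fin L.length, i ≠ j ∧ x ∈ toBlock v L[i] ∧
        y ∈ toBlock v L[i] ∧ x ∈ toBlock v L[j] ∧ y ∈ toBlock v L[j] := by
      intro x y hxy
      have h1 := List.all_eq_true.1 hcov x.1 (List.mem_range.2 x.2)
      have h2 := List.all_eq_true.1 h1 y.1 (List.mem_range.2 hxy)
      rw [Nat.ble_eq, List.countP_filter] at h2
      obtain ⟨i, j, hij, hi, hj⟩ := exists_getElem_of_two_le_countP _ _ h2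
      rw [Bool.and_eq_true] at hi hj
      have hx : Fin.ofNat v x.1 = x := by ext; simp [Fin.ofNat, Nat.mod_eq_of_lt x.2]
      have hy : Fin.ofNat v y.1 = y := by ext; simp [Fin.ofNat, Nat.mod_eq_of_lt y.2]
      refine ⟨i, j, hij, ?_, ?_, ?_, ?_⟩
      · rw [← hx]; exact mem_toBlock hi.2
      · rw [← hy]; exact mem_toBlock hi.1
      · rw [← hx]; exact mem_toBlock hj.2
      · rw [← hy]; exact mem_toBlock hj.1
    intro x y hxy
    rcases lt_or_gt_of_ne hxy with h | h
    · obtain ⟨i, j, hij, h1, h2, h3, h4⟩ := key y x h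
      exact ⟨i, List.mem_finRange i, j, List.mem_finRange j, hij, h2, h1, h4, h3⟩
    · obtain ⟨i, j, hij, h1, h2, h3, h4⟩ := key x y h
      exact ⟨i, List.mem_finRange i, j, List.mem_finRange j, hij, h1, h2, h3, h4⟩
  -- The test `share` compares positions in a triple; the cardinality supplied by the counting
  -- criterion makes the points in those positions distinct.
  · intro h3
    have hc : ((L : List (ℕ × ℕ × ℕ)) : Cycle (ℕ × ℕ × ℕ)).Chain (fun t u => share t u = true) := by
      rw [hL, Cycle.chain_coe_cons]; exact isChain_of_chained _ hch
    rw [← hmap, ← Cycle.map_coe, Cycle.chain_map] at hc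
    exact hc.imp fun i j h => sharePair_toBlock (h3 i (List.mem_finRange i)) h

theorem hasGrayTTS_four : HasGrayTTS 4 :=
  hasGrayTTS 4 (0,1,2)
    [(0,1,3), (0,2,3), (1,2,3)]
    (by decide +kernel) (by decide +kernel) (by decide +kernel) (by decide +kernel)

theorem hasGrayTTS_seven : HasGrayTTS 7 :=
  hasGrayTTS 7 (2,4,5)
    [(2,3,5), (3,5,6), (1,5,6), (1,2,6), (0,2,6), (0,2,3), (0,1,3), (0,1,5), (0,4,5), (0,4,6),
     (3,4,6), (1,3,4), (1,2,4)]
    (by decide +kernel) (by decide +kernel) (by decide +kernel) (by decide +kernel)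

theorem hasGrayTTS_nine : HasGrayTTS 9 :=
  hasGrayTTS 9 (1,2,6)
    [(1,2,4), (1,4,8), (4,6,8), (5,6,8), (1,5,8), (0,1,5), (0,4,5), (3,4,5), (2,3,4), (2,3,5),
     (2,5,7), (5,6,7), (4,6,7), (0,4,7), (0,1,7), (1,3,7), (1,3,6), (0,3,6), (0,3,8), (3,7,8),
     (2,7,8), (0,2,8), (0,2,6)]
    (by decide +kernel) (by decide +kernel) (by decide +kernel) (by decide +kernel)

theorem hasGrayTTS_twelve : HasGrayTTS 12 :=
  hasGrayTTS 12 (2,4,8)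
    [(2,5,8), (2,5,10), (1,5,10), (1,5,11), (1,8,11), (1,6,8), (6,7,8), (5,6,7), (4,5,6),
     (4,6,10), (6,10,11), (3,10,11), (3,8,10), (8,9,10), (7,8,9), (2,7,9), (2,7,10), (4,7,10),
     (1,4,7), (1,4,9), (1,6,9), (3,6,9), (0,3,6), (0,3,8), (0,5,8), (0,5,7), (0,7,11), (3,7,11),
     (1,3,7), (1,2,3), (2,3,4), (3,4,5), (3,5,9), (5,9,11), (2,9,11), (2,6,11), (0,2,6), (0,1,2),
     (0,1,10), (0,9,10), (0,4,9), (0,4,11), (4,8,11)]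
    (by decide +kernel) (by decide +kernel) (by decide +kernel) (by decide +kernel)

theorem hasGrayTTS_eighteen : HasGrayTTS 18 :=
  hasGrayTTS 18 (3,4,9)
    [(0,4,9), (0,9,11), (9,11,17), (11,13,17), (2,11,13), (2,6,11), (5,6,11), (3,5,11), (3,11,15),
     (3,14,15), (3,12,14), (3,7,12), (6,7,12), (6,7,10), (6,10,15), (9,10,15), (9,10,13),
     (3,10,13), (3,6,13), (2,3,6), (2,3,8), (0,2,8), (0,2,17), (2,4,17), (2,4,10), (4,5,10),
     (1,5,10), (1,10,12), (10,12,17), (12,14,17), (14,16,17), (1,16,17), (1,7,16), (1,2,7),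
     (1,2,5), (2,5,12), (2,9,12), (2,9,16), (2,15,16), (2,7,15), (7,9,15), (7,9,17), (5,7,17),
     (3,5,17), (1,3,17), (1,3,9), (1,9,13), (1,12,13), (12,13,16), (6,13,16), (6,9,16), (5,6,9),
     (5,9,14), (5,14,16), (0,5,16), (0,5,13), (5,7,13), (7,8,13), (4,8,13), (4,5,8), (5,8,15),
     (5,12,15), (11,12,15), (0,11,12), (0,8,12), (8,9,12), (8,9,14), (6,8,14), (1,6,14),
     (1,14,15), (1,8,15), (1,8,11), (7,8,11), (7,11,16), (10,11,16), (10,11,14), (2,10,14),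
     (2,13,14), (0,13,14), (0,7,14), (0,7,10), (0,3,10), (0,3,16), (3,8,16), (8,10,16), (8,10,17),
     (6,8,17), (4,6,17), (4,6,12), (4,12,16), (4,15,16), (4,13,15), (13,15,17), (0,15,17),
     (0,6,15), (0,1,6), (0,1,4), (1,4,11), (4,11,14), (4,7,14), (3,4,7)]
    (by decide +kernel) (by decide +kernel) (by decide +kernel) (by decide +kernel)

theorem hasGrayTTS_twentyFour : HasGrayTTS 24 :=
  hasGrayTTS 24 (1,5,11)
    [(4,5,11), (4,5,20), (4,20,21), (13,20,21), (13,14,20), (6,13,14), (6,14,17), (5,14,17),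
     (2,5,17), (1,2,17), (1,17,18), (1,14,18), (14,16,18), (16,18,20), (3,16,20), (3,19,20),
     (3,4,19), (4,7,19), (4,7,18), (4,18,23), (4,13,23), (4,13,16), (5,13,16), (2,5,16),
     (2,16,23), (7,16,23), (7,16,19), (8,16,19), (8,15,16), (15,16,22), (0,15,22), (0,6,22),
     (0,6,19), (0,19,21), (0,2,21), (2,8,21), (1,2,8), (1,8,9), (8,9,15), (5,9,15), (5,10,15),
     (0,5,10), (0,5,18), (0,13,18), (8,13,18), (8,12,18), (8,10,12), (6,8,10), (4,6,8), (4,8,14),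
     (4,9,14), (4,9,22), (3,9,22), (2,3,9), (2,9,10), (2,10,13), (1,10,13), (1,13,21), (1,12,21),
     (1,9,12), (0,9,12), (0,9,23), (9,18,23), (9,18,21), (6,9,21), (6,9,20), (6,20,23),
     (11,20,23), (2,11,23), (2,11,14), (3,11,14), (3,10,11), (3,4,10), (0,4,10), (0,2,4), (2,4,6),
     (2,6,12), (2,7,12), (7,12,17), (7,11,17), (10,11,17), (10,17,18), (10,18,21), (7,10,21),
     (7,21,23), (12,21,23), (3,12,23), (3,12,15), (0,3,15), (0,3,14), (0,14,23), (5,14,23),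
     (5,19,23), (5,8,19), (5,8,20), (8,17,20), (9,17,20), (9,16,17), (9,10,16), (6,10,16),
     (6,11,16), (11,16,21), (3,16,21), (3,8,21), (3,8,13), (3,7,13), (6,7,13), (6,7,22),
     (7,10,22), (10,19,22), (10,19,23), (1,10,23), (1,15,23), (6,15,23), (6,15,18), (7,15,18),
     (7,14,15), (7,8,14), (0,7,8), (0,1,7), (1,7,20), (2,7,20), (2,15,20), (10,15,20), (10,14,20),
     (10,12,14), (12,14,16), (12,16,22), (12,17,22), (4,17,22), (4,17,21), (17,19,21), (15,17,19),
     (2,15,19), (2,18,19), (2,3,18), (3,6,18), (3,6,17), (3,17,23), (8,17,23), (8,22,23),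
     (13,22,23), (2,13,22), (2,14,22), (14,21,22), (14,15,21), (11,15,21), (11,13,15), (13,15,17),
     (0,13,17), (0,16,17), (0,1,16), (1,4,16), (1,4,15), (4,12,15), (4,11,12), (11,12,18),
     (11,18,19), (11,19,22), (8,11,22), (0,8,11), (0,11,20), (0,12,20), (12,19,20), (12,13,19),
     (5,12,13), (5,6,12), (5,6,21), (5,21,22), (5,18,22), (18,20,22), (1,20,22), (1,3,22),
     (1,3,5), (3,5,7), (5,7,9), (7,9,11), (9,11,13), (9,13,19), (9,14,19), (1,14,19), (1,6,19),
     (1,6,11)]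
    (by decide +kernel) (by decide +kernel) (by decide +kernel) (by decide +kernel)

theorem hasGrayTTS_thirty : HasGrayTTS 30 :=
  hasGrayTTS 30 (11,17,19)
    [(7,11,19), (6,7,11), (0,6,11), (0,10,11), (10,11,15), (4,10,15), (4,10,12), (0,4,12),
     (0,3,12), (0,3,19), (0,1,19), (0,1,5), (0,5,23), (4,5,23), (4,5,9), (5,9,17), (5,8,17),
     (5,8,24), (8,22,24), (16,22,24), (16,22,27), (16,26,27), (0,16,26), (0,14,16), (0,7,14),
     (0,7,22), (0,15,22), (8,15,22), (1,8,15), (1,8,23), (1,16,23), (1,3,16), (1,3,24), (3,20,24),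
     (3,20,23), (3,23,29), (3,12,29), (12,21,29), (9,12,21), (9,13,21), (8,9,13), (2,8,13),
     (2,8,10), (8,10,23), (10,20,23), (10,20,21), (10,16,21), (16,17,21), (6,16,17), (6,12,17),
     (6,12,14), (12,14,27), (5,12,27), (5,12,19), (12,19,26), (4,19,26), (4,11,26), (4,11,18),
     (4,18,20), (1,4,20), (1,2,20), (2,20,26), (2,26,27), (2,10,27), (1,10,27), (1,17,27),
     (1,15,17), (9,15,17), (9,15,20), (9,19,20), (19,20,24), (13,19,24), (13,19,21), (5,19,21),
     (2,5,21), (2,3,21), (3,21,27), (0,21,27), (0,17,21), (0,17,20), (0,20,29), (0,9,29),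
     (0,9,26), (1,9,26), (1,25,26), (1,19,25), (19,25,27), (11,25,27), (11,18,25), (3,18,25),
     (3,10,25), (10,12,25), (12,22,25), (12,22,23), (22,23,27), (6,23,27), (6,23,26), (6,26,29),
     (6,15,29), (15,24,29), (12,15,24), (12,16,24), (11,12,16), (5,11,16), (5,15,16), (15,16,20),
     (16,20,28), (20,26,28), (12,26,28), (9,12,28), (9,10,28), (5,10,28), (5,7,28), (7,24,28),
     (7,24,27), (14,24,27), (14,24,25), (0,24,25), (0,18,24), (0,18,28), (0,4,28), (4,22,28),
     (3,4,22), (3,4,8), (4,8,16), (8,14,16), (8,14,19), (8,18,19), (8,18,21), (1,18,21),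
     (1,21,29), (1,10,29), (10,19,29), (7,10,19), (7,10,26), (10,24,26), (18,24,26), (14,18,26),
     (13,14,18), (3,13,14), (3,13,16), (13,16,25), (16,25,29), (5,25,29), (5,22,25), (5,22,26),
     (21,22,26), (11,21,22), (11,17,22), (17,18,22), (1,18,22), (1,22,28), (1,14,28), (1,11,14),
     (1,11,12), (1,7,12), (1,7,9), (7,9,22), (9,19,22), (2,19,22), (2,22,29), (13,22,29),
     (10,13,22), (0,10,13), (0,13,27), (13,20,27), (5,20,27), (5,7,20), (7,17,20), (7,17,18),
     (7,13,18), (7,13,15), (13,15,28), (6,13,28), (6,13,20), (6,20,22), (3,6,22), (3,6,15),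
     (3,7,15), (2,3,7), (2,7,25), (6,7,25), (6,9,25), (6,9,18), (9,18,29), (18,27,29), (7,27,29),
     (7,16,29), (4,7,16), (4,7,23), (7,21,23), (7,14,21), (14,21,28), (6,21,28), (6,8,21),
     (0,6,8), (0,8,25), (8,25,28), (15,25,28), (15,25,26), (15,21,26), (15,21,23), (11,15,23),
     (11,14,23), (14,23,29), (5,14,29), (2,5,14), (2,6,14), (1,2,6), (1,6,24), (5,6,24), (5,6,10),
     (6,10,18), (10,16,18), (2,16,18), (2,18,28), (2,11,28), (2,11,29), (11,20,29), (8,11,20),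
     (8,11,27), (8,9,27), (4,9,27), (4,6,27), (4,6,19), (6,16,19), (16,19,28), (19,28,29),
     (8,28,29), (8,17,29), (17,26,29), (14,17,26), (4,14,17), (4,14,15), (14,15,19), (15,19,27),
     (15,18,27), (5,15,18), (3,5,18), (3,5,26), (3,8,26), (7,8,26), (7,8,12), (8,12,20),
     (12,18,20), (12,18,23), (18,19,23), (2,19,23), (0,2,23), (0,2,15), (2,12,15), (2,12,13),
     (12,13,17), (13,17,25), (17,23,25), (9,23,25), (9,16,23), (2,9,16), (2,9,24), (9,11,24),
     (11,21,24), (4,21,24), (4,24,29), (4,13,29), (1,4,13), (1,5,13), (5,11,13), (11,13,26),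
     (13,23,26), (13,23,24), (23,24,28), (17,23,28), (17,27,28), (3,27,28), (3,11,28), (3,9,11),
     (3,9,14), (9,10,14), (10,14,22), (14,20,22), (14,20,25), (20,21,25), (4,21,25), (2,4,25),
     (2,4,17), (2,17,24), (10,17,24), (3,10,17), (3,17,19)]
    (by decide +kernel) (by decide +kernel) (by decide +kernel) (by decide +kernel)

end ExplicitCode

/-! ### Orders 6t+6: a cyclic group with one fixed point. -/

namespace Rotational

variable {n : ℕ}

/-- The block spanned by two consecutive pairs of a sequence of pairs `{F p, F p + D p}`. -/
def block (F D : ℕ → ZMod n) (p : ℕ) : Finset (Option (ZMod n)) :=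
  {some (F p), some (F p + D p), some (F (p + 1)), some (F (p + 1) + D (p + 1))}

theorem sharePair_of_mem {A B : Finset (Option (ZMod n))} {x y : ZMod n} (hxy : x ≠ y)
    (h1 : some x ∈ A) (h2 : some y ∈ A) (h3 : some x ∈ B) (h4 : some y ∈ B) : SharePair A B :=
  ⟨some x, some y, by simpa using hxy, h1, h2, h3, h4⟩

theorem sharePair_block_succ {F D : ℕ → ZMod n} (hD : ∀ p, D p ≠ 0) (p : ℕ) :
    SharePair (block F D p) (block F D (p + 1)) :=
  sharePair_of_mem (x := F (p + 1)) (y := F (p + 1) + D (p + 1)) (by simpa using (hD (p + 1)))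
    (by simp [block]) (by simp [block]) (by simp [block]) (by simp [block])

theorem add_mul_period {F : ℕ → ZMod n} {g : ZMod n} {L : ℕ} (hF : ∀ p, F (p + L) = F p + g)
    (q p : ℕ) : F (p + q * L) = F p + q * g := by
  induction q with
  | zero => simp
  | succ q ih =>
    rw [show p + (q + 1) * L = p + q * L + L by ring, hF, ih]; push_cast; ring

theorem mem_block_add {F D : ℕ → ZMod n} {g : ZMod n} {L : ℕ} (hF : ∀ p, F (p + L) = F p + g)
    (hD : ∀ p, D (p + L) = D p) (q p : ℕ) {z : ZMod n} (hz : some z ∈ block F D p) :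
    some (z + q * g) ∈ block F D (p + q * L) := by
  have hD' : ∀ p, D (p + q * L) = D p := fun p => by
    rw [add_mul_period (F := D) (g := 0) (L := L) (by simpa using hD), mul_zero, add_zero]
  simp only [block, Finset.mem_insert, Finset.mem_singleton, Option.some.injEq] at hz ⊢
  rw [show p + q * L + 1 = p + 1 + q * L by ring, add_mul_period hF, add_mul_period hF, hD', hD']
  rcases hz with rfl | rfl | rfl | rfl
  · exact Or.inl rfl
  · exact Or.inr (Or.inl (by ring))
  · exact Or.inr (Or.inr (Or.inl rfl))
  · exact Or.inr (Or.inr (Or.inr (by ring)))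

/-- Consecutive pairs have a common endpoint, in one of four ways, so the four listed points
collapse to three. -/
theorem card_block_le {F D : ℕ → ZMod n} {p : ℕ}
    (h : F p = F (p + 1) ∨ F p + D p = F (p + 1) + D (p + 1) ∨
      F p = F (p + 1) + D (p + 1) ∨ F p + D p = F (p + 1)) : (block F D p).card ≤ 3 := by
  have hsub : ∃ c, block F D p ⊆ {some (F p), some (F p + D p), c} := by
    rcases h with h | h | h | h
    · exact ⟨some (F (p + 1) + D (p + 1)), by
        simp only [block, Finset.insert_subset_iff, Finset.singleton_subset_iff]; simp [h]⟩
    · exact ⟨some (F (p + 1)), by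
        simp only [block, Finset.insert_subset_iff, Finset.singleton_subset_iff]; simp [h]⟩
    · exact ⟨some (F (p + 1)), by
        simp only [block, Finset.insert_subset_iff, Finset.singleton_subset_iff]; simp [h]⟩
    · exact ⟨some (F (p + 1) + D (p + 1)), by
        simp only [block, Finset.insert_subset_iff, Finset.singleton_subset_iff]; simp [h]⟩
  obtain ⟨c, h⟩ := hsub
  exact (Finset.card_le_card h).trans Finset.card_le_three

theorem card_block_le_of_period {F D : ℕ → ZMod n} {g : ZMod n} {L : ℕ} (hL : 1 ≤ L)
    (hF : ∀ p, F (p + L) = F p + g) (hD : ∀ p, D (p + L) = D p)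
    (hcard : ∀ p < L, F p = F (p + 1) ∨ F p + D p = F (p + 1) + D (p + 1) ∨
      F p = F (p + 1) + D (p + 1) ∨ F p + D p = F (p + 1)) (p : ℕ) :
    (block F D p).card ≤ 3 := by
  apply card_block_le
  have hD' : ∀ q p, D (p + q * L) = D p := fun q p => by
    rw [add_mul_period (F := D) (g := 0) (L := L) (by simpa using hD), mul_zero, add_zero]
  have h := hcard (p % L) (Nat.mod_lt _ (by omega))
  obtain ⟨r, q, hr⟩ : ∃ r q, r = p % L ∧ q = p / L := ⟨_, _, rfl, rfl⟩
  have hp : p = r + q * L := by rw [hr.1, hr.2, mul_comm, Nat.mod_add_div]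
  rw [← hr.1] at h
  rw [hp, show r + q * L + 1 = r + 1 + q * L by ring, add_mul_period hF, add_mul_period hF, hD', hD']
  rcases h with h | h | h | h
  · exact Or.inl (by linear_combination h)
  · exact Or.inr (Or.inl (by linear_combination h))
  · exact Or.inr (Or.inr (Or.inl (by linear_combination h)))
  · exact Or.inr (Or.inr (Or.inr (by linear_combination h)))

/-- A cyclically developed sequence of pairs of `ZMod n` and the ring of all blocks
`{∞, y, y + d}`, suitably arranged, form a twofold triple system with a Gray code. -/
theorem hasGrayTTS [NeZero n] {L : ℕ} (hL : 1 ≤ L) (hn : n + 1 = 3 * (L + 1))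
    (F D : ℕ → ZMod n) (g d step x₁ : ZMod n) (hg : IsUnit g) (hd : IsUnit d)
    (hstep : step = d ∨ step = -d)
    (hF : ∀ p, F (p + L) = F p + g) (hD : ∀ p, D (p + L) = D p)
    (hcard : ∀ p < L, F p = F (p + 1) ∨ F p + D p = F (p + 1) + D (p + 1) ∨
      F p = F (p + 1) + D (p + 1) ∨ F p + D p = F (p + 1))
    (hcov : ∀ e : ZMod n, e ≠ 0 → ∃ e', (e' = e ∨ e' = -e) ∧
      ((∃ r < L, ∃ r' < L, r ≠ r' ∧ ∃ u u', some u ∈ block F D r ∧ some (u + e') ∈ block F D r ∧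
        some u' ∈ block F D r' ∧ some (u' + e') ∈ block F D r') ∨
       (e' = d ∧ ∃ r < L, ∃ u, some u ∈ block F D r ∧ some (u + d) ∈ block F D r)))
    (ord : List ℕ) (hord : ord.Perm (List.range' 1 (n * L)))
    (hchain : ord.IsChain (fun p p' => SharePair (block F D p) (block F D p')))
    (hlast : ∀ p ∈ ord.getLast?, some x₁ ∈ block F D p ∧ some (x₁ + d) ∈ block F D p)
    (hhead : ∀ p ∈ ord.head?, some (x₁ - step) ∈ block F D p ∧
      some (x₁ - step + d) ∈ block F D p) :
    HasGrayTTS (n + 1) := by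
  have hn5 : 5 ≤ n := by omega
  have hone : (1 : ZMod n) ≠ 0 := by
    have : Fact (1 < n) := ⟨by omega⟩
    exact one_ne_zero
  have hd0 : d ≠ 0 := by
    have : Fact (1 < n) := ⟨by omega⟩
    exact hd.ne_zero
  have hstepu : IsUnit step := by
    rcases hstep with rfl | rfl
    · exact hd
    · exact hd.neg
  let y : ℕ → ZMod n := fun i => x₁ + i * step
  let W : ℕ → Finset (Option (ZMod n)) := fun i => {none, some (y i), some (y i + d)}
  let f : ℕ ⊕ ℕ → Finset (Option (ZMod n)) := Sum.elim (block F D) W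
  -- The Gray code is the rearranged path of finite blocks followed by the ring of ∞-blocks, cut
  -- open between the pairs at x₁ - step and x₁.
  let l : List (ℕ ⊕ ℕ) := ord.map Sum.inl ++ (List.range n).map Sum.inr
  have hsolve : ∀ g : ZMod n, IsUnit g → ∀ s, ∃ q < n, (q : ZMod n) * g = s := by
    rintro _ ⟨u, rfl⟩ s
    refine ⟨(s * ↑u⁻¹ : ZMod n).val, ZMod.val_lt _, ?_⟩
    rw [ZMod.natCast_val, ZMod.cast_id', id, mul_assoc, Units.inv_mul, mul_one]
  have hmemW : ∀ i, i < n → Sum.inr i ∈ l := by intro i hi; simp [l, hi]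
  have hmemB : ∀ p, 1 ≤ p → p ≤ n * L → Sum.inl p ∈ l := by
    intro p h1 h2
    refine List.mem_append_left _ (List.mem_map.2 ⟨p, hord.mem_iff.2 ?_, rfl⟩)
    rw [List.mem_range'_1]; omega
  have hWsurj : ∀ z, ∃ i < n, y i = z := by
    intro z
    obtain ⟨q, hq, h⟩ := hsolve step hstepu (z - x₁)
    exact ⟨q, hq, by simp only [y, h]; ring⟩
  have hlenord : ord.length = n * L := by rw [hord.length_eq]; simp
  have hlen : l.length = n * L + n := by simp [l, hlenord]
  have hpos : ∀ r < L, ∀ s : ZMod n, ∃ p, Sum.inl p ∈ l ∧ p % L = r ∧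
      ∀ z w, some z ∈ block F D r → z + s = w → some w ∈ block F D p := by
    intro r hr s
    obtain ⟨q, hq, rfl⟩ := hsolve g hg s
    -- Positions run from 1 to nL, so position 0 is replaced by nL, which carries the same block
    -- because n·g = 0.
    by_cases h0 : r + q * L = 0
    · refine ⟨r + n * L, hmemB _ ?_ ?_, ?_, ?_⟩
      · have : 1 * 1 ≤ n * L := Nat.mul_le_mul (by omega) hL
        omega
      · omega
      · rw [Nat.add_mul_mod_self_right, Nat.mod_eq_of_lt hr]
      · rintro z _ hz rfl
        have hq0 : q = 0 := by
          have := Nat.eq_zero_of_add_eq_zero_left h0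
          rcases Nat.mul_eq_zero.1 this with h | h <;> omega
        have := mem_block_add hF hD n r hz
        simpa [hq0] using this
    · refine ⟨r + q * L, hmemB _ (by omega) ?_, ?_, ?_⟩
      · have : (q + 1) * L ≤ n * L := Nat.mul_le_mul_right L hq
        rw [add_mul, one_mul] at this
        omega
      · rw [Nat.add_mul_mod_self_right, Nat.mod_eq_of_lt hr]
      · rintro z _ hz rfl
        exact mem_block_add hF hD q r hz
  have hcovpt : ∀ x w : ZMod n, x ≠ w → ∃ i ∈ l, ∃ j ∈ l, i ≠ j ∧
      some x ∈ f i ∧ some w ∈ f i ∧ some x ∈ f j ∧ some w ∈ f j := by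
    have key : ∀ x e : ZMod n,
        ((∃ r < L, ∃ r' < L, r ≠ r' ∧ ∃ u u', some u ∈ block F D r ∧ some (u + e) ∈ block F D r ∧
          some u' ∈ block F D r' ∧ some (u' + e) ∈ block F D r') ∨
        (e = d ∧ ∃ r < L, ∃ u, some u ∈ block F D r ∧ some (u + d) ∈ block F D r)) →
        ∃ i ∈ l, ∃ j ∈ l, i ≠ j ∧
        some x ∈ f i ∧ some (x + e) ∈ f i ∧ some x ∈ f j ∧ some (x + e) ∈ f j := by
      rintro x e (⟨r, hr, r', hr', hne, u, u', h1, h2, h3, h4⟩ | ⟨rfl, r, hr, u, h1, h2⟩)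
      · obtain ⟨p, hp, hpr, hpz⟩ := hpos r hr (x - u)
        obtain ⟨p', hp', hpr', hpz'⟩ := hpos r' hr' (x - u')
        refine ⟨_, hp, _, hp', ?_, ?_, ?_, ?_, ?_⟩
        · rintro h
          rw [Sum.inl.inj h] at hpr
          exact hne (hpr.symm.trans hpr')
        · exact hpz _ _ h1 (by ring)
        · exact hpz _ _ h2 (by ring)
        · exact hpz' _ _ h3 (by ring)
        · exact hpz' _ _ h4 (by ring)
      · obtain ⟨p, hp, hpr, hpz⟩ := hpos r hr (x - u)
        obtain ⟨i, hi, hix⟩ := hWsurj x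
        refine ⟨_, hp, _, hmemW i hi, by simp, ?_, ?_, ?_, ?_⟩
        · exact hpz _ _ h1 (by ring)
        · exact hpz _ _ h2 (by ring)
        · simp [f, W, hix]
        · simp [f, W, hix]
    intro x w hxw
    obtain ⟨e, he | he, hc⟩ := hcov (w - x) (sub_ne_zero.2 hxw.symm)
    · obtain ⟨i, hi, j, hj, hij, h1, h2, h3, h4⟩ := key x e hc
      have : x + e = w := by rw [he]; ring
      rw [this] at h2 h4
      exact ⟨i, hi, j, hj, hij, h1, h2, h3, h4⟩
    · obtain ⟨i, hi, j, hj, hij, h1, h2, h3, h4⟩ := key w e hc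
      have : w + e = x := by rw [he]; ring
      rw [this] at h2 h4
      exact ⟨i, hi, j, hj, hij, h2, h1, h4, h3⟩
  -- The point w lies in the ∞-blocks based at w and at w - d, which differ since d ≠ 0.
  have hcovinf : ∀ w : ZMod n, ∃ i ∈ l, ∃ j ∈ l, i ≠ j ∧
      none ∈ f i ∧ some w ∈ f i ∧ none ∈ f j ∧ some w ∈ f j := by
    intro w
    obtain ⟨i, hi, hiw⟩ := hWsurj w
    obtain ⟨j, hj, hjw⟩ := hWsurj (w - d)
    refine ⟨_, hmemW i hi, _, hmemW j hj, ?_, ?_, ?_, ?_, ?_⟩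
    · rintro h
      rw [Sum.inr.inj h, hjw] at hiw
      exact hd0 (by linear_combination -hiw)
    all_goals simp [f, W, hiw, hjw]
  have hcardB := card_block_le_of_period hL hF hD hcard
  have hord0 : ord ≠ [] := by
    rintro rfl
    have : 1 * 1 ≤ n * L := Nat.mul_le_mul (by omega) hL
    simp at hlenord
    omega
  refine HasGrayTTS.of_list (V := Option (ZMod n)) (by simp [ZMod.card]) l ?_ (by rw [hlen]; omega)
    f ?_ ?_ ?_ (fun _ => ?_)
  · refine List.nodup_append'.2 ⟨?_, List.nodup_range.map Sum.inr_injective, ?_⟩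
    · exact (hord.nodup_iff.2 List.nodup_range').map Sum.inl_injective
    · rw [List.disjoint_left]
      intro z h1 h2
      obtain ⟨_, _, rfl⟩ := List.mem_map.1 h1
      simp at h2
  · rw [hlen, hn, Nat.mul_sub_one, ← hn, show n * L + n = n * (L + 1) by ring,
      show 3 * (n * (L + 1)) = n * (3 * (L + 1)) by ring, ← hn]
    have : (n + 1) * (n + 1) - (n + 1) = n * (n + 1) := by
      rw [show (n + 1) * (n + 1) = n * (n + 1) + (n + 1) by ring, Nat.add_sub_cancel]
    omega
  · rintro (p | i) _
    · exact hcardB p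
    · exact Finset.card_le_three
  · rintro (_ | x) (_ | w) hne
    · exact absurd rfl hne
    · exact hcovinf w
    · obtain ⟨i, hi, j, hj, hij, h1, h2, h3, h4⟩ := hcovinf x
      exact ⟨i, hi, j, hj, hij, h2, h1, h4, h3⟩
    · exact hcovpt x w (by simpa using hne)
  -- Adjacent ∞-blocks share ∞ and one finite point, because successive bases differ by d or -d.
  · have hWW : ((List.range n).map Sum.inr).IsChain (fun i j => SharePair (f i) (f j)) := by
      rw [List.isChain_map, List.isChain_range]
      intro i _
      have hyi : y (i + 1) = y i + step := by simp only [y]; push_cast; ring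
      rcases hstep with h | h
      · exact ⟨none, some (y i + d), by simp, by simp [f, W], by simp [f, W], by simp [f, W],
          by simp [f, W, hyi, h]⟩
      · exact ⟨none, some (y i), by simp, by simp [f, W], by simp [f, W], by simp [f, W],
          by simp [f, W, hyi, h]⟩
    have hBB : (ord.map Sum.inl).IsChain (fun i j => SharePair (f i) (f j)) := by
      rw [List.isChain_map]; exact hchain
    have hn0 : n ≠ 0 := by omega
    have hne : l ≠ [] := by simp [l, hord0]
    rw [Cycle.chain_ne_nil _ hne]
    refine List.IsChain.cons (List.IsChain.append hBB hWW ?_) ?_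
    · simp only [List.getLast?_map, List.head?_map, List.head?_range, hn0, if_false,
        Option.map_some, Option.mem_def, Option.some.injEq, Option.map_eq_some_iff]
      rintro _ ⟨p, hp, rfl⟩ _ rfl
      obtain ⟨h1, h2⟩ := hlast p hp
      exact sharePair_of_mem (x := x₁) (y := x₁ + d) (by simpa using hd0) h1 h2
        (by simp [f, W, y]) (by simp [f, W, y])
    · have hlastl : l.getLast hne = Sum.inr (n - 1) := by
        have : l.getLast? = some (Sum.inr (n - 1)) := by
          simp [l, List.getLast?_append, List.getLast?_range, hn0]
        rw [List.getLast?_eq_some_getLast hne] at this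
        exact Option.some.inj this
      rw [hlastl]
      obtain ⟨a, o, rfl⟩ := List.exists_cons_of_ne_nil hord0
      intro z hz
      simp only [l, List.map_cons, List.cons_append, List.head?_cons, Option.mem_def,
        Option.some.injEq] at hz
      subst hz
      obtain ⟨h1, h2⟩ := hhead a rfl
      have hy : y (n - 1) = x₁ - step := by
        simp only [y]
        rw [Nat.cast_sub (by omega)]
        simp
        ring
      exact sharePair_of_mem (x := x₁ - step) (y := x₁ - step + d) (by simpa using hd0)
        (by simp [f, W, hy]) (by simp [f, W, hy]) h1 h2

end Rotational

/-! ### The difference pattern of one period and its blocks. -/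

namespace Rotational

/-- The differences of the pairs in one period. -/
def diff (t : ℕ) (b : ℤ) (r : ℕ) : ℤ :=
  if r = 0 then b - t - zigzag (t - 1)
  else if r ≤ t + 1 then b + zigzag (t + 1 - r) else b - t - zigzag (r - t - 2)

theorem diff_zero (t : ℕ) (b : ℤ) : diff t b 0 = b - t - zigzag (t - 1) := rfl

/-- The indices 1, …, t+1 run backwards through b + zigzag, with steps of sizes t, …, 1. The drop by
t at index t+1 and the forward zigzag with steps 1, …, t-1 then give every size from 1 to t a second
time. -/
theorem diff_long {t r k : ℕ} (b : ℤ) (h : r + k = t + 1) (hr : 1 ≤ r) :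
    diff t b r = b + zigzag k := by
  rw [diff, if_neg (by omega), if_pos (by omega), show t + 1 - r = k by omega]

theorem diff_short {t r k : ℕ} (b : ℤ) (h : r = t + 2 + k) :
    diff t b r = b - t - zigzag k := by
  rw [diff, if_neg (by omega), if_neg (by omega), show r - t - 2 = k by omega]

theorem abs_zigzag_le (k : ℕ) : -(k : ℤ) ≤ 2 * zigzag k ∧ 2 * zigzag k ≤ k + 1 := by
  rcases Nat.mod_two_eq_zero_or_one k with h | h
  · have := two_mul_zigzag_of_even h; omega
  · have := two_mul_zigzag_of_odd h; omega

theorem exists_zigzag_eq_int (z : ℤ) : ∃ k : ℕ, zigzag k = z ∧ (0 < z → (k : ℤ) = 2 * z - 1) ∧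
    (z ≤ 0 → (k : ℤ) = -2 * z) := by
  rcases lt_or_ge 0 z with h | h
  · obtain ⟨m, hm⟩ := Int.eq_ofNat_of_zero_le h.le
    refine ⟨2 * m - 1, ?_, by omega, by omega⟩
    have := two_mul_zigzag_of_odd (k := 2 * m - 1) (by omega)
    omega
  · obtain ⟨m, hm⟩ := Int.eq_ofNat_of_zero_le (show 0 ≤ -z by omega)
    refine ⟨2 * m, ?_, by omega, by omega⟩
    have := two_mul_zigzag_of_even (k := 2 * m) (by omega)
    omega

/-- The first point of the pair at position `p`. -/
def framePos (t : ℕ) (g : ℤ) (f : ℕ → ℤ) (p : ℕ) : ZMod (6 * t + 5) :=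
  (((p / (2 * t + 1) : ℕ) * g + f (p % (2 * t + 1)) : ℤ) : ZMod (6 * t + 5))

/-- The difference of the pair at position `p`. -/
def diffPos (t : ℕ) (b : ℤ) (p : ℕ) : ZMod (6 * t + 5) :=
  ((diff t b (p % (2 * t + 1)) : ℤ) : ZMod (6 * t + 5))

section

variable {t : ℕ} {b g : ℤ} {f : ℕ → ℤ}

theorem framePos_add (p : ℕ) :
    framePos t g f (p + (2 * t + 1)) = framePos t g f p + (g : ZMod (6 * t + 5)) := by
  rw [framePos, framePos, Nat.add_div_right _ (by omega), Nat.add_mod_right]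
  push_cast; ring

theorem diffPos_add (p : ℕ) : diffPos t b (p + (2 * t + 1)) = diffPos t b p := by
  rw [diffPos, diffPos, Nat.add_mod_right]

theorem framePos_eq (h0 : f 0 = 0) (hL : f (2 * t + 1) = g) {r : ℕ} (hr : r ≤ 2 * t + 1) (q : ℕ) :
    framePos t g f (r + q * (2 * t + 1)) = ((q * g + f r : ℤ) : ZMod (6 * t + 5)) := by
  have base : framePos t g f r = (f r : ZMod (6 * t + 5)) := by
    rcases hr.lt_or_eq with h | rfl
    · rw [framePos, Nat.div_eq_of_lt h, Nat.mod_eq_of_lt h]; simp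
    · rw [framePos, Nat.div_self (by omega), Nat.mod_self, h0, hL]; simp
  rw [add_mul_period framePos_add, base]
  push_cast; ring

/-- The value r = 2t+1 is allowed because the difference at index 0 repeats the one at the end of
the period. -/
theorem diffPos_eq (ht : 1 ≤ t) {r : ℕ} (hr : r ≤ 2 * t + 1) (q : ℕ) :
    diffPos t b (r + q * (2 * t + 1)) = (diff t b r : ZMod (6 * t + 5)) := by
  rcases hr.lt_or_eq with h | rfl
  · rw [diffPos, Nat.add_mul_mod_self_right, Nat.mod_eq_of_lt h]
  · rw [diffPos, Nat.add_mul_mod_self_right, Nat.mod_self, diff_zero,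
      diff_short (k := t - 1) b (by omega)]

theorem intCast_eq_of_eq_add {n : ℕ} {x y c : ℤ} (h : x = y + c * n) : (x : ZMod n) = y := by
  rw [h]; simp

theorem intCast_ne_zero {n : ℕ} {x : ℤ} (h0 : x ≠ 0) (h : |x| < n) : (x : ZMod n) ≠ 0 := by
  intro hx
  rw [ZMod.intCast_zmod_eq_zero_iff_dvd] at hx
  exact h0 (Int.eq_zero_of_abs_lt_dvd hx h)

/-- The four (at most three different) points of the block at position `r + qL`. -/
theorem mem_block_iff (ht : 1 ≤ t) (h0 : f 0 = 0) (hL : f (2 * t + 1) = g) {r : ℕ}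
    (hr : r < 2 * t + 1) (q : ℕ) {x : ZMod (6 * t + 5)} :
    some x ∈ block (framePos t g f) (diffPos t b) (r + q * (2 * t + 1)) ↔
      x = ((q * g + f r : ℤ) : ZMod (6 * t + 5)) ∨
      x = ((q * g + f r + diff t b r : ℤ) : ZMod (6 * t + 5)) ∨
      x = ((q * g + f (r + 1) : ℤ) : ZMod (6 * t + 5)) ∨
      x = ((q * g + f (r + 1) + diff t b (r + 1) : ℤ) : ZMod (6 * t + 5)) := by
  simp only [block, Finset.mem_insert, Finset.mem_singleton, Option.some.injEq]
  rw [show r + q * (2 * t + 1) + 1 = r + 1 + q * (2 * t + 1) by ring,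
    framePos_eq h0 hL hr.le, framePos_eq h0 hL (Nat.succ_le_of_lt hr), diffPos_eq ht hr.le,
    diffPos_eq ht (Nat.succ_le_of_lt hr)]
  simp only [Int.cast_add]

/-- Two blocks share a pair if the second ends of their pairs agree modulo `n`, in one of the two
possible orders. -/
theorem sharePair_block_of_eq (ht : 1 ≤ t) (h0 : f 0 = 0) (hL : f (2 * t + 1) = g) {r r' : ℕ}
    (hr : r < 2 * t + 1) (hr' : r' < 2 * t + 1) (q q' : ℕ) (c : ℤ)
    (hfr : f r = f (r + 1)) (hd : diff t b r ≠ diff t b (r + 1))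
    (hlt : |diff t b r - diff t b (r + 1)| < (6 * t + 5 : ℕ))
    (h : (q * g + f r + diff t b r = q' * g + f r' + diff t b r' + c * (6 * t + 5 : ℕ) ∧
        q * g + f (r + 1) + diff t b (r + 1) =
          q' * g + f (r' + 1) + diff t b (r' + 1) + c * (6 * t + 5 : ℕ)) ∨
      (q * g + f r + diff t b r =
          q' * g + f (r' + 1) + diff t b (r' + 1) + c * (6 * t + 5 : ℕ) ∧
        q * g + f (r + 1) + diff t b (r + 1) =
          q' * g + f r' + diff t b r' + c * (6 * t + 5 : ℕ))) :
    SharePair (block (framePos t g f) (diffPos t b) (r + q * (2 * t + 1)))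
      (block (framePos t g f) (diffPos t b) (r' + q' * (2 * t + 1))) := by
  refine sharePair_of_mem (x := ((q * g + f r + diff t b r : ℤ) : ZMod (6 * t + 5)))
    (y := ((q * g + f (r + 1) + diff t b (r + 1) : ℤ) : ZMod (6 * t + 5))) ?_ ?_ ?_ ?_ ?_
  · intro h
    refine intCast_ne_zero (sub_ne_zero.2 hd) hlt ?_
    rw [hfr] at h
    push_cast at h ⊢
    linear_combination h
  · exact (mem_block_iff ht h0 hL hr q).2 (by tauto)
  · exact (mem_block_iff ht h0 hL hr q).2 (by tauto)
  · rw [mem_block_iff ht h0 hL hr' q']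
    rcases h with ⟨h1, -⟩ | ⟨h1, -⟩ <;> rw [intCast_eq_of_eq_add h1] <;> tauto
  · rw [mem_block_iff ht h0 hL hr' q']
    rcases h with ⟨-, h2⟩ | ⟨-, h2⟩ <;> rw [intCast_eq_of_eq_add h2] <;> tauto

theorem diffPos_ne_zero (h : ∀ r < 2 * t + 1, diff t b r ≠ 0 ∧ |diff t b r| < (6 * t + 5 : ℕ))
    (p : ℕ) : diffPos t b p ≠ 0 := by
  have := h (p % (2 * t + 1)) (Nat.mod_lt _ (by omega))
  exact intCast_ne_zero this.1 this.2

/-- Two pairs with one end in common have other ends that differ by the change of the pair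
difference; this is the third pair of the block. -/
theorem exists_mem_block_of_short (ht : 1 ≤ t) (h0 : f 0 = 0) (hL : f (2 * t + 1) = g) {r : ℕ}
    (hr : r < 2 * t + 1)
    (hfr : f r = f (r + 1) ∨ f r + diff t b r = f (r + 1) + diff t b (r + 1)) {k : ℤ}
    (hk : diff t b (r + 1) - diff t b r = k ∨ diff t b (r + 1) - diff t b r = -k) :
    ∃ u, some u ∈ block (framePos t g f) (diffPos t b) r ∧
      some (u + (k : ZMod (6 * t + 5))) ∈ block (framePos t g f) (diffPos t b) r := by
  have hmem := fun x => mem_block_iff (b := b) (x := x) ht h0 hL hr 0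
  simp only [Nat.cast_zero, zero_mul, add_zero, zero_add] at hmem
  have key : ∀ X : ℤ, (X = f r ∨ X = f r + diff t b r ∨ X = f (r + 1) ∨
      X = f (r + 1) + diff t b (r + 1)) → (X + k = f r ∨ X + k = f r + diff t b r ∨
      X + k = f (r + 1) ∨ X + k = f (r + 1) + diff t b (r + 1)) →
      ∃ u, some u ∈ block (framePos t g f) (diffPos t b) r ∧
      some (u + (k : ZMod (6 * t + 5))) ∈ block (framePos t g f) (diffPos t b) r := by
    intro X h1 h2
    refine ⟨X, (hmem _).2 ?_, (hmem _).2 ?_⟩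
    · rcases h1 with h | h | h | h <;> rw [h] <;> tauto
    · rw [← Int.cast_add]
      rcases h2 with h | h | h | h <;> rw [h] <;> tauto
  rcases hfr with hfr | hfr <;> rcases hk with hk | hk
  · exact key (f r + diff t b r) (by tauto) (by omega)
  · exact key (f (r + 1) + diff t b (r + 1)) (by tauto) (by omega)
  · exact key (f (r + 1)) (by tauto) (by omega)
  · exact key (f r) (by tauto) (by omega)

end

end Rotational

/-! ### Sufficient conditions on frames and differences. -/

namespace Rotational

/-- The arrangements of one period that satisfy the stated conditions on frames and differences give
twofold triple systems on `6t + 6` points with a Gray code. -/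
theorem hasGrayTTS_of_frames {t : ℕ} (ht : 2 ≤ t) {b g : ℤ} {f : ℕ → ℤ} (h0 : f 0 = 0)
    (hL : f (2 * t + 1) = g) (hg : IsUnit (g : ZMod (6 * t + 5)))
    (hstart : f 0 = f 1 + diff t b 1 ∨ f 0 + diff t b 0 = f 1)
    (hsum : ((diff t b 0 + diff t b 1 : ℤ) : ZMod (6 * t + 5)) = ((3 * t + 2 : ℤ) : ZMod (6 * t + 5)))
    (hfr : ∀ r, 1 ≤ r → r < 2 * t + 1 →
      f r = f (r + 1) ∨ f r + diff t b r = f (r + 1) + diff t b (r + 1))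
    (hdiff : ∀ k : ℤ, t < k → k ≤ 3 * t + 1 → ∃ r, 1 ≤ r ∧ r ≤ 2 * t + 1 ∧
      (diff t b r = k ∨ diff t b r = -k))
    (step x₁ : ZMod (6 * t + 5))
    (hstep : step = ((3 * t + 2 : ℤ) : ZMod (6 * t + 5)) ∨
      step = -((3 * t + 2 : ℤ) : ZMod (6 * t + 5)))
    (ord : List ℕ) (hord : ord.Perm (List.range' 1 ((6 * t + 5) * (2 * t + 1))))
    (hchain : ord.IsChain (fun p p' => SharePair (block (framePos t g f) (diffPos t b) p)
      (block (framePos t g f) (diffPos t b) p')))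
    (hlast : ∀ p ∈ ord.getLast?, some x₁ ∈ block (framePos t g f) (diffPos t b) p ∧
      some (x₁ + ((3 * t + 2 : ℤ) : ZMod (6 * t + 5))) ∈ block (framePos t g f) (diffPos t b) p)
    (hhead : ∀ p ∈ ord.head?, some (x₁ - step) ∈ block (framePos t g f) (diffPos t b) p ∧
      some (x₁ - step + ((3 * t + 2 : ℤ) : ZMod (6 * t + 5))) ∈
        block (framePos t g f) (diffPos t b) p) :
    HasGrayTTS (6 * t + 6) := by
  have : NeZero (6 * t + 5) := ⟨by omega⟩
  have hmem := fun r (hr : r < 2 * t + 1) x =>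
    mem_block_iff (b := b) (x := x) (by omega) h0 hL hr 0
  simp only [Nat.cast_zero, zero_mul, add_zero, zero_add] at hmem
  have hnn : ((6 * t + 5 : ℤ) : ZMod (6 * t + 5)) = 0 := by
    have := ZMod.natCast_self (6 * t + 5)
    push_cast at this ⊢
    exact this
  have hFr : ∀ r, r ≤ 2 * t + 1 → framePos t g f r = (f r : ZMod (6 * t + 5)) := by
    intro r hr
    have := framePos_eq h0 hL hr 0
    simpa using this
  have hDr : ∀ r, r ≤ 2 * t + 1 → diffPos t b r = (diff t b r : ZMod (6 * t + 5)) := by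
    intro r hr
    have := diffPos_eq (b := b) (show 1 ≤ t by omega) hr 0
    simpa using this
  refine hasGrayTTS (n := 6 * t + 5) (L := 2 * t + 1) (by omega) (by omega) (framePos t g f)
    (diffPos t b) g ((3 * t + 2 : ℤ) : ZMod (6 * t + 5)) step x₁ hg ?_ hstep framePos_add
    diffPos_add ?_ ?_ ord hord hchain hlast hhead
  -- The unit condition on d = 3t+2 holds because 2d = n - 1.
  · refine IsUnit.of_mul_eq_one (-2) ?_
    push_cast at hnn ⊢
    linear_combination -hnn
  · intro r hr
    rw [hFr r hr.le, hFr (r + 1) hr, hDr r hr.le, hDr (r + 1) hr]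
    rcases Nat.eq_zero_or_pos r with rfl | hr0
    · rcases hstart with h | h
      · right; right; left; exact_mod_cast congrArg (Int.cast : ℤ → ZMod (6 * t + 5)) h
      · right; right; right; exact_mod_cast congrArg (Int.cast : ℤ → ZMod (6 * t + 5)) h
    · rcases hfr r hr0 hr with h | h
      · left; exact_mod_cast congrArg (Int.cast : ℤ → ZMod (6 * t + 5)) h
      · right; left; exact_mod_cast congrArg (Int.cast : ℤ → ZMod (6 * t + 5)) h
  · intro e he
    have hrep : ∃ k : ℤ, 1 ≤ k ∧ k ≤ 3 * t + 2 ∧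
        ((k : ZMod (6 * t + 5)) = e ∨ (k : ZMod (6 * t + 5)) = -e) := by
      have hval : (((e.val : ℕ) : ℤ) : ZMod (6 * t + 5)) = e := by simp
      have hlt := ZMod.val_lt e
      have hpos : e.val ≠ 0 := by rwa [Ne, ZMod.val_eq_zero]
      by_cases hle : e.val ≤ 3 * t + 2
      · exact ⟨e.val, by omega, by omega, Or.inl hval⟩
      · refine ⟨6 * t + 5 - e.val, by omega, by omega, Or.inr ?_⟩
        rw [Int.cast_sub, hval, hnn, zero_sub]
    obtain ⟨k, hk1, hk2, hke⟩ := hrep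
    refine ⟨k, hke, ?_⟩
    by_cases hkd : k = 3 * t + 2
    · right
      -- In block 0 the common point is the first end of one pair and the second end of the other,
      -- so its third difference is the sum of the two pair differences, which is d. Its other
      -- occurrence is in the ∞-ring.
      refine ⟨by rw [hkd], 0, by omega, ?_⟩
      rcases hstart with h | h
      · refine ⟨(f 1 : ZMod (6 * t + 5)), (hmem 0 (by omega) _).2 (by tauto),
          (hmem 0 (by omega) _).2 ?_⟩
        right; left
        rw [← hsum, h]
        push_cast; ring
      · refine ⟨(f 0 : ZMod (6 * t + 5)), (hmem 0 (by omega) _).2 (by tauto),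
          (hmem 0 (by omega) _).2 ?_⟩
        right; right; right
        rw [← hsum, zero_add, ← h]
        push_cast; ring
    left
    by_cases hkt : k ≤ t
    · obtain ⟨j, rfl⟩ : ∃ j : ℕ, k = j := ⟨k.toNat, by omega⟩
      have hj1 : 1 ≤ j := by omega
      have hjt : j ≤ t := by omega
      obtain ⟨i, rfl⟩ : ∃ i, j = i + 1 := ⟨j - 1, by omega⟩
      have hz := zigzag_succ_sub i
      obtain ⟨u, hu1, hu2⟩ := exists_mem_block_of_short (b := b) (f := f) (g := g) (r := t - i)
        (k := ((i + 1 : ℕ) : ℤ))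
        (by omega) h0 hL (by omega) (hfr _ (by omega) (by omega)) (by
          rw [diff_long (r := t - i) (k := i + 1) b (by omega) (by omega),
            diff_long (r := t - i + 1) (k := i) b (by omega) (by omega)]
          push_cast
          omega)
      -- The second occurrence of a short difference i+1 is in the block at index t+2+i, except that
      -- t itself occurs at the drop, index t+1.
      by_cases hit : i + 1 = t
      · obtain ⟨u', hu1', hu2'⟩ := exists_mem_block_of_short (b := b) (f := f) (g := g) (r := t + 1)
          (k := ((i + 1 : ℕ) : ℤ))
          (by omega) h0 hL (by omega) (hfr _ (by omega) (by omega)) (by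
            rw [diff_long (r := t + 1) (k := 0) b (by omega) (by omega),
              diff_short (r := t + 1 + 1) (k := 0) b (by omega)]
            rw [zigzag_zero]
            push_cast
            omega)
        exact ⟨t - i, by omega, t + 1, by omega, by omega, u, u', hu1, hu2, hu1', hu2'⟩
      · obtain ⟨u', hu1', hu2'⟩ := exists_mem_block_of_short (b := b) (f := f) (g := g)
          (r := t + 2 + i) (k := ((i + 1 : ℕ) : ℤ))
          (by omega) h0 hL (by omega) (hfr _ (by omega) (by omega)) (by
            rw [diff_short (r := t + 2 + i) (k := i) b (by omega),
              diff_short (r := t + 2 + i + 1) (k := i + 1) b (by omega)]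
            push_cast
            omega)
        exact ⟨t - i, by omega, t + 2 + i, by omega, by omega, u, u', hu1, hu2, hu1', hu2'⟩
    · obtain ⟨r, hr1, hr2, hr⟩ := hdiff k (by omega) (by omega)
      have hor : ∀ (A : Finset (Option (ZMod (6 * t + 5)))) (x y : ℤ), y - x = diff t b r →
          some (x : ZMod (6 * t + 5)) ∈ A → some (y : ZMod (6 * t + 5)) ∈ A →
          ∃ u, some u ∈ A ∧ some (u + (k : ZMod (6 * t + 5))) ∈ A := by
        intro A x y hxy hx hy
        rcases hr with h | h
        · refine ⟨x, hx, ?_⟩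
          rwa [← Int.cast_add, show x + k = y by omega]
        · refine ⟨y, hy, ?_⟩
          rwa [← Int.cast_add, show y + k = x by omega]
      -- A pair of the sequence lies in the two blocks that it joins, at indices r-1 and r.
      have hprev := hmem (r - 1) (by omega)
      rw [Nat.sub_add_cancel hr1] at hprev
      obtain ⟨u, h1, h2⟩ := hor _ (f r) (f r + diff t b r) (by omega)
        ((hprev _).2 (Or.inr (Or.inr (Or.inl rfl)))) ((hprev _).2 (Or.inr (Or.inr (Or.inr rfl))))
      rcases hr2.lt_or_eq with hlt | hrL
      · obtain ⟨u', h3, h4⟩ := hor _ (f r) (f r + diff t b r) (by omega)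
          ((hmem r hlt _).2 (Or.inl rfl)) ((hmem r hlt _).2 (Or.inr (Or.inl rfl)))
        exact ⟨r - 1, by omega, r, hlt, by omega, u, u', h1, h2, h3, h4⟩
      -- At the end of the period the second block is a translate of block 0.
      · have hd0 : diff t b r = diff t b 0 := by
          rw [hrL, diff_short (k := t - 1) b (by omega), diff_zero]
        obtain ⟨u', h3, h4⟩ := hor _ (f 0) (f 0 + diff t b 0) (by omega)
          ((hmem 0 (by omega) _).2 (Or.inl rfl)) ((hmem 0 (by omega) _).2 (Or.inr (Or.inl rfl)))
        exact ⟨r - 1, by omega, 0, by omega, by omega, u, u', h1, h2, h3, h4⟩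

end Rotational

/-! ### Cutting and reconnecting a path. -/

/-- The interval `a, a + 1, …, b` as a list. -/
def List.arc (a b : ℕ) : List ℕ := List.range' a (b + 1 - a)

section arcs

variable {R : ℕ → ℕ → Prop}

theorem List.isChain_arc (h : ∀ p, R p (p + 1)) (a b : ℕ) : (List.arc a b).IsChain R :=
  (List.isChain_range' a (b + 1 - a) 1).imp (by rintro p _ rfl; exact h p)

theorem List.isChain_arc_reverse (h : ∀ p, R (p + 1) p) (a b : ℕ) :
    (List.arc a b).reverse.IsChain R :=
  List.isChain_reverse.2 (List.isChain_arc (R := fun p q => R q p) h a b)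

theorem List.head?_arc {a b : ℕ} (h : a ≤ b) : (List.arc a b).head? = some a := by
  rw [List.arc, show b + 1 - a = (b - a) + 1 by omega, List.range'_succ, List.head?_cons]

theorem List.getLast?_arc {a b : ℕ} (h : a ≤ b) : (List.arc a b).getLast? = some b := by
  rw [List.arc, show b + 1 - a = (b - a) + 1 by omega, List.range'_concat, List.getLast?_concat]
  congr 1
  omega

theorem List.arc_append {a b c : ℕ} (hab : a ≤ b) (hbc : b ≤ c) :
    List.arc a b ++ List.arc (b + 1) c = List.arc a c := by
  rw [List.arc, List.arc, List.arc, show c + 1 - a = (b + 1 - a) + (c + 1 - (b + 1)) by omega,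
    ← List.range'_append]
  congr 2
  omega

theorem List.count_arc_split {c₁ c₂ c₃ c₄ N : ℕ} (h₁ : 1 ≤ c₁) (h₂ : c₁ < c₂) (h₃ : c₂ < c₃)
    (h₄ : c₃ < c₄) (h₅ : c₄ < N) (x : ℕ) :
    (List.range' 1 N).count x = (List.arc 1 c₁).count x + (List.arc (c₁ + 1) c₂).count x +
      (List.arc (c₂ + 1) c₃).count x + (List.arc (c₃ + 1) c₄).count x +
      (List.arc (c₄ + 1) N).count x := by
  have : List.range' 1 N = List.arc 1 N := by rw [List.arc, Nat.add_sub_cancel]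
  rw [this, ← List.arc_append (b := c₄) (by omega) h₅.le, ← List.arc_append (b := c₃) (by omega) h₄.le,
    ← List.arc_append (b := c₂) (by omega) h₃.le, ← List.arc_append (b := c₁) (by omega) h₂.le]
  simp only [List.count_append]

/-- Rearrangement of a path `1, …, N` by four cuts, with two arcs reversed. -/
theorem exists_rearrangement_two (hs : ∀ p, R p (p + 1)) (hs' : ∀ p, R (p + 1) p)
    {c₁ c₂ c₃ c₄ N : ℕ} (h₁ : 1 ≤ c₁) (h₂ : c₁ < c₂) (h₃ : c₂ < c₃) (h₄ : c₃ < c₄) (h₅ : c₄ < N)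
    (j₁ : R (c₄ + 1) 1) (j₂ : R c₁ (c₃ + 1)) (j₃ : R c₄ (c₂ + 1)) (j₄ : R c₃ c₂) :
    ∃ ord : List ℕ, ord.Perm (List.range' 1 N) ∧ ord.IsChain R ∧ ord.head? = some N ∧
      ord.getLast? = some (c₁ + 1) := by
  refine ⟨(List.arc (c₄ + 1) N).reverse ++ (List.arc 1 c₁ ++ (List.arc (c₃ + 1) c₄ ++
    (List.arc (c₂ + 1) c₃ ++ (List.arc (c₁ + 1) c₂).reverse))), ?_, ?_, ?_, ?_⟩
  · rw [List.perm_iff_count]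
    intro x
    rw [List.count_arc_split h₁ h₂ h₃ h₄ h₅]
    simp only [List.count_append, List.count_reverse]
    ring
  · refine List.IsChain.append (List.isChain_arc_reverse hs' _ _) (List.IsChain.append
      (List.isChain_arc hs _ _) (List.IsChain.append (List.isChain_arc hs _ _) (List.IsChain.append
      (List.isChain_arc hs _ _) (List.isChain_arc_reverse hs' _ _) ?_) ?_) ?_) ?_
    all_goals
      simp only [List.getLast?_reverse, List.head?_reverse, List.head?_append,
        List.head?_arc h₁,
        List.head?_arc (Nat.succ_le_of_lt h₃), List.head?_arc (Nat.succ_le_of_lt h₄),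
        List.head?_arc (Nat.succ_le_of_lt h₅),
        List.getLast?_arc h₁, List.getLast?_arc (Nat.succ_le_of_lt h₂),
        List.getLast?_arc (Nat.succ_le_of_lt h₃), List.getLast?_arc (Nat.succ_le_of_lt h₄),
        Option.some_or, Option.mem_def, Option.some.injEq]
      rintro _ rfl _ rfl
      assumption
  · rw [List.head?_append, List.head?_reverse, List.getLast?_arc (Nat.succ_le_of_lt h₅),
      Option.some_or]
  · simp only [List.getLast?_append, List.getLast?_reverse, List.head?_arc (Nat.succ_le_of_lt h₂),
      Option.some_or]

/-- Rearrangement of a path `1, …, N` by four cuts, with three arcs reversed. -/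
theorem exists_rearrangement_three (hs : ∀ p, R p (p + 1)) (hs' : ∀ p, R (p + 1) p)
    {c₁ c₂ c₃ c₄ N : ℕ} (h₁ : 1 ≤ c₁) (h₂ : c₁ < c₂) (h₃ : c₂ < c₃) (h₄ : c₃ < c₄) (h₅ : c₄ < N)
    (j₁ : R (c₄ + 1) c₁) (j₂ : R 1 (c₁ + 1)) (j₃ : R c₂ (c₃ + 1)) (j₄ : R c₄ c₃) :
    ∃ ord : List ℕ, ord.Perm (List.range' 1 N) ∧ ord.IsChain R ∧ ord.head? = some N ∧
      ord.getLast? = some (c₂ + 1) := by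
  refine ⟨(List.arc (c₄ + 1) N).reverse ++ ((List.arc 1 c₁).reverse ++ (List.arc (c₁ + 1) c₂ ++
    (List.arc (c₃ + 1) c₄ ++ (List.arc (c₂ + 1) c₃).reverse))), ?_, ?_, ?_, ?_⟩
  · rw [List.perm_iff_count]
    intro x
    rw [List.count_arc_split h₁ h₂ h₃ h₄ h₅]
    simp only [List.count_append, List.count_reverse]
    ring
  · refine List.IsChain.append (List.isChain_arc_reverse hs' _ _) (List.IsChain.append
      (List.isChain_arc_reverse hs' _ _) (List.IsChain.append (List.isChain_arc hs _ _)
      (List.IsChain.append (List.isChain_arc hs _ _)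
      (List.isChain_arc_reverse hs' _ _) ?_) ?_) ?_) ?_
    all_goals
      simp only [List.getLast?_reverse, List.head?_reverse, List.head?_append,
        List.head?_arc h₁, List.head?_arc (Nat.succ_le_of_lt h₂),
        List.head?_arc (Nat.succ_le_of_lt h₄),
        List.head?_arc (Nat.succ_le_of_lt h₅),
        List.getLast?_arc h₁, List.getLast?_arc (Nat.succ_le_of_lt h₂),
        List.getLast?_arc (Nat.succ_le_of_lt h₃), List.getLast?_arc (Nat.succ_le_of_lt h₄),
        Option.some_or, Option.mem_def, Option.some.injEq]
      rintro _ rfl _ rfl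
      assumption
  · rw [List.head?_append, List.head?_reverse, List.getLast?_arc (Nat.succ_le_of_lt h₅),
      Option.some_or]
  · simp only [List.getLast?_append, List.getLast?_reverse, List.head?_arc (Nat.succ_le_of_lt h₃),
      Option.some_or]

end arcs

theorem zigzag_two_mul (j : ℕ) : zigzag (2 * j) = -j := by
  have := two_mul_zigzag_of_even (k := 2 * j) (by omega); omega

theorem zigzag_two_mul_add_one (j : ℕ) : zigzag (2 * j + 1) = j + 1 := by
  have := two_mul_zigzag_of_odd (k := 2 * j + 1) (by omega); omega

/-! ### The case of even t. -/

namespace Rotational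

/-- Two blocks share a pair if the differences of their frames and of their pairs match. -/
theorem sharePair_block_of_values {t : ℕ} {b g : ℤ} {f : ℕ → ℤ} (ht : 1 ≤ t) (h0 : f 0 = 0)
    (hL : f (2 * t + 1) = g) {p p' : ℕ} (r r' q q' : ℕ) (c : ℤ) {φ φ' δ ε δ' ε' : ℤ}
    (hp : p = r + q * (2 * t + 1)) (hp' : p' = r' + q' * (2 * t + 1))
    (hr : r < 2 * t + 1) (hr' : r' < 2 * t + 1)
    (hf : f r = φ) (hf₁ : f (r + 1) = φ) (hf' : f r' = φ') (hf₁' : f (r' + 1) = φ')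
    (hd : diff t b r = δ) (hd₁ : diff t b (r + 1) = ε)
    (hd' : diff t b r' = δ') (hd₁' : diff t b (r' + 1) = ε')
    (hne : δ ≠ ε) (hlt : |δ - ε| < (6 * t + 5 : ℕ))
    (h : (q * g + φ + δ = q' * g + φ' + δ' + c * (6 * t + 5 : ℕ) ∧ δ - ε = δ' - ε') ∨
      (q * g + φ + δ = q' * g + φ' + ε' + c * (6 * t + 5 : ℕ) ∧ δ - ε = ε' - δ')) :
    SharePair (block (framePos t g f) (diffPos t b) p)
      (block (framePos t g f) (diffPos t b) p') := by
  subst hp hp'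
  refine sharePair_block_of_eq ht h0 hL hr hr' q q' c (hf.trans hf₁.symm) (by rwa [hd, hd₁])
    (by rwa [hd, hd₁]) ?_
  rw [hf, hf₁, hf', hf₁', hd, hd₁, hd', hd₁']
  rcases h with ⟨h, h'⟩ | ⟨h, h'⟩
  · exact Or.inl ⟨h, by linear_combination h - h'⟩
  · exact Or.inr ⟨h, by linear_combination h - h'⟩

/-- The frames for an even number of short differences. -/
def frameEven (s r : ℕ) : ℤ :=
  if r = 0 then 0 else if r ≤ 2 * s - 1 then 2 * s + 1 else if r ≤ 2 * s + 3 then 2 * s - 1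
  else if r ≤ 4 * s - 1 then 2 * s - 3 else -1

theorem frameEven_one {s r : ℕ} (h : 1 ≤ r) (h' : r ≤ 2 * s - 1) : frameEven s r = 2 * s + 1 := by
  rw [frameEven, if_neg (by omega), if_pos h']

theorem frameEven_two {s r : ℕ} (h1 : 1 ≤ r) (h : 2 * s ≤ r) (h' : r ≤ 2 * s + 3) :
    frameEven s r = 2 * s - 1 := by
  rw [frameEven, if_neg (by omega), if_neg (by omega), if_pos h']

theorem frameEven_three {s r : ℕ} (h : 2 * s + 4 ≤ r) (h' : r ≤ 4 * s - 1) :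
    frameEven s r = 2 * s - 3 := by
  rw [frameEven, if_neg (by omega), if_neg (by omega), if_neg (by omega), if_pos h']

theorem frameEven_four {s r : ℕ} (hs : 2 ≤ s) (h : 4 * s ≤ r) (h2 : 2 * s + 4 ≤ r) :
    frameEven s r = -1 := by
  rw [frameEven, if_neg (by omega), if_neg (by omega), if_neg (by omega), if_neg (by omega)]

/-- With b = 5s+1 the pair differences fill 2s+1, …, 6s+1 once each. The frame changes inside a
period only at r = 2s-1, 2s+3 and 4s-1, where second ends are shared; together with the value 2s+1
after block 0 these jumps make the total g = -1. The four junctions use third pairs of sizes 2s,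
2s-1, 1 and 2s. -/
theorem hasGrayTTS_even {s : ℕ} (hs : 3 ≤ s) : HasGrayTTS (6 * (2 * s) + 6) := by
  obtain ⟨w, hw⟩ : ∃ w, s = w + 1 := ⟨s - 1, by omega⟩
  obtain ⟨b, hb⟩ : ∃ b : ℤ, b = 5 * s + 1 := ⟨_, rfl⟩
  have long : ∀ r k, r + k = 2 * s + 1 → 1 ≤ r → diff (2 * s) b r = 5 * s + 1 + zigzag k :=
    fun r k h hr => by rw [diff_long b h hr, hb]
  have short : ∀ r k, r = 2 * s + 2 + k → diff (2 * s) b r = 3 * s + 1 - zigzag k :=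
    fun r k h => by rw [diff_short b h, hb]; push_cast; ring
  have d0 : diff (2 * s) b 0 = 2 * s + 1 := by
    have := zigzag_two_mul_add_one w
    rw [diff_zero, hb, show 2 * s - 1 = 2 * w + 1 by omega, this]; push_cast; omega
  have d1 : diff (2 * s) b 1 = 4 * s + 1 := by
    rw [long 1 (2 * s) (by omega) le_rfl, zigzag_two_mul]; ring
  have d2 : diff (2 * s) b 2 = 6 * s + 1 := by
    rw [long 2 (2 * w + 1) (by omega) (by omega), zigzag_two_mul_add_one]; omega
  have d3 : diff (2 * s) b 3 = 4 * s + 2 := by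
    rw [long 3 (2 * w) (by omega) (by omega), zigzag_two_mul]; omega
  have e0 : diff (2 * s) b (2 * s - 1) = 5 * s := by
    rw [long (2 * s - 1) 2 (by omega) (by omega), zigzag_two_mul 1]; omega
  have e1 : diff (2 * s) b (2 * s) = 5 * s + 2 := by
    rw [long (2 * s) 1 (by omega) (by omega), zigzag_two_mul_add_one 0]; omega
  have e2 : diff (2 * s) b (2 * s + 1) = 5 * s + 1 := by
    rw [long (2 * s + 1) 0 (by omega) (by omega), zigzag_zero]; omega
  have e3 : diff (2 * s) b (2 * s + 2) = 3 * s + 1 := by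
    rw [short (2 * s + 2) 0 (by omega), zigzag_zero]; omega
  have e4 : diff (2 * s) b (2 * s + 3) = 3 * s := by
    rw [short (2 * s + 3) 1 (by omega), zigzag_two_mul_add_one 0]; omega
  have e5 : diff (2 * s) b (2 * s + 4) = 3 * s + 2 := by
    rw [short (2 * s + 4) 2 (by omega), zigzag_two_mul 1]; omega
  have f1 : diff (2 * s) b (4 * s - 1) = 2 * s + 2 := by
    obtain ⟨w', rfl⟩ : ∃ w', w = w' + 1 := ⟨w - 1, by omega⟩
    rw [short (4 * s - 1) (2 * w' + 1) (by omega), zigzag_two_mul_add_one]; omega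
  have f2 : diff (2 * s) b (4 * s) = 4 * s := by
    rw [short (4 * s) (2 * w) (by omega), zigzag_two_mul]; omega
  have f3 : diff (2 * s) b (4 * s + 1) = 2 * s + 1 := by
    rw [short (4 * s + 1) (2 * w + 1) (by omega), zigzag_two_mul_add_one]; omega
  have h0 : frameEven s 0 = 0 := rfl
  have hL : frameEven s (2 * (2 * s) + 1) = -1 := frameEven_four (by omega) (by omega) (by omega)
  have hbound : ∀ r < 2 * (2 * s) + 1, diff (2 * s) b r ≠ 0 ∧
      |diff (2 * s) b r| < (6 * (2 * s) + 5 : ℕ) := by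
    intro r hr
    have : 2 * s + 1 ≤ diff (2 * s) b r ∧ diff (2 * s) b r ≤ 6 * s + 1 := by
      rcases Nat.eq_zero_or_pos r with rfl | h1
      · omega
      rcases Nat.lt_or_ge (2 * s + 1) r with h2 | h2
      · obtain ⟨k, rfl⟩ : ∃ k, r = 2 * s + 2 + k := ⟨r - (2 * s + 2), by omega⟩
        rw [short _ k rfl]
        have := abs_zigzag_le k
        omega
      · obtain ⟨k, hk⟩ : ∃ k, r + k = 2 * s + 1 := ⟨2 * s + 1 - r, by omega⟩
        rw [long _ k hk h1]
        have := abs_zigzag_le k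
        omega
    refine ⟨by omega, ?_⟩
    rw [abs_lt]; push_cast; omega
  obtain ⟨R, hR⟩ : ∃ R : ℕ → ℕ → Prop, R = fun p p' =>
      SharePair (block (framePos (2 * s) (-1) (frameEven s)) (diffPos (2 * s) b) p)
        (block (framePos (2 * s) (-1) (frameEven s)) (diffPos (2 * s) b) p') := ⟨_, rfl⟩
  have hsucc : ∀ p, R p (p + 1) := fun p => by
    rw [hR]; exact sharePair_block_succ (diffPos_ne_zero hbound) p
  have hsucc' : ∀ p, R (p + 1) p := fun p => by
    have := hsucc p
    rw [hR] at this ⊢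
    exact this.symm
  have ht : 1 ≤ 2 * s := by omega
  obtain ⟨M, hM⟩ : ∃ M, M = 2 * (2 * s) + 1 := ⟨_, rfl⟩
  -- Each junction matches the second ends of two blocks with constant frame and equal short
  -- difference. The period numbers are chosen so that the translations by -1 per period align them.
  have j₁ : R (2 * s + (11 * s + 3) * M + 1) 1 := by
    rw [hR, hM]
    exact sharePair_block_of_values ht h0 hL (2 * s + 1) (1) (11 * s + 3) (0) (-1) (by ring) (by ring)
      (by omega) (by omega) (frameEven_two (by omega) (by omega) (by omega))
      (frameEven_two (by omega) (by omega) (by omega)) (frameEven_one (by omega) (by omega))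
      (frameEven_one (by omega) (by omega)) e2 e3 d1 d2 (by omega)
      (by rw [abs_lt]; push_cast; omega) (Or.inr (by push_cast; constructor <;> ring))
  have j₂ : R (4 * s + (6 * s + 1) * M) (1 + (10 * s + 4) * M + 1) := by
    rw [hR, hM]
    exact sharePair_block_of_values ht h0 hL (4 * s) (2) (6 * s + 1) (10 * s + 4) (0) (by ring) (by ring)
      (by omega) (by omega) (frameEven_four (by omega) (by omega) (by omega))
      (frameEven_four (by omega) (by omega) (by omega)) (frameEven_one (by omega) (by omega))
      (frameEven_one (by omega) (by omega)) f2 f3 d2 d3 (by omega)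
      (by rw [abs_lt]; push_cast; omega) (Or.inl (by push_cast; constructor <;> ring))
  have j₃ : R (2 * s + (11 * s + 3) * M) (2 * s + 1 + (9 * s + 2) * M + 1) := by
    rw [hR, hM]
    exact sharePair_block_of_values ht h0 hL (2 * s) (2 * s + 2) (11 * s + 3) (9 * s + 2) (0) (by ring) (by ring)
      (by omega) (by omega) (frameEven_two (by omega) (by omega) (by omega))
      (frameEven_two (by omega) (by omega) (by omega)) (frameEven_two (by omega) (by omega) (by omega))
      (frameEven_two (by omega) (by omega) (by omega)) e1 e2 e3 e4 (by omega)
      (by rw [abs_lt]; push_cast; omega) (Or.inl (by push_cast; constructor <;> ring))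
  have j₄ : R (1 + (10 * s + 4) * M) (2 * s + 1 + (9 * s + 2) * M) := by
    rw [hR, hM]
    exact sharePair_block_of_values ht h0 hL (1) (2 * s + 1) (10 * s + 4) (9 * s + 2) (0) (by ring) (by ring)
      (by omega) (by omega) (frameEven_one (by omega) (by omega))
      (frameEven_one (by omega) (by omega)) (frameEven_two (by omega) (by omega) (by omega))
      (frameEven_two (by omega) (by omega) (by omega)) d1 d2 e2 e3 (by omega)
      (by rw [abs_lt]; push_cast; omega) (Or.inr (by push_cast; constructor <;> ring))
  -- The order of the cuts is decided by their period numbers, which differ; the offsets stay below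
  -- M.
  have mul_le : ∀ a c, a ≤ c → a * M ≤ c * M := fun a c h => Nat.mul_le_mul_right M h
  have m₁ := mul_le (6 * s + 2) (9 * s + 2) (by omega)
  have m₂ := mul_le (9 * s + 3) (10 * s + 4) (by omega)
  have m₃ := mul_le (10 * s + 5) (11 * s + 3) (by omega)
  have m₄ := mul_le (11 * s + 4) (6 * (2 * s) + 5) (by omega)
  rw [show 6 * s + 2 = 6 * s + 1 + 1 by ring, add_mul (6 * s + 1), one_mul] at m₁
  rw [show 9 * s + 3 = 9 * s + 2 + 1 by ring, add_mul (9 * s + 2), one_mul] at m₂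
  rw [show 10 * s + 5 = 10 * s + 4 + 1 by ring, add_mul (10 * s + 4), one_mul] at m₃
  rw [show 11 * s + 4 = 11 * s + 3 + 1 by ring, add_mul (11 * s + 3), one_mul] at m₄
  obtain ⟨ord, hperm, hchain, hhead, hlast⟩ := exists_rearrangement_two
    (N := (6 * (2 * s) + 5) * M) hsucc hsucc' (by omega) (by omega) (by omega) (by omega) (by omega)
    j₁ j₂ j₃ j₄
  have hframe1 : frameEven s 1 = 2 * s + 1 := frameEven_one (by omega) (by omega)
  rw [hR] at hchain
  rw [hM] at hperm hhead hlast
  refine hasGrayTTS_of_frames (by omega) h0 hL (by simp) (Or.inr ?_) ?_ ?_ ?_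
    (-((3 * (2 * s : ℕ) + 2 : ℤ) : ZMod (6 * (2 * s) + 5)))
    (((-(6 * s + 2) : ℤ)) : ZMod (6 * (2 * s) + 5)) (Or.inr rfl) ord hperm hchain ?_ ?_
  · rw [h0, d0, hframe1]; ring
  · rw [d0, d1]; push_cast; ring
  · intro r h1 h2
    rcases Nat.lt_or_ge r (2 * s - 1) with h | h
    · left; rw [frameEven_one h1 (by omega), frameEven_one (by omega) (by omega)]
    rcases Nat.eq_or_lt_of_le h with rfl | h
    · right
      rw [frameEven_one h1 (by omega), frameEven_two (by omega) (by omega) (by omega), e0,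
        show 2 * s - 1 + 1 = 2 * s by omega, e1]
      ring
    rcases Nat.lt_or_ge r (2 * s + 3) with h' | h'
    · left; rw [frameEven_two (by omega) (by omega) (by omega),
        frameEven_two (by omega) (by omega) (by omega)]
    rcases Nat.eq_or_lt_of_le h' with rfl | h'
    · right
      rw [frameEven_two (by omega) (by omega) (by omega), e4, e5,
        frameEven_three (by omega) (by omega)]
      ring
    rcases Nat.lt_or_ge r (4 * s - 1) with h'' | h''
    · left; rw [frameEven_three (by omega) (by omega), frameEven_three (by omega) (by omega)]
    rcases Nat.eq_or_lt_of_le h'' with rfl | h''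
    · right
      rw [frameEven_three (by omega) (by omega), frameEven_four (by omega) (by omega) (by omega),
        show 4 * s - 1 + 1 = 4 * s by omega, f1, f2]
      ring
    · left
      rw [frameEven_four (by omega) (by omega) (by omega),
        frameEven_four (by omega) (by omega) (by omega)]
  · intro k hk1 hk2
    push_cast at hk1 hk2
    rcases lt_or_ge k (4 * s + 1) with h | h
    · obtain ⟨j, hj, hj1, hj2⟩ := exists_zigzag_eq_int (3 * s + 1 - k)
      refine ⟨2 * s + 2 + j, by omega, ?_, Or.inl ?_⟩
      · rcases lt_or_ge 0 (3 * s + 1 - k) with h' | h'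
        · have := hj1 h'; omega
        · have := hj2 h'; omega
      · rw [short _ j rfl, hj]; ring
    · obtain ⟨j, hj, hj1, hj2⟩ := exists_zigzag_eq_int (k - (5 * s + 1))
      have hj3 : j ≤ 2 * s := by
        rcases lt_or_ge 0 (k - (5 * s + 1)) with h' | h'
        · have := hj1 h'; omega
        · have := hj2 h'; omega
      refine ⟨2 * s + 1 - j, by omega, by omega, Or.inl ?_⟩
      rw [long _ j (by omega) (by omega), hj]; ring
  · intro p hp
    rw [hlast] at hp
    obtain rfl := Option.some.inj hp
    -- The path ends at the translate of block 0 by period 6s+2, that is by -d. Its other end is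
    -- period n, an untranslated block 0, so the two pairs of difference d are based at -d and 0, as
    -- consecutive ∞-blocks require.
    rw [show 4 * s + (6 * s + 1) * (2 * (2 * s) + 1) + 1 = 0 + (6 * s + 2) * (2 * (2 * s) + 1) by ring,
      mem_block_iff ht h0 hL (by omega), mem_block_iff ht h0 hL (by omega)]
    refine ⟨Or.inl ?_, Or.inr (Or.inr (Or.inr ?_))⟩
    · rw [h0]; push_cast; ring
    · rw [zero_add, hframe1, d1]; push_cast; ring
  · intro p hp
    rw [hhead] at hp
    obtain rfl := Option.some.inj hp
    have hnn : (6 * (2 * (s : ZMod (6 * (2 * s) + 5))) + 5) = 0 := by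
      have := ZMod.natCast_self (6 * (2 * s) + 5)
      push_cast at this
      exact this
    rw [show (6 * (2 * s) + 5) * (2 * (2 * s) + 1) = 0 + (6 * (2 * s) + 5) * (2 * (2 * s) + 1) by ring,
      mem_block_iff ht h0 hL (by omega), mem_block_iff ht h0 hL (by omega)]
    refine ⟨Or.inl ?_, Or.inr (Or.inr (Or.inr ?_))⟩
    · rw [h0]; push_cast; linear_combination hnn
    · rw [zero_add, hframe1, d1]; push_cast; linear_combination hnn

end Rotational

/-! ### The case of odd t. -/

namespace Rotational

/-- The frames for an odd number of short differences. -/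
def frameOdd (s r : ℕ) : ℤ :=
  if r = 0 then 0 else if r ≤ 2 * s - 1 then 2 * s + 2 else if r ≤ 4 * s + 1 then 2 * s + 5
  else 4 * s + 4

theorem frameOdd_one {s r : ℕ} (h : 1 ≤ r) (h' : r ≤ 2 * s - 1) : frameOdd s r = 2 * s + 2 := by
  rw [frameOdd, if_neg (by omega), if_pos h']

theorem frameOdd_two {s r : ℕ} (h1 : 1 ≤ r) (h : 2 * s ≤ r) (h' : r ≤ 4 * s + 1) :
    frameOdd s r = 2 * s + 5 := by
  rw [frameOdd, if_neg (by omega), if_neg (by omega), if_pos h']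

theorem frameOdd_three {s r : ℕ} (h : 4 * s + 2 ≤ r) : frameOdd s r = 4 * s + 4 := by
  rw [frameOdd, if_neg (by omega), if_neg (by omega), if_neg (by omega)]

/-- With b = -(3s+3) the negatives of the pair differences fill 2s+2, …, 6s+4. The frame starts at
2s+2 after block 0 and jumps by 3 at r = 2s-1 and by 2s-1 at r = 4s+1, so g = 4s+4. The junctions
use third pairs of sizes 1, 2s+1, 2s and 2s+1. -/
theorem hasGrayTTS_odd {s : ℕ} (hs : 2 ≤ s) : HasGrayTTS (6 * (2 * s + 1) + 6) := by
  obtain ⟨w, hw⟩ : ∃ w, s = w + 2 := ⟨s - 2, by omega⟩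
  have hw' : (s : ℤ) = w + 2 := by exact_mod_cast hw
  obtain ⟨b, hb⟩ : ∃ b : ℤ, b = -(3 * s + 3) := ⟨_, rfl⟩
  have long : ∀ r k, r + k = 2 * s + 2 → 1 ≤ r →
      diff (2 * s + 1) b r = -(3 * s + 3) + zigzag k :=
    fun r k h hr => by rw [diff_long b h hr, hb]
  have short : ∀ r k, r = 2 * s + 3 + k → diff (2 * s + 1) b r = -(5 * s + 4) - zigzag k :=
    fun r k h => by rw [diff_short (k := k) b (by omega), hb]; push_cast; ring
  have d0 : diff (2 * s + 1) b 0 = -4 * s - 4 := by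
    rw [diff_zero, hb, Nat.add_sub_cancel, zigzag_two_mul]; push_cast; ring
  have d1 : diff (2 * s + 1) b 1 = -2 * s - 2 := by
    rw [long 1 (2 * s + 1) (by omega) le_rfl, zigzag_two_mul_add_one]; ring
  have d2 : diff (2 * s + 1) b 2 = -4 * s - 3 := by
    rw [long 2 (2 * s) (by omega) (by omega), zigzag_two_mul]; ring
  have d3 : diff (2 * s + 1) b 3 = -2 * s - 3 := by
    rw [long 3 (2 * (w + 1) + 1) (by omega) (by omega), zigzag_two_mul_add_one]; omega
  have e0 : diff (2 * s + 1) b (2 * s - 1) = -3 * s - 1 := by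
    rw [long (2 * s - 1) 3 (by omega) (by omega), zigzag_two_mul_add_one 1]; omega
  have e1 : diff (2 * s + 1) b (2 * s) = -3 * s - 4 := by
    rw [long (2 * s) 2 (by omega) (by omega), zigzag_two_mul 1]; omega
  have e2 : diff (2 * s + 1) b (2 * s + 1) = -3 * s - 2 := by
    rw [long (2 * s + 1) 1 (by omega) (by omega), zigzag_two_mul_add_one 0]; omega
  have e3 : diff (2 * s + 1) b (2 * s + 2) = -3 * s - 3 := by
    rw [long (2 * s + 2) 0 (by omega) (by omega), zigzag_zero]; omega
  have e4 : diff (2 * s + 1) b (2 * s + 3) = -5 * s - 4 := by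
    rw [short (2 * s + 3) 0 (by omega), zigzag_zero]; omega
  have e5 : diff (2 * s + 1) b (2 * s + 4) = -5 * s - 5 := by
    rw [short (2 * s + 4) 1 (by omega), zigzag_two_mul_add_one 0]; omega
  have f1 : diff (2 * s + 1) b (4 * s + 1) = -4 * s - 5 := by
    rw [short (4 * s + 1) (2 * (w + 1)) (by omega), zigzag_two_mul]; omega
  have f2 : diff (2 * s + 1) b (4 * s + 2) = -6 * s - 4 := by
    rw [short (4 * s + 2) (2 * (w + 1) + 1) (by omega), zigzag_two_mul_add_one]; omega
  have f3 : diff (2 * s + 1) b (4 * s + 3) = -4 * s - 4 := by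
    rw [short (4 * s + 3) (2 * s) (by omega), zigzag_two_mul]; omega
  have h0 : frameOdd s 0 = 0 := rfl
  have hL : frameOdd s (2 * (2 * s + 1) + 1) = 4 * s + 4 := frameOdd_three (by omega)
  have hbound : ∀ r < 2 * (2 * s + 1) + 1, diff (2 * s + 1) b r ≠ 0 ∧
      |diff (2 * s + 1) b r| < (6 * (2 * s + 1) + 5 : ℕ) := by
    intro r hr
    have : -6 * s - 4 ≤ diff (2 * s + 1) b r ∧ diff (2 * s + 1) b r ≤ -2 * s - 2 := by
      rcases Nat.eq_zero_or_pos r with rfl | h1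
      · omega
      rcases Nat.lt_or_ge (2 * s + 2) r with h2 | h2
      · obtain ⟨k, rfl⟩ : ∃ k, r = 2 * s + 3 + k := ⟨r - (2 * s + 3), by omega⟩
        rw [short _ k rfl]
        have := abs_zigzag_le k
        omega
      · obtain ⟨k, hk⟩ : ∃ k, r + k = 2 * s + 2 := ⟨2 * s + 2 - r, by omega⟩
        rw [long _ k hk h1]
        have := abs_zigzag_le k
        omega
    refine ⟨by omega, ?_⟩
    rw [abs_lt]; push_cast; omega
  obtain ⟨R, hR⟩ : ∃ R : ℕ → ℕ → Prop, R = fun p p' =>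
      SharePair (block (framePos (2 * s + 1) (4 * s + 4) (frameOdd s)) (diffPos (2 * s + 1) b) p)
        (block (framePos (2 * s + 1) (4 * s + 4) (frameOdd s)) (diffPos (2 * s + 1) b) p') :=
    ⟨_, rfl⟩
  have hsucc : ∀ p, R p (p + 1) := fun p => by
    rw [hR]; exact sharePair_block_succ (diffPos_ne_zero hbound) p
  have hsucc' : ∀ p, R (p + 1) p := fun p => by
    have := hsucc p
    rw [hR] at this ⊢
    exact this.symm
  have ht : 1 ≤ 2 * s + 1 := by omega
  obtain ⟨M, hM⟩ : ∃ M, M = 2 * (2 * s + 1) + 1 := ⟨_, rfl⟩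
  -- As 3g = n + 1 ≡ 1, three periods translate by 1; the period numbers are chosen accordingly, and
  -- the argument after them counts the multiples of n left over.
  have j₁ : R (2 * s + 2 + 9 * s * M + 1) (2 * s + 1 + 3 * w * M) := by
    rw [hR, hM]
    exact sharePair_block_of_values ht h0 hL (2 * s + 3) (2 * s + 1) (9 * s) (3 * w) (2 * s + 2)
      (by ring) (by ring) (by omega) (by omega) (frameOdd_two (by omega) (by omega) (by omega))
      (frameOdd_two (by omega) (by omega) (by omega))
      (frameOdd_two (by omega) (by omega) (by omega))
      (frameOdd_two (by omega) (by omega) (by omega)) e4 e5 e2 e3 (by omega)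
      (by rw [abs_lt]; push_cast; omega) (Or.inl (by push_cast; rw [hw']; constructor <;> ring))
  have j₂ : R 1 (2 * s + 1 + 3 * w * M + 1) := by
    rw [hR, hM]
    exact sharePair_block_of_values ht h0 hL 1 (2 * s + 2) 0 (3 * w) (2 - s)
      (by ring) (by ring) (by omega) (by omega) (frameOdd_one (by omega) (by omega))
      (frameOdd_one (by omega) (by omega)) (frameOdd_two (by omega) (by omega) (by omega))
      (frameOdd_two (by omega) (by omega) (by omega)) d1 d2 e3 e4 (by omega)
      (by rw [abs_lt]; push_cast; omega) (Or.inl (by push_cast; rw [hw']; constructor <;> ring))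
  have j₃ : R (4 * s + 2 + (6 * s + 3) * M) (1 + (6 * s + 6) * M + 1) := by
    rw [hR, hM]
    exact sharePair_block_of_values ht h0 hL (4 * s + 2) 2 (6 * s + 3) (6 * s + 6) (-1)
      (by ring) (by ring) (by omega) (by omega) (frameOdd_three (by omega))
      (frameOdd_three (by omega)) (frameOdd_one (by omega) (by omega))
      (frameOdd_one (by omega) (by omega)) f2 f3 d2 d3 (by omega)
      (by rw [abs_lt]; push_cast; omega) (Or.inl (by push_cast; constructor <;> ring))
  have j₄ : R (2 * s + 2 + 9 * s * M) (1 + (6 * s + 6) * M) := by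
    rw [hR, hM]
    exact sharePair_block_of_values ht h0 hL (2 * s + 2) 1 (9 * s) (6 * s + 6) (s - 2)
      (by ring) (by ring) (by omega) (by omega) (frameOdd_two (by omega) (by omega) (by omega))
      (frameOdd_two (by omega) (by omega) (by omega)) (frameOdd_one (by omega) (by omega))
      (frameOdd_one (by omega) (by omega)) e3 e4 d1 d2 (by omega)
      (by rw [abs_lt]; push_cast; omega) (Or.inl (by push_cast; constructor <;> ring))
  have mul_le : ∀ a c, a ≤ c → a * M ≤ c * M := fun a c h => Nat.mul_le_mul_right M h
  have m₁ := mul_le (3 * w) (6 * s + 3) (by omega)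
  have m₂ := mul_le (6 * s + 3 + 1) (6 * s + 6) (by omega)
  have m₃ := mul_le (6 * s + 6) (9 * s) (by omega)
  have m₄ := mul_le (9 * s + 1) (6 * (2 * s + 1) + 5) (by omega)
  rw [add_mul (6 * s + 3), one_mul] at m₂
  rw [add_mul (9 * s), one_mul] at m₄
  obtain ⟨ord, hperm, hchain, hhead, hlast⟩ := exists_rearrangement_three
    (N := (6 * (2 * s + 1) + 5) * M) hsucc hsucc' (by omega) (by omega) (by omega) (by omega)
    (by omega) j₁ j₂ j₃ j₄
  have hframe1 : frameOdd s 1 = 2 * s + 2 := frameOdd_one (by omega) (by omega)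
  have hnn : (6 * (2 * (s : ZMod (6 * (2 * s + 1) + 5)) + 1) + 5) = 0 := by
    have := ZMod.natCast_self (6 * (2 * s + 1) + 5)
    push_cast at this
    exact this
  rw [hR] at hchain
  rw [hM] at hperm hhead hlast
  refine hasGrayTTS_of_frames (by omega) h0 hL ?_ (Or.inl ?_) ?_ ?_ ?_
    ((3 * (2 * s + 1 : ℕ) + 2 : ℤ) : ZMod (6 * (2 * s + 1) + 5))
    ((((6 * s + 4) * (4 * s + 4) + 2 * s + 2 : ℤ)) : ZMod (6 * (2 * s + 1) + 5)) (Or.inl rfl) ord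
    hperm hchain ?_ ?_
  -- Indeed 3(4s+4) = n + 1.
  · refine IsUnit.of_mul_eq_one 3 ?_
    push_cast
    linear_combination hnn
  · rw [h0, d1, hframe1]; ring
  · rw [d0, d1]
    exact intCast_eq_of_eq_add (c := -1) (by push_cast; ring)
  · intro r h1 h2
    rcases Nat.lt_or_ge r (2 * s - 1) with h | h
    · left; rw [frameOdd_one h1 (by omega), frameOdd_one (by omega) (by omega)]
    rcases Nat.eq_or_lt_of_le h with rfl | h
    · right
      rw [frameOdd_one h1 (by omega), frameOdd_two (by omega) (by omega) (by omega), e0,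
        show 2 * s - 1 + 1 = 2 * s by omega, e1]
      ring
    rcases Nat.lt_or_ge r (4 * s + 1) with h' | h'
    · left; rw [frameOdd_two (by omega) (by omega) (by omega),
        frameOdd_two (by omega) (by omega) (by omega)]
    rcases Nat.eq_or_lt_of_le h' with rfl | h'
    · right
      rw [frameOdd_two (by omega) (by omega) (by omega), f1, f2, frameOdd_three (by omega)]
      ring
    · left
      rw [frameOdd_three (by omega), frameOdd_three (by omega)]
  · intro k hk1 hk2
    push_cast at hk1 hk2
    rcases lt_or_ge k (4 * s + 4) with h | h
    · obtain ⟨j, hj, hj1, hj2⟩ := exists_zigzag_eq_int (3 * s + 3 - k)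
      have hj3 : j ≤ 2 * s + 1 := by
        rcases lt_or_ge 0 (3 * s + 3 - k) with h' | h'
        · have := hj1 h'; omega
        · have := hj2 h'; omega
      refine ⟨2 * s + 2 - j, by omega, by omega, Or.inr ?_⟩
      rw [long _ j (by omega) (by omega), hj]; ring
    · obtain ⟨j, hj, hj1, hj2⟩ := exists_zigzag_eq_int (k - (5 * s + 4))
      refine ⟨2 * s + 3 + j, by omega, ?_, Or.inr ?_⟩
      · rcases lt_or_ge 0 (k - (5 * s + 4)) with h' | h'
        · have := hj1 h'; omega
        · have := hj2 h'; omega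
      · rw [short _ j rfl, hj]; ring
  · intro p hp
    rw [hlast] at hp
    obtain rfl := Option.some.inj hp
    -- Period 6s+4 translates block 0 by (6s+4)g ≡ 6s+5 = d, so the pair of difference d sits one
    -- step after the one in period n.
    rw [show 4 * s + 2 + (6 * s + 3) * (2 * (2 * s + 1) + 1) + 1
        = 0 + (6 * s + 4) * (2 * (2 * s + 1) + 1) by ring,
      mem_block_iff ht h0 hL (by omega), mem_block_iff ht h0 hL (by omega)]
    refine ⟨Or.inr (Or.inr (Or.inl ?_)), Or.inr (Or.inl ?_)⟩
    · rw [zero_add, hframe1]; push_cast; ring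
    · rw [h0, d0]; push_cast; linear_combination hnn
  · intro p hp
    rw [hhead] at hp
    obtain rfl := Option.some.inj hp
    rw [show (6 * (2 * s + 1) + 5) * (2 * (2 * s + 1) + 1)
        = 0 + (6 * (2 * s + 1) + 5) * (2 * (2 * s + 1) + 1) by ring,
      mem_block_iff ht h0 hL (by omega), mem_block_iff ht h0 hL (by omega)]
    refine ⟨Or.inr (Or.inr (Or.inl ?_)), Or.inr (Or.inl ?_)⟩
    · rw [zero_add, hframe1]; push_cast
      linear_combination (2 * (s : ZMod (6 * (2 * s + 1) + 5)) + 1 - (4 * s + 4)) * hnn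
    · rw [h0, d0]; push_cast
      linear_combination (2 * (s : ZMod (6 * (2 * s + 1) + 5)) + 2 - (4 * s + 4)) * hnn

end Rotational

/-- The three-level construction settles v = 3m+1 for m ≥ 3 and v = 3m for odd m ≥ 5. The multiples
of 6 split modulo 12 into the two rotational families, and the explicit codes fill the gaps at small
orders. -/
theorem hasGrayTTS_of_mod_three {v : ℕ} (hv : 3 ≤ v) (h : v ≡ 0 [MOD 3] ∨ v ≡ 1 [MOD 3])
    (h3 : v ≠ 3) (h6 : v ≠ 6) : HasGrayTTS v := by
  rcases h with h | h
  · obtain ⟨m, rfl⟩ : ∃ m, v = 3 * m := ⟨v / 3, by unfold Nat.ModEq at h; omega⟩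
    rcases Nat.even_or_odd' m with ⟨k, rfl | rfl⟩
    · rcases Nat.even_or_odd' k with ⟨s, rfl | rfl⟩
      · rcases Nat.lt_or_ge s 3 with hs | hs
        · interval_cases s
          · omega
          · exact ExplicitCode.hasGrayTTS_twelve
          · exact ExplicitCode.hasGrayTTS_twentyFour
        -- The shift by one comes from 12(a+1) = 6(2a+1) + 6.
        · obtain ⟨s, rfl⟩ : ∃ a, s = a + 1 := ⟨s - 1, by omega⟩
          convert Rotational.hasGrayTTS_odd (s := s) (by omega) using 1; ring
      · rcases Nat.lt_or_ge s 3 with hs | hs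
        · interval_cases s
          · omega
          · exact ExplicitCode.hasGrayTTS_eighteen
          · exact ExplicitCode.hasGrayTTS_thirty
        · convert Rotational.hasGrayTTS_even hs using 1; ring
    · rcases Nat.lt_or_ge k 2 with hk | hk
      · interval_cases k
        · omega
        · exact ExplicitCode.hasGrayTTS_nine
      · exact Theta.hasGrayTTS_three_mul_odd hk
  · obtain ⟨m, rfl⟩ : ∃ m, v = 3 * m + 1 := ⟨v / 3, by unfold Nat.ModEq at h; omega⟩
    rcases Nat.lt_or_ge m 3 with hm | hm
    · interval_cases m
      · omega
      · exact ExplicitCode.hasGrayTTS_four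
      · exact ExplicitCode.hasGrayTTS_seven
    · obtain ⟨n, rfl⟩ : ∃ n, m = n + 1 := ⟨m - 1, by omega⟩
      exact Theta.hasGrayTTS_three_mul_add_one (by omega)

theorem theorem8p1 (v : ℕ) (hv : 3 ≤ v) :
    ((∃ (V : Type) (_ : Fintype V) (_ : DecidableEq V) (B : Multiset (Finset V)),
        IsTTS V B v ∧ (blockIntersectionGraph B 2).IsHamiltonian) ↔
      (v ≡ 0 [MOD 3] ∨ v ≡ 1 [MOD 3]) ∧ v ≠ 3 ∧ v ≠ 6) ∧
    ((∃ (V : Type) (_ : Fintype V) (_ : DecidableEq V) (B : Multiset (Finset V)),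
        IsTTS V B v ∧ ∃ c : Cycle (Finset V), IsCyclicGrayCode B 2 c) ↔
      (v ≡ 0 [MOD 3] ∨ v ≡ 1 [MOD 3]) ∧ v ≠ 3 ∧ v ≠ 6) := by
  have hcard : ∀ {V : Type} [Fintype V] [DecidableEq V] {B : Multiset (Finset V)},
      IsTTS V B v → 2 ≤ Multiset.card B ∧ (v ≠ 3 → 3 ≤ Multiset.card B) := by
    intro V _ _ B hB
    have h := hB.three_mul_card
    constructor
    · have : 3 * 2 ≤ v * (v - 1) := Nat.mul_le_mul hv (by omega)
      omega
    · intro h3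
      have : 4 * 3 ≤ v * (v - 1) := Nat.mul_le_mul (by omega) (by omega)
      omega
  constructor
  · constructor
    · rintro ⟨V, _, _, B, hB, hH⟩
      obtain ⟨c, hc⟩ := exists_isCyclicGrayCode_of_isHamiltonian
        (by have := (hcard hB).1; omega) hH
      exact ⟨hB.mod_three, hB.ne_three_of_gray hc, hB.ne_six_of_gray hc⟩
    · rintro ⟨h, h3, h6⟩
      obtain ⟨V, _, _, B, hB, c, hc⟩ := hasGrayTTS_of_mod_three hv h h3 h6
      exact ⟨V, _, _, B, hB, hc.isHamiltonian hB.card_block ((hcard hB).2 h3)⟩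
  · constructor
    · rintro ⟨V, _, _, B, hB, c, hc⟩
      exact ⟨hB.mod_three, hB.ne_three_of_gray hc, hB.ne_six_of_gray hc⟩
    · rintro ⟨h, h3, h6⟩
      exact hasGrayTTS_of_mod_three hv h h3 h6
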